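/- Let $\mathcal C$ be the space of regular closed plane curves of class $C^2$ and length $2\pi$, i.e. $2\pi$-periodic $C^2$ maps $\gamma:\mathbb R\to\mathbb R^2$ with $\gamma'(t)\ne0$ for all $t$ and $\int_0^{2\pi}|\gamma'|\,dt=2\pi$, and let $U(\gamma)=\int_0^{2\pi}\kappa_\gamma^2\,|\gamma'|\,dt$ be the Euler functional ($\kappa_\gamma$ is the curvature, and the integral is with respect to arclength). A curve $\gamma\in\mathcal C$ is *critical* if $\frac{d}{dh}\big|_{h=0}U(\Gamma_h)=0$ for every path $h\mapsto\Gamma_h\in\mathcal C$ (defined for small $h$) with $\Gamma_0=\gamma$ that is differentiable at $h=0$ in the $C^2$ norm. A curve $\gamma\in\mathcal C$ is a *local minimum* (or is *stable*) if $U(\gamma)\le U(\eta)$ for all $\eta\in\mathcal C$ sufficiently close to $\gamma$ in the $C^2$ norm. Curves are described up to isometries of the plane and orientation preserving $C^2$ changes of parameter of the circle. For $n\ge1$ let the *circle traversed $n$ times* be $t\mapsto\frac1n(\cos nt,\sin nt)$. There is a unique $k\in(0,1)$ with $\int_0^{2\pi}\frac{1-2k^2\sin^2u}{\sqrt{1-k^2\sin^2u}}\,du=0$.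 For this $k$, *Bernoulli's $\infty$-shaped closed elastica* (of length $2\pi$, traversed once) is $$B(t)=\lambda\left(\int_0^t\frac{1-2k^2\sin^2u}{\sqrt{1-k^2\sin^2u}}\,du,\;2k\cos t\right),\qquad \lambda=2\pi\Big/\int_0^{2\pi}\frac{du}{\sqrt{1-k^2\sin^2u}}.$$ Up to scale and isometry it is the closed curve whose tangent angle $\alpha$, as a function of arclength, runs through one period of an oscillating (not fully rotating) solution of the pendulum equation $\ddot\alpha+\sin\alpha=0$. The same elastica traversed $n$ times, rescaled to total length $2\pi$, is $t\mapsto\frac1nB(nt)$. **Theorem.** (i) Every critical curve $\gamma\in\mathcal C$ of $U$ is, for some $n\ge1$, either a circle traversed $n$ times or Bernoulli's closed elastica traversed $n$ times. (ii) For every $n\ge2$, Bernoulli's closed elastica traversed $n$ times belongs to $\mathcal C$ and is not stable, i.e. is not a local minimum of $U$ on $\mathcal C$. (iii) A circle traversed $n$ times, for every $n\ge1$, and Bernoulli's closed elastica traversed once belong to $\mathcal C$ and are local minima of $U$ on $\mathcal C$. -/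

import Mathlib

open Real Filter Topology

noncomputable section

namespace EulerElastica

/-! The plane `ℝ²` is `ℂ` (with its Euclidean norm); a map from the circle to the plane is a
`2π`-periodic map `ℝ → ℂ`. -/

/-- A regular closed plane curve of class `C²`, in an arbitrary regular parametrization. -/
structure IsRegularClosedCurve (γ : ℝ → ℂ) : Prop where
  contDiff : ContDiff ℝ 2 γ
  periodic : Function.Periodic γ (2 * π)
  regular : ∀ t, deriv γ t ≠ 0

/-- The length of a closed curve. -/
def length (γ : ℝ → ℂ) : ℝ := ∫ t in (0 : ℝ)..(2 * π), ‖deriv γ t‖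

/-- The signed curvature `(x' y'' - y' x'') / |γ'|³`. -/
def curvature (γ : ℝ → ℂ) (t : ℝ) : ℝ :=
  ((deriv γ t).re * (deriv (deriv γ) t).im - (deriv γ t).im * (deriv (deriv γ) t).re)
    / ‖deriv γ t‖ ^ 3

/-- The Euler functional: the integral of the squared curvature with respect to arclength. -/
def U (γ : ℝ → ℂ) : ℝ := ∫ t in (0 : ℝ)..(2 * π), curvature γ t ^ 2 * ‖deriv γ t‖

/-- The space of curves on which the Euler functional is studied:
regular closed `C²` curves of length `2π`. -/
def Curves : Set (ℝ → ℂ) := {γ | IsRegularClosedCurve γ ∧ length γ = 2 * π}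

/-- `Γ` is a variation of `γ` inside `Curves`: a path `h ↦ Γ h` in `Curves`, defined for small `h`,
that starts at `γ` and is differentiable at `h = 0`, with velocity `V`, for the `C²` norm. -/
structure IsVariation (γ : ℝ → ℂ) (Γ : ℝ → ℝ → ℂ) (V : ℝ → ℂ) : Prop where
  zero : Γ 0 = γ
  mem : ∀ᶠ h in 𝓝 (0 : ℝ), Γ h ∈ Curves
  contDiff : ContDiff ℝ 2 V
  periodic : Function.Periodic V (2 * π)
  differentiable : ∀ i : ℕ, i ≤ 2 → ∀ ε : ℝ, 0 < ε → ∀ᶠ h in 𝓝 (0 : ℝ), ∀ t : ℝ,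
    ‖iteratedDeriv i (Γ h) t - iteratedDeriv i γ t - h • iteratedDeriv i V t‖ ≤ ε * |h|

/-- `γ` is a critical curve of the Euler functional at fixed length `2π`: the first variation of
`U` vanishes along every variation of `γ` through regular closed curves of length `2π`. -/
def IsCritical (γ : ℝ → ℂ) : Prop :=
  γ ∈ Curves ∧ ∀ (Γ : ℝ → ℝ → ℂ) (V : ℝ → ℂ), IsVariation γ Γ V →
    HasDerivAt (fun h => U (Γ h)) 0 0

/-- `γ` is a local minimum of the Euler functional among the regular closed `C²` curves of
length `2π`, with respect to the `C²` topology. -/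
def IsLocalMinimum (γ : ℝ → ℂ) : Prop :=
  ∃ ε : ℝ, 0 < ε ∧ ∀ η ∈ Curves,
    (∀ i : ℕ, i ≤ 2 → ∀ t : ℝ, ‖iteratedDeriv i η t - iteratedDeriv i γ t‖ < ε) → U γ ≤ U η

/-- An orientation preserving `C²` change of parameter of the circle, lifted to `ℝ`. -/
structure IsReparametrization (φ : ℝ → ℝ) : Prop where
  contDiff : ContDiff ℝ 2 φ
  deriv_pos : ∀ t, 0 < deriv φ t
  add_period : ∀ t, φ (t + 2 * π) = φ t + 2 * π

/-- `γ` and `δ` are the same curve up to an isometry of the plane (reflections are allowed) and a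
change of parameter. -/
def SameShape (γ δ : ℝ → ℂ) : Prop :=
  ∃ (e : ℂ ≃ᵢ ℂ) (φ : ℝ → ℝ), IsReparametrization φ ∧ ∀ t, γ t = e (δ (φ t))

/-- The circle of radius `1 / n` traversed `n` times (total length `2π`). -/
def circleTimes (n : ℕ) (t : ℝ) : ℂ := (n : ℂ)⁻¹ * Complex.exp ((n * t : ℝ) * Complex.I)

/-- The horizontal velocity of the elastica of modulus `k` (see `bernoulli`). -/
def elasticaVelocity (k u : ℝ) : ℝ := (1 - 2 * k ^ 2 * sin u ^ 2) / √(1 - k ^ 2 * sin u ^ 2)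

lemma elastica_pos {k : ℝ} (h0 : 0 ≤ k) (h1 : k < 1) (u : ℝ) : 0 < 1 - k ^ 2 * sin u ^ 2 := by
  nlinarith [sin_sq_le_one u, sq_nonneg (sin u), mul_nonneg h0 h0,
    mul_le_mul_of_nonneg_left (sin_sq_le_one u) (sq_nonneg k)]

lemma elasticaVelocity_eq {k : ℝ} (h0 : 0 ≤ k) (h1 : k < 1) (u : ℝ) :
    elasticaVelocity k u = 2 * √(1 - k ^ 2 * sin u ^ 2) - (√(1 - k ^ 2 * sin u ^ 2))⁻¹ := by
  have h := elastica_pos h0 h1 u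
  have hs := Real.sq_sqrt h.le
  have hp := Real.sqrt_pos.2 h
  unfold elasticaVelocity
  field_simp
  rw [hs]; ring

lemma continuous_elasticaVelocity {k : ℝ} (h0 : 0 ≤ k) (h1 : k < 1) :
    Continuous (elasticaVelocity k) := by
  unfold elasticaVelocity
  exact Continuous.div (by fun_prop) (by fun_prop)
    (fun u => (Real.sqrt_pos.2 (elastica_pos h0 h1 u)).ne')

/-- The elastica of modulus `k` closes up if and only if this vanishes. -/
def elasticaGap (k : ℝ) : ℝ := ∫ u in (0 : ℝ)..(2 * π), elasticaVelocity k u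

lemma elasticaGap_strictAnti : StrictAntiOn elasticaGap (Set.Ico 0 1) := by
  intro a ha b hb hab
  have key : ∀ u, elasticaVelocity b u ≤ elasticaVelocity a u ∧
      (sin u ≠ 0 → elasticaVelocity b u < elasticaVelocity a u) := by
    intro u
    rw [elasticaVelocity_eq ha.1 ha.2, elasticaVelocity_eq hb.1 hb.2]
    have hbp := elastica_pos hb.1 hb.2 u
    have hsq : a ^ 2 < b ^ 2 := by nlinarith [ha.1]
    have hle : 1 - b ^ 2 * sin u ^ 2 ≤ 1 - a ^ 2 * sin u ^ 2 := by
      nlinarith [mul_le_mul_of_nonneg_right hsq.le (sq_nonneg (sin u))]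
    have hp := Real.sqrt_pos.2 hbp
    have h1 := Real.sqrt_le_sqrt hle
    have h2 := inv_anti₀ hp h1
    refine ⟨by linarith, fun hu => ?_⟩
    have hlt : 1 - b ^ 2 * sin u ^ 2 < 1 - a ^ 2 * sin u ^ 2 := by
      have : 0 < sin u ^ 2 := by positivity
      nlinarith [mul_lt_mul_of_pos_right hsq this]
    have h3 := Real.sqrt_lt_sqrt hbp.le hlt
    linarith
  apply intervalIntegral.integral_lt_integral_of_continuousOn_of_le_of_exists_lt (by positivity)
    (continuous_elasticaVelocity hb.1 hb.2).continuousOn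
    (continuous_elasticaVelocity ha.1 ha.2).continuousOn
  · intro u _
    exact (key u).1
  · exact ⟨π / 2, ⟨by positivity, by linarith [pi_pos]⟩, (key _).2 (by simp)⟩

lemma exists_elasticaGap_neg : ∃ k ∈ Set.Ioo (0 : ℝ) 1, elasticaGap k < 0 := by
  have hε : 0 < exp (-13) := exp_pos _
  have hε1 : exp (-13) < 1 := by rw [exp_lt_one_iff]; norm_num
  set ε := exp (-13) with hεdef
  have hk2 : 0 < 1 - ε ^ 2 := by nlinarith
  have hk : √(1 - ε ^ 2) ^ 2 = 1 - ε ^ 2 := Real.sq_sqrt hk2.le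
  have hk0 : 0 < √(1 - ε ^ 2) := Real.sqrt_pos.2 hk2
  have hk1 : √(1 - ε ^ 2) < 1 := by
    rw [Real.sqrt_lt' one_pos]; nlinarith
  set k := √(1 - ε ^ 2) with hkdef
  refine ⟨k, ⟨hk0, hk1⟩, ?_⟩
  have hc := continuous_elasticaVelocity hk0.le hk1
  have hle2 : ∀ u, elasticaVelocity k u ≤ 2 := by
    intro u
    rw [elasticaVelocity_eq hk0.le hk1]
    have h1 : √(1 - k ^ 2 * sin u ^ 2) ≤ 1 := by
      rw [Real.sqrt_le_left one_pos.le]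
      nlinarith [mul_nonneg (sq_nonneg k) (sq_nonneg (sin u))]
    have h2 : 0 ≤ (√(1 - k ^ 2 * sin u ^ 2))⁻¹ := by positivity
    linarith
  have hmid : ∀ u ∈ Set.Icc (π / 2) π, elasticaVelocity k u ≤ 2 - (u + (ε - π / 2))⁻¹ := by
    intro u hu
    rw [elasticaVelocity_eq hk0.le hk1]
    have h1 : √(1 - k ^ 2 * sin u ^ 2) ≤ 1 := by
      rw [Real.sqrt_le_left one_pos.le]
      nlinarith [mul_nonneg (sq_nonneg k) (sq_nonneg (sin u))]
    have hp := Real.sqrt_pos.2 (elastica_pos hk0.le hk1 u)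
    have hx : 0 ≤ u - π / 2 := by linarith [hu.1]
    have hcos : cos u ^ 2 ≤ (u - π / 2) ^ 2 := by
      have h3 : cos u = - sin (u - π / 2) := by rw [sin_sub_pi_div_two]; ring
      rw [h3, neg_sq]
      exact sq_le_sq.2 abs_sin_le_abs
    have h2 : √(1 - k ^ 2 * sin u ^ 2) ≤ u + (ε - π / 2) := by
      rw [Real.sqrt_le_left (by linarith), hk]
      nlinarith [sin_sq_add_cos_sq u, mul_nonneg hx hε.le,
        mul_nonneg (sq_nonneg ε) (sq_nonneg (cos u))]
    have h4 := inv_anti₀ hp h2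
    linarith
  have hI : ∀ a b, IntervalIntegrable (elasticaVelocity k) MeasureTheory.volume a b :=
    fun a b => hc.intervalIntegrable a b
  have e1 : ∫ u in (0 : ℝ)..(π / 2), elasticaVelocity k u ≤ π := by
    have := intervalIntegral.integral_mono_on (by positivity) (hI 0 (π / 2))
      (intervalIntegrable_const (c := (2 : ℝ))) (fun u _ => hle2 u)
    simp at this; linarith
  have e3 : ∫ u in π..(2 * π), elasticaVelocity k u ≤ 2 * π := by
    have := intervalIntegral.integral_mono_on (by linarith [pi_pos]) (hI π (2 * π))
      (intervalIntegrable_const (c := (2 : ℝ))) (fun u _ => hle2 u)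
    simp at this; linarith
  have e2 : ∫ u in (π / 2)..π, elasticaVelocity k u ≤ π - 13 := by
    have hinv : ContinuousOn (fun u : ℝ => (u + (ε - π / 2))⁻¹) (Set.uIcc (π / 2) π) := by
      refine ContinuousOn.inv₀ (by fun_prop) fun u hu => ?_
      rw [Set.uIcc_of_le (by linarith [pi_pos])] at hu
      linarith [hu.1]
    have := intervalIntegral.integral_mono_on (by linarith [pi_pos]) (hI (π / 2) π)
      ((intervalIntegrable_const (c := (2 : ℝ))).sub hinv.intervalIntegrable) hmid
    rw [intervalIntegral.integral_sub intervalIntegrable_const hinv.intervalIntegrable,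
      intervalIntegral.integral_comp_add_right (fun x : ℝ => x⁻¹),
      integral_inv_of_pos (by linarith) (by linarith [pi_pos])] at this
    have hlog : 13 ≤ log ((π + (ε - π / 2)) / (π / 2 + (ε - π / 2))) := by
      rw [Real.le_log_iff_exp_le (div_pos (by linarith [pi_pos]) (by linarith)),
        le_div_iff₀ (by linarith)]
      have : exp 13 * ε = 1 := by rw [hεdef, ← exp_add]; norm_num
      nlinarith [pi_gt_three]
    simp at this
    simp at hlog
    linarith
  have hsum : elasticaGap k = (∫ u in (0 : ℝ)..(π / 2), elasticaVelocity k u)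
      + (∫ u in (π / 2)..π, elasticaVelocity k u) + ∫ u in π..(2 * π), elasticaVelocity k u := by
    rw [intervalIntegral.integral_add_adjacent_intervals (hI _ _) (hI _ _),
      intervalIntegral.integral_add_adjacent_intervals (hI _ _) (hI _ _)]
    rfl
  rw [hsum]
  linarith [pi_lt_d2]

lemma existsUnique_modulus : ∃! k : ℝ, k ∈ Set.Ioo (0 : ℝ) 1 ∧ elasticaGap k = 0 := by
  obtain ⟨k₁, hk₁, hneg⟩ := exists_elasticaGap_neg
  have hpos : 0 < elasticaGap 0 := by
    simp [elasticaGap, elasticaVelocity, pi_pos]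
  have hcont : ContinuousOn elasticaGap (Set.Icc 0 k₁) := by
    have hc : Continuous fun p : ℝ × ℝ => 1 - (max 0 (min k₁ p.1)) ^ 2 * sin p.2 ^ 2 := by fun_prop
    have h : Continuous fun k : ℝ => elasticaGap (max 0 (min k₁ k)) := by
      unfold elasticaGap elasticaVelocity
      apply intervalIntegral.continuous_parametric_intervalIntegral_of_continuous' (μ := MeasureTheory.volume)
      refine Continuous.div (by fun_prop) (by fun_prop) fun p => ?_
      exact (Real.sqrt_pos.2 (elastica_pos (le_max_left _ _)
        (max_lt one_pos (lt_of_le_of_lt (min_le_left _ _) hk₁.2)) p.2)).ne'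
    refine h.continuousOn.congr fun k hk => ?_
    simp [min_eq_right hk.2, max_eq_right hk.1]
  obtain ⟨k, hk, hk0⟩ := intermediate_value_Icc' hk₁.1.le hcont ⟨hneg.le, hpos.le⟩
  have hk_pos : 0 < k := lt_of_le_of_ne hk.1 (by rintro rfl; exact hpos.ne' hk0)
  have hkI : k ∈ Set.Ioo (0 : ℝ) 1 := ⟨hk_pos, lt_of_le_of_lt hk.2 hk₁.2⟩
  refine ⟨k, ⟨hkI, hk0⟩, fun l hl => ?_⟩
  exact elasticaGap_strictAnti.injOn (Set.Ioo_subset_Ico_self hl.1) (Set.Ioo_subset_Ico_self hkI)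
    (hl.2.trans hk0.symm)

/-- The modulus of Bernoulli's closed elastica: the unique `k ∈ (0, 1)` for which the elastica of
modulus `k` is closed. -/
def bernoulliModulus : ℝ := existsUnique_modulus.choose

/-- The scale that gives Bernoulli's closed elastica the length `2π`. -/
def bernoulliScale : ℝ :=
  2 * π / ∫ u in (0 : ℝ)..(2 * π), (√(1 - bernoulliModulus ^ 2 * sin u ^ 2))⁻¹

/-- Bernoulli's `∞`-shaped closed elastica, of length `2π` and traversed once. With
`Δ u = √(1 - k² sin² u)`, the curve `t ↦ (∫₀ᵗ (1 - 2 k² sin² u) / Δ u du, 2 k cos t)` has speed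
`1 / Δ t`, and its tangent angle `α` is given by `sin (α / 2) = - k sin t`. As a function of the
arclength, `α` is the oscillating solution of the pendulum equation `α'' + sin α = 0` with amplitude
`2 arcsin k`; the parameter interval `[0, 2π]` is one period of the oscillation. The modulus
`k` is the only one for which the curve is closed. -/
def bernoulli (t : ℝ) : ℂ :=
  bernoulliScale * ((∫ u in (0 : ℝ)..t, elasticaVelocity bernoulliModulus u : ℝ)
    + (2 * bernoulliModulus * cos t : ℝ) * Complex.I)

/-- Bernoulli's closed elastica traversed `n` times (total length `2π`). -/
def bernoulliTimes (n : ℕ) (t : ℝ) : ℂ := (n : ℂ)⁻¹ * bernoulli (n * t)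

end EulerElastica

end

namespace EulerElastica

/-! ### Calculus preliminaries -/

/-! In the arclength parameter a curve of length `2π` is determined, up to its starting point, by
its tangent angle `θ`. Here `θ (s + 2π) = θ s + 2πm` with `m` the rotation number, closure is the
condition `∫ exp (iθ) = 0`, and the energy is `∫ θ'²`. Changes of parameter disappear; isometries
only add a constant to `θ` or negate it. The theorem becomes a statement about the Dirichlet energy
under two real constraints.

Critical curves. If `∫ ψ exp (iθ) = 0`, the implicit function theorem
(`IsClosedAngle.exists_closing`) corrects `θ + xψ` by a term `o(x)` to the angle of a closed curve,
so criticality gives `∫ θ'ψ' = 0` for all such `ψ`. Lagrange multipliers and the du Bois-Reymond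
argument yield the pendulum equation `θ'' = -μ sin (θ - c)` with `μ ≥ 0`. If `μ = 0`, then `θ` is
affine and the curve is a circle. If `μ > 0`, closure excludes full rotations
(`IsClosedAngle.exists_deriv_eq_zero`), so the pendulum comes to rest somewhere. Uniqueness for the
equation identifies `θ` with an explicit oscillation; periodicity makes the number of oscillations
an integer, and closure forces the modulus to be Bernoulli's (`oscillation_eq_bernoulliAngle`).

Stability. The rotation number is locally constant, so it is enough to minimize the energy among
closed angles with the same `m`. For circles this is `∫ (θ' - m)² ≥ 0`. For Bernoulli's elastica `m
= 0`, and some `s₀` satisfies `θ (s₀ + π) = θ s₀`. Closure allows `μ cos (θ - θ s₀)` to be added to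
the integrand `θ'² / 2` at no cost, and the problem splits into two Dirichlet problems on intervals
of length `π`. A positive arch `p` of the pendulum solves each of them (`pendulum_arch_le`): `cos`
is bounded below by its tangents as a function of the square, and the remaining quadratic form is
nonnegative because `p` is a positive solution of its linear equation `p'' + μ (sin p / p) p = 0`.

Instability. For `n ≥ 2` the angle has the period `T = 2π/n`, and `cos T ≠ 1`. Every `2π`-periodic
function of the form `g - g (· - T)` is orthogonal to the `T`-periodic function `exp (iθ)`, which
supplies many admissible variations. The second variation is `∫ (ψ'² - μ cos (θ - c) ψ²)`, with
Jacobi field `ω = θ'`. On `ψ = ω f + δ χ` it equals `∫ ω² f'²` plus a term linear in `δ` plus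
`O(δ²)`. Concentrating `f'` near a zero of `ω` and its translate by `T` makes the first term
negligible against the second, so the form takes negative values
(`IsClosedAngle.exists_second_variation_neg`). -/

lemma eq_of_hasDerivAt {E : Type*} [NormedAddCommGroup E] [NormedSpace ℝ E] {f g f' : ℝ → E}
    (hf : ∀ x, HasDerivAt f (f' x) x) (hg : ∀ x, HasDerivAt g (f' x) x) (x₀ : ℝ)
    (h₀ : f x₀ = g x₀) (x : ℝ) : f x = g x := by
  have h := is_const_of_deriv_eq_zero (f := fun x => f x - g x)
    (fun x => ((hf x).sub (hg x)).differentiableAt)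
    (fun x => by rw [((hf x).fun_sub (hg x)).deriv, sub_self]) x x₀
  simp only [h₀, sub_self] at h
  exact sub_eq_zero.1 h

lemma integral_eq_zero_of_periodic {E : Type*} [NormedAddCommGroup E] [NormedSpace ℝ E]
    [CompleteSpace E] {f f' : ℝ → E} (hf : ∀ x, HasDerivAt f (f' x) x) (hc : Continuous f')
    (hp : Function.Periodic f (2 * π)) : ∫ x in (0 : ℝ)..(2 * π), f' x = 0 := by
  rw [intervalIntegral.integral_eq_sub_of_hasDerivAt (fun x _ => hf x) (hc.intervalIntegrable _ _),
    sub_eq_zero]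
  simpa using hp 0

lemma hasDerivAt_integral {E : Type*} [NormedAddCommGroup E] [NormedSpace ℝ E]
    [CompleteSpace E] {f : ℝ → E} (hc : Continuous f) (a x : ℝ) :
    HasDerivAt (fun x => ∫ s in a..x, f s) (f x) x :=
  intervalIntegral.integral_hasDerivAt_right (hc.intervalIntegrable _ _)
    (hc.stronglyMeasurableAtFilter _ _) hc.continuousAt

lemma contDiff_one_of_hasDerivAt {E : Type*} [NormedAddCommGroup E] [NormedSpace ℝ E]
    {f f' : ℝ → E} (hf : ∀ x, HasDerivAt f (f' x) x) (hc : Continuous f') : ContDiff ℝ 1 f := by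
  have hd : deriv f = f' := funext fun x => (hf x).deriv
  exact contDiff_one_iff_deriv.2 ⟨fun x => (hf x).differentiableAt, hd ▸ hc⟩

lemma contDiff_two_of_hasDerivAt {E : Type*} [NormedAddCommGroup E] [NormedSpace ℝ E]
    {f f' : ℝ → E} (hf : ∀ x, HasDerivAt f (f' x) x) (hc : ContDiff ℝ 1 f') :
    ContDiff ℝ 2 f := by
  have hd : deriv f = f' := funext fun x => (hf x).deriv
  have := (contDiff_succ_iff_deriv (𝕜 := ℝ) (n := 1) (f := f)).2
    ⟨fun x => (hf x).differentiableAt, by simp, hd ▸ hc⟩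
  simpa [one_add_one_eq_two] using this

lemma contDiff_one_deriv {E : Type*} [NormedAddCommGroup E] [NormedSpace ℝ E] {f : ℝ → E}
    (hf : ContDiff ℝ 2 f) : ContDiff ℝ 1 (deriv f) := by
  have h : ContDiff ℝ (1 + 1) f := by simpa [one_add_one_eq_two] using hf
  exact (contDiff_succ_iff_deriv.1 h).2.2

lemma hasDerivAt_of_contDiff_one {E : Type*} [NormedAddCommGroup E] [NormedSpace ℝ E] {f : ℝ → E}
    (hf : ContDiff ℝ 1 f) (x : ℝ) : HasDerivAt f (deriv f x) x :=
  (hf.differentiable (by norm_num) x).hasDerivAt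

lemma periodic_deriv {E : Type*} [NormedAddCommGroup E] [NormedSpace ℝ E] {f : ℝ → E} {T : ℝ}
    (hf : Function.Periodic f T) : Function.Periodic (deriv f) T := fun x => by
  rw [← deriv_comp_add_const, show (fun x => f (x + T)) = f from funext hf]

lemma exists_bound_of_periodic {E : Type*} [NormedAddCommGroup E] {f : ℝ → E}
    (hp : Function.Periodic f (2 * π)) (hc : Continuous f) :
    ∃ C : ℝ, 0 < C ∧ ∀ x, ‖f x‖ ≤ C := by
  obtain ⟨C, hC⟩ := (isCompact_Icc (a := (0 : ℝ)) (b := 2 * π)).exists_bound_of_continuousOn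
    hc.continuousOn
  refine ⟨|C| + 1, by positivity, fun x => ?_⟩
  obtain ⟨y, hy, hxy⟩ := hp.exists_mem_Ico₀ (by positivity) x
  rw [hxy]
  linarith [hC y ⟨hy.1, hy.2.le⟩, le_abs_self C]

lemma integral_shift_of_periodic {E : Type*} [NormedAddCommGroup E] [NormedSpace ℝ E]
    {f : ℝ → E} (hp : Function.Periodic f (2 * π)) (a : ℝ) :
    ∫ x in (0 : ℝ)..(2 * π), f (x + a) = ∫ x in (0 : ℝ)..(2 * π), f x := by
  rw [intervalIntegral.integral_comp_add_right]
  have := hp.intervalIntegral_add_eq a 0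
  simpa [add_comm] using this

/-! ### Changes of parameter -/

namespace IsReparametrization

variable {σ φ : ℝ → ℝ}

lemma hasDerivAt (h : IsReparametrization σ) (t : ℝ) : HasDerivAt σ (deriv σ t) t :=
  (h.contDiff.differentiable (by norm_num) t).hasDerivAt

lemma continuous (h : IsReparametrization σ) : Continuous σ := h.contDiff.continuous

lemma contDiff_deriv (h : IsReparametrization σ) : ContDiff ℝ 1 (deriv σ) :=
  contDiff_one_deriv h.contDiff

lemma periodic_deriv (h : IsReparametrization σ) : Function.Periodic (deriv σ) (2 * π) :=
  fun t => by
    rw [← deriv_comp_add_const, show (fun x => σ (x + 2 * π)) = fun x => σ x + 2 * π from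
      funext h.add_period, deriv_add_const]

lemma strictMono (h : IsReparametrization σ) : StrictMono σ := strictMono_of_deriv_pos h.deriv_pos

lemma add_int_period (h : IsReparametrization σ) (t : ℝ) (n : ℤ) :
    σ (t + n * (2 * π)) = σ t + n * (2 * π) := by
  have hp : Function.Periodic (fun t => σ t - t) (2 * π) := fun t => by
    simp only [h.add_period]; ring
  have : σ (t + n * (2 * π)) - (t + n * (2 * π)) = σ t - t := hp.int_mul n t
  linarith

lemma surjective (h : IsReparametrization σ) : Function.Surjective σ := by
  intro y
  set n : ℤ := ⌊(y - σ 0) / (2 * π)⌋ with hn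
  have hπ : 0 < 2 * π := by positivity
  have h1 : σ 0 + n * (2 * π) ≤ y := by
    have := Int.floor_le ((y - σ 0) / (2 * π))
    rw [← hn, le_div_iff₀ hπ] at this; linarith
  have h2 : y ≤ σ 0 + (n + 1) * (2 * π) := by
    have := (Int.lt_floor_add_one ((y - σ 0) / (2 * π))).le
    rw [← hn, div_le_iff₀ hπ] at this; linarith
  have e1 := h.add_int_period 0 n
  have e2 := h.add_int_period 0 (n + 1)
  push_cast at e2
  obtain ⟨x, -, hx⟩ := intermediate_value_Icc
    (show (0 + n * (2 * π) : ℝ) ≤ 0 + (n + 1) * (2 * π) by nlinarith)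
    h.continuous.continuousOn (show y ∈ Set.Icc _ _ by rw [e1, e2]; exact ⟨h1, h2⟩)
  exact ⟨x, hx⟩

lemma exists_inverse (h : IsReparametrization σ) :
    ∃ τ : ℝ → ℝ, IsReparametrization τ ∧ (∀ t, τ (σ t) = t) ∧ ∀ s, σ (τ s) = s := by
  let e := (h.strictMono.orderIsoOfSurjective σ h.surjective).toHomeomorph
  have he : ∀ t, e t = σ t := fun t => rfl
  have h1 : ∀ t, e.symm (σ t) = t := fun t => by rw [← he, e.symm_apply_apply]
  have h2 : ∀ s, σ (e.symm s) = s := fun s => by rw [← he, e.apply_symm_apply]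
  have hd : ∀ s, HasDerivAt e.symm (deriv σ (e.symm s))⁻¹ s := fun s =>
    HasDerivAt.of_local_left_inverse e.symm.continuous.continuousAt (h.hasDerivAt _)
      (h.deriv_pos _).ne' (Eventually.of_forall h2)
  refine ⟨e.symm, ⟨?_, fun s => ?_, fun s => ?_⟩, h1, h2⟩
  · exact e.contDiff_symm_deriv (fun x => (h.deriv_pos x).ne') h.hasDerivAt h.contDiff
  · rw [(hd s).deriv]; exact inv_pos.2 (h.deriv_pos _)
  · apply h.strictMono.injective
    rw [h2, h.add_period, h2]

lemma comp (h : IsReparametrization σ) (h' : IsReparametrization φ) :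
    IsReparametrization (fun t => σ (φ t)) where
  contDiff := h.contDiff.comp h'.contDiff
  deriv_pos t := by
    have : HasDerivAt (fun t => σ (φ t)) _ t := (h.hasDerivAt _).comp t (h'.hasDerivAt t)
    rw [this.deriv]
    exact mul_pos (h.deriv_pos _) (h'.deriv_pos _)
  add_period t := by rw [h'.add_period, h.add_period]

lemma add_const (h : IsReparametrization σ) (c : ℝ) :
    IsReparametrization (fun t => σ t + c) where
  contDiff := h.contDiff.add contDiff_const
  deriv_pos t := by rw [deriv_add_const]; exact h.deriv_pos t
  add_period t := by rw [h.add_period]; ring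

lemma integral_comp {E : Type*} [NormedAddCommGroup E] [NormedSpace ℝ E] [CompleteSpace E]
    (h : IsReparametrization σ) {f : ℝ → E} (hf : Continuous f) (a b : ℝ) :
    ∫ t in a..b, deriv σ t • f (σ t) = ∫ s in σ a..σ b, f s :=
  intervalIntegral.integral_deriv_smul_comp (fun x _ => h.hasDerivAt x)
    h.contDiff_deriv.continuous.continuousOn hf

lemma integral_comp_period {E : Type*} [NormedAddCommGroup E] [NormedSpace ℝ E] [CompleteSpace E]
    (h : IsReparametrization σ) {f : ℝ → E} (hf : Continuous f)
    (hp : Function.Periodic f (2 * π)) :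
    ∫ t in (0 : ℝ)..(2 * π), deriv σ t • f (σ t) = ∫ s in (0 : ℝ)..(2 * π), f s := by
  rw [h.integral_comp hf]
  have h1 := h.add_period 0
  rw [zero_add] at h1
  rw [h1, hp.intervalIntegral_add_eq (σ 0) 0, zero_add]

end IsReparametrization

/-! ### Curves given by their tangent angle -/

/-- The curve with velocity `f` in the parameter `σ`. -/
noncomputable def primitiveAlong (z : ℂ) (f : ℝ → ℂ) (σ : ℝ → ℝ) (t : ℝ) : ℂ := z + ∫ s in (0 : ℝ)..σ t, f s

lemma hasDerivAt_primitiveAlong {z : ℂ} {f : ℝ → ℂ} {σ : ℝ → ℝ} (hf : Continuous f)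
    (hσ : IsReparametrization σ) (t : ℝ) :
    HasDerivAt (primitiveAlong z f σ) (((deriv σ t : ℝ) : ℂ) * f (σ t)) t := by
  have := (hasDerivAt_integral hf 0 (σ t)).scomp t (hσ.hasDerivAt t)
  have h2 : HasDerivAt (primitiveAlong z f σ) (deriv σ t • f (σ t)) t := this.const_add z
  rwa [Complex.real_smul] at h2

lemma deriv_primitiveAlong {z : ℂ} {f : ℝ → ℂ} {σ : ℝ → ℝ} (hf : Continuous f)
    (hσ : IsReparametrization σ) :
    deriv (primitiveAlong z f σ) = fun t => ((deriv σ t : ℝ) : ℂ) * f (σ t) :=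
  funext fun t => (hasDerivAt_primitiveAlong hf hσ t).deriv

lemma hasDerivAt_deriv_primitiveAlong {f f' : ℝ → ℂ} {σ : ℝ → ℝ}
    (hf : ∀ s, HasDerivAt f (f' s) s) (hσ : IsReparametrization σ) (t : ℝ) :
    HasDerivAt (fun t => ((deriv σ t : ℝ) : ℂ) * f (σ t))
      (((deriv (deriv σ) t : ℝ) : ℂ) * f (σ t) + ((deriv σ t : ℝ) : ℂ) ^ 2 * f' (σ t)) t := by
  have h1 := (hasDerivAt_of_contDiff_one hσ.contDiff_deriv t).ofReal_comp
  have h2 := (hf (σ t)).scomp t (hσ.hasDerivAt t)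
  refine (h1.mul h2).congr_deriv ?_
  rw [Complex.real_smul]
  simp only [Function.comp]
  ring

lemma contDiff_primitiveAlong {z : ℂ} {f : ℝ → ℂ} {σ : ℝ → ℝ} (hf : ContDiff ℝ 1 f)
    (hσ : IsReparametrization σ) : ContDiff ℝ 2 (primitiveAlong z f σ) := by
  refine contDiff_two_of_hasDerivAt (hasDerivAt_primitiveAlong hf.continuous hσ) ?_
  exact (Complex.ofRealCLM.contDiff.comp hσ.contDiff_deriv).mul
    (hf.comp (hσ.contDiff.of_le (by norm_num)))

lemma periodic_primitiveAlong {z : ℂ} {f : ℝ → ℂ} {σ : ℝ → ℝ} (hf : Continuous f)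
    (hp : Function.Periodic f (2 * π)) (h0 : ∫ s in (0 : ℝ)..(2 * π), f s = 0)
    (hσ : IsReparametrization σ) : Function.Periodic (primitiveAlong z f σ) (2 * π) := by
  intro t
  unfold primitiveAlong
  rw [hσ.add_period, ← intervalIntegral.integral_add_adjacent_intervals
    (hf.intervalIntegrable 0 (σ t)) (hf.intervalIntegrable _ _),
    hp.intervalIntegral_add_eq (σ t) 0, zero_add, h0, add_zero]

/-- The unit tangent vector of angle `θ`. -/
noncomputable def tangent (θ : ℝ → ℝ) (s : ℝ) : ℂ := Complex.exp (θ s * Complex.I)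

lemma norm_tangent (θ : ℝ → ℝ) (s : ℝ) : ‖tangent θ s‖ = 1 := Complex.norm_exp_ofReal_mul_I _

lemma tangent_re (θ : ℝ → ℝ) (s : ℝ) : (tangent θ s).re = cos (θ s) :=
  Complex.exp_ofReal_mul_I_re _

lemma tangent_im (θ : ℝ → ℝ) (s : ℝ) : (tangent θ s).im = sin (θ s) :=
  Complex.exp_ofReal_mul_I_im _

lemma hasDerivAt_tangent {θ : ℝ → ℝ} {θ' s : ℝ} (h : HasDerivAt θ θ' s) :
    HasDerivAt (tangent θ) (θ' * Complex.I * tangent θ s) s := by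
  have := (h.ofReal_comp.mul_const Complex.I).cexp
  exact this.congr_deriv (by rw [tangent]; ring)

lemma continuous_tangent {θ : ℝ → ℝ} (h : Continuous θ) : Continuous (tangent θ) := by
  unfold tangent; fun_prop

lemma contDiff_tangent {θ : ℝ → ℝ} (h : ContDiff ℝ 1 θ) : ContDiff ℝ 1 (tangent θ) :=
  ((Complex.ofRealCLM.contDiff.comp h).mul contDiff_const).cexp

lemma tangent_add_period {θ : ℝ → ℝ} {m : ℤ} (h : ∀ s, θ (s + 2 * π) = θ s + m * (2 * π)) :
    Function.Periodic (tangent θ) (2 * π) := fun s => by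
  unfold tangent
  rw [h]
  push_cast
  rw [show ((θ s : ℂ) + m * (2 * π)) * Complex.I = θ s * Complex.I + m * (2 * π * Complex.I) by
    ring]
  exact Complex.exp_periodic.int_mul m _

lemma periodic_deriv_angle {θ : ℝ → ℝ} {c : ℝ} (h : ∀ s, θ (s + 2 * π) = θ s + c) :
    Function.Periodic (deriv θ) (2 * π) := fun s => by
  rw [← deriv_comp_add_const, show (fun x => θ (x + 2 * π)) = fun x => θ x + c from
      funext h, deriv_add_const]

/-- `θ` is the tangent angle, as a function of arclength, of a closed `C²` curve of length `2π`
and rotation number `m`. -/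
structure IsClosedAngle (θ : ℝ → ℝ) (m : ℤ) : Prop where
  contDiff : ContDiff ℝ 1 θ
  add_period : ∀ s, θ (s + 2 * π) = θ s + m * (2 * π)
  closed : ∫ s in (0 : ℝ)..(2 * π), tangent θ s = 0

/-- `γ` starts at `z` and has tangent angle `θ` in the arclength parameter `σ`. -/
structure HasAngle (γ : ℝ → ℂ) (z : ℂ) (θ : ℝ → ℝ) (m : ℤ) (σ : ℝ → ℝ) : Prop where
  angle : IsClosedAngle θ m
  reparam : IsReparametrization σ
  eq : γ = primitiveAlong z (tangent θ) σ

namespace IsClosedAngle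

variable {θ : ℝ → ℝ} {m : ℤ}

lemma hasDerivAt (h : IsClosedAngle θ m) (s : ℝ) : HasDerivAt θ (deriv θ s) s :=
  hasDerivAt_of_contDiff_one h.contDiff s

lemma continuous_deriv (h : IsClosedAngle θ m) : Continuous (deriv θ) :=
  h.contDiff.continuous_deriv (by norm_num)

lemma periodic_deriv (h : IsClosedAngle θ m) : Function.Periodic (deriv θ) (2 * π) :=
  periodic_deriv_angle h.add_period

lemma periodic_tangent (h : IsClosedAngle θ m) : Function.Periodic (tangent θ) (2 * π) :=
  tangent_add_period h.add_period

lemma integral_cos (h : IsClosedAngle θ m) : ∫ s in (0 : ℝ)..(2 * π), cos (θ s) = 0 := by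
  have h1 := Complex.reCLM.intervalIntegral_comp_comm
    ((continuous_tangent h.contDiff.continuous).intervalIntegrable (μ := MeasureTheory.volume) 0 (2 * π))
  rw [h.closed] at h1
  simpa [tangent_re] using h1

lemma integral_sin (h : IsClosedAngle θ m) : ∫ s in (0 : ℝ)..(2 * π), sin (θ s) = 0 := by
  have h1 := Complex.imCLM.intervalIntegral_comp_comm
    ((continuous_tangent h.contDiff.continuous).intervalIntegrable (μ := MeasureTheory.volume) 0 (2 * π))
  rw [h.closed] at h1
  simpa [tangent_im] using h1

lemma integral_cos_sub (h : IsClosedAngle θ m) (c : ℝ) :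
    ∫ s in (0 : ℝ)..(2 * π), cos (θ s - c) = 0 := by
  have hc := h.contDiff.continuous
  simp only [cos_sub]
  rw [intervalIntegral.integral_add (Continuous.intervalIntegrable (by fun_prop) _ _)
    (Continuous.intervalIntegrable (by fun_prop) _ _), intervalIntegral.integral_mul_const,
    intervalIntegral.integral_mul_const, h.integral_cos, h.integral_sin]
  simp

end IsClosedAngle

namespace HasAngle

variable {γ : ℝ → ℂ} {z : ℂ} {θ : ℝ → ℝ} {m : ℤ} {σ : ℝ → ℝ}

lemma deriv_eq (h : HasAngle γ z θ m σ) :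
    deriv γ = fun t => ((deriv σ t : ℝ) : ℂ) * tangent θ (σ t) := by
  rw [h.eq, deriv_primitiveAlong (continuous_tangent h.angle.contDiff.continuous) h.reparam]

lemma norm_deriv (h : HasAngle γ z θ m σ) (t : ℝ) : ‖deriv γ t‖ = deriv σ t := by
  rw [h.deriv_eq, norm_mul, norm_tangent, mul_one, Complex.norm_real, Real.norm_eq_abs,
    abs_of_pos (h.reparam.deriv_pos t)]

lemma curvature_eq (h : HasAngle γ z θ m σ) (t : ℝ) : curvature γ t = deriv θ (σ t) := by
  have hpos := h.reparam.deriv_pos t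
  have h2 := (hasDerivAt_deriv_primitiveAlong (fun s => hasDerivAt_tangent (h.angle.hasDerivAt s))
    h.reparam t).deriv
  rw [← h.deriv_eq] at h2
  unfold curvature
  rw [h.norm_deriv, h2, h.deriv_eq, div_eq_iff (by positivity)]
  have hcs := sin_sq_add_cos_sq (θ (σ t))
  simp only [Complex.mul_re, Complex.mul_im, Complex.add_re, Complex.add_im, Complex.ofReal_re,
    Complex.ofReal_im, tangent_re, tangent_im, Complex.I_re, Complex.I_im, pow_two]
  linear_combination (deriv σ t ^ 3 * deriv θ (σ t)) * hcs

/-- The substitution `s = σ t` removes the parametrization, since the curvature is `θ' ∘ σ` and the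
speed is `σ'`. -/
lemma U_eq (h : HasAngle γ z θ m σ) : U γ = ∫ s in (0 : ℝ)..(2 * π), deriv θ s ^ 2 := by
  unfold U
  simp only [h.curvature_eq, h.norm_deriv]
  rw [← h.reparam.integral_comp_period (f := fun s => deriv θ s ^ 2)
    (h.angle.continuous_deriv.pow 2) (fun s => by simp only [h.angle.periodic_deriv s])]
  simp only [smul_eq_mul, mul_comm]

lemma mem_curves (h : HasAngle γ z θ m σ) : γ ∈ Curves := by
  refine ⟨⟨?_, ?_, fun t => ?_⟩, ?_⟩
  · rw [h.eq]; exact contDiff_primitiveAlong (contDiff_tangent h.angle.contDiff) h.reparam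
  · rw [h.eq]; exact periodic_primitiveAlong (continuous_tangent h.angle.contDiff.continuous)
      h.angle.periodic_tangent h.angle.closed h.reparam
  · rw [← norm_pos_iff, h.norm_deriv]; exact h.reparam.deriv_pos t
  · unfold length
    simp only [h.norm_deriv]
    have := h.reparam.integral_comp_period (f := fun _ => (1 : ℝ)) continuous_const
      (fun _ => rfl)
    simpa using this

end HasAngle

/-! ### Isometries of the plane and tangent angles -/

lemma tangent_add_const (θ : ℝ → ℝ) (c s : ℝ) :
    tangent (fun s => θ s + c) s = Complex.exp (c * Complex.I) * tangent θ s := by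
  simp only [tangent]
  rw [← Complex.exp_add]
  push_cast
  ring_nf

lemma tangent_const_sub (θ : ℝ → ℝ) (c s : ℝ) :
    tangent (fun s => c - θ s) s =
      Complex.exp (c * Complex.I) * (starRingEnd ℂ) (tangent θ s) := by
  simp only [tangent]
  rw [← Complex.exp_conj, ← Complex.exp_add]
  simp only [map_mul, Complex.conj_ofReal, Complex.conj_I]
  push_cast
  ring_nf

lemma integral_conj_eq (f : ℝ → ℂ) (a b : ℝ) :
    ∫ s in a..b, (starRingEnd ℂ) (f s) = (starRingEnd ℂ) (∫ s in a..b, f s) := by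
  simp only [intervalIntegral.intervalIntegral_eq_integral_uIoc, integral_conj]
  split_ifs <;> simp

/-- By Mazur-Ulam an isometry is affine, and a linear isometry of the plane is a rotation, possibly
preceded by conjugation. -/
lemma isometry_form (e : ℂ ≃ᵢ ℂ) : ∃ (c : ℝ) (b : ℂ),
    (∀ w, e w = Complex.exp (c * Complex.I) * w + b) ∨
    (∀ w, e w = Complex.exp (c * Complex.I) * (starRingEnd ℂ) w + b) := by
  have key : ∀ w, e w = e.toRealAffineIsometryEquiv.linearIsometryEquiv w + e 0 := fun w => by
    have := e.toRealAffineIsometryEquiv.map_vadd 0 w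
    simpa using this
  obtain ⟨a, ha⟩ := linear_isometry_complex e.toRealAffineIsometryEquiv.linearIsometryEquiv
  refine ⟨Complex.arg a, e 0, ?_⟩
  have hexp : Complex.exp ((Complex.arg a : ℝ) * Complex.I) = a := by
    have := Complex.norm_mul_exp_arg_mul_I (a : ℂ)
    rwa [Circle.norm_coe, Complex.ofReal_one, one_mul] at this
  rw [hexp]
  rcases ha with ha | ha
  · left; intro w; rw [key, ha]; simp [rotation_apply]
  · right; intro w; rw [key, ha]; simp [rotation_apply]

lemma IsClosedAngle.add_const {θ : ℝ → ℝ} {m : ℤ} (h : IsClosedAngle θ m) (c : ℝ) :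
    IsClosedAngle (fun s => θ s + c) m where
  contDiff := h.contDiff.add contDiff_const
  add_period s := by rw [h.add_period]; ring
  closed := by
    simp only [tangent_add_const]
    rw [intervalIntegral.integral_const_mul, h.closed, mul_zero]

lemma IsClosedAngle.const_sub {θ : ℝ → ℝ} {m : ℤ} (h : IsClosedAngle θ m) (c : ℝ) :
    IsClosedAngle (fun s => c - θ s) (-m) where
  contDiff := contDiff_const.sub h.contDiff
  add_period s := by rw [h.add_period]; push_cast; ring
  closed := by
    simp only [tangent_const_sub]
    rw [intervalIntegral.integral_const_mul, integral_conj_eq, h.closed, map_zero, mul_zero]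

/-- A rotation shifts the angle and a reflection negates it, along with the rotation number. This
carries the stability statements from the model curves to all curves of the same shape. -/
lemma SameShape.hasAngle {γ δ : ℝ → ℂ} {z : ℂ} {θ : ℝ → ℝ} {m : ℤ} {σ : ℝ → ℝ}
    (h : SameShape γ δ) (hδ : HasAngle δ z θ m σ) :
    ∃ (z' : ℂ) (c : ℝ) (σ' : ℝ → ℝ), HasAngle γ z' (fun s => θ s + c) m σ' ∨
      HasAngle γ z' (fun s => c - θ s) (-m) σ' := by
  obtain ⟨e, φ, hφ, heq⟩ := h
  obtain ⟨c, b, hc | hc⟩ := isometry_form e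
  · refine ⟨Complex.exp (c * Complex.I) * z + b, c, fun t => σ (φ t), Or.inl
      ⟨hδ.angle.add_const c, hδ.reparam.comp hφ, funext fun t => ?_⟩⟩
    rw [heq, hc, hδ.eq]
    simp only [primitiveAlong, tangent_add_const]
    rw [intervalIntegral.integral_const_mul]
    ring
  · refine ⟨Complex.exp (c * Complex.I) * (starRingEnd ℂ) z + b, c, fun t => σ (φ t), Or.inr
      ⟨hδ.angle.const_sub c, hδ.reparam.comp hφ, funext fun t => ?_⟩⟩
    rw [heq, hc, hδ.eq]
    simp only [primitiveAlong, tangent_const_sub]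
    rw [intervalIntegral.integral_const_mul, integral_conj_eq, map_add]
    ring

lemma exp_mul_I_circle (c : ℝ) : ((Circle.exp c : Circle) : ℂ) = Complex.exp (c * Complex.I) :=
  Circle.coe_exp c

/-- Converse of the preceding lemma. The shift `s₀` of the arclength origin is absorbed in the
change of parameter, and the translation part of the isometry matches the starting points. -/
lemma sameShape_of_angle {γ δ : ℝ → ℂ} {z z' : ℂ} {θ θ' : ℝ → ℝ} {m m' : ℤ} {σ σ' : ℝ → ℝ}
    (hγ : HasAngle γ z θ m σ) (hδ : HasAngle δ z' θ' m' σ') (s₀ c : ℝ)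
    (h : (∀ s, θ s = θ' (s + s₀) + c) ∨ (∀ s, θ s = c - θ' (s + s₀))) : SameShape γ δ := by
  obtain ⟨τ, hτ, -, hστ⟩ := hδ.reparam.exists_inverse
  have hcont : Continuous (tangent θ') := continuous_tangent hδ.angle.contDiff.continuous
  have hφ : IsReparametrization (fun t => τ (σ t + s₀)) := hτ.comp (hγ.reparam.add_const s₀)
  have hδφ : ∀ t, δ (τ (σ t + s₀)) = z' + (∫ s in (0 : ℝ)..s₀, tangent θ' s) +
      ∫ s in (0 : ℝ)..σ t, tangent θ' (s + s₀) := fun t => by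
    rw [hδ.eq, primitiveAlong, hστ, intervalIntegral.integral_comp_add_right, zero_add, add_assoc,
      intervalIntegral.integral_add_adjacent_intervals (hcont.intervalIntegrable _ _)
      (hcont.intervalIntegrable _ _)]
  rcases h with h | h
  · refine ⟨(rotation (Circle.exp c)).toIsometryEquiv.trans (IsometryEquiv.addRight
      (z - Complex.exp (c * Complex.I) * (z' + ∫ s in (0 : ℝ)..s₀, tangent θ' s))), _, hφ,
      fun t => ?_⟩
    simp only [IsometryEquiv.trans_apply, LinearIsometryEquiv.coe_toIsometryEquiv, rotation_apply,
      IsometryEquiv.addRight_apply, exp_mul_I_circle, hδφ]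
    rw [hγ.eq, primitiveAlong, show θ = fun s => θ' (s + s₀) + c from funext h]
    simp only [tangent_add_const (fun s => θ' (s + s₀))]
    rw [intervalIntegral.integral_const_mul]
    simp only [tangent]
    ring
  · refine ⟨(Complex.conjLIE.trans (rotation (Circle.exp c))).toIsometryEquiv.trans
      (IsometryEquiv.addRight (z - Complex.exp (c * Complex.I) *
        (starRingEnd ℂ) (z' + ∫ s in (0 : ℝ)..s₀, tangent θ' s))), _, hφ, fun t => ?_⟩
    simp only [IsometryEquiv.trans_apply, LinearIsometryEquiv.coe_toIsometryEquiv, rotation_apply,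
      IsometryEquiv.addRight_apply, exp_mul_I_circle, hδφ, LinearIsometryEquiv.trans_apply,
      Complex.conjLIE_apply]
    rw [hγ.eq, primitiveAlong, show θ = fun s => c - θ' (s + s₀) from funext h]
    simp only [tangent_const_sub (fun s => θ' (s + s₀))]
    rw [intervalIntegral.integral_const_mul, integral_conj_eq]
    simp only [tangent, map_add]
    ring

/-! ### Every curve has a tangent angle -/

/-- If `T = exp (iθ)` then `conj T * T' = iθ'`, which dictates `θ` as an integral. Conversely,
differentiating `‖T‖² = 1` shows that `conj T * T'` is imaginary, hence `T * conj (exp (iθ))` is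
constant, and it is `1` at `0`. -/
lemma exists_angle_of_norm_one {T : ℝ → ℂ} (hT : ContDiff ℝ 1 T) (h1 : ∀ s, ‖T s‖ = 1) :
    ∃ θ : ℝ → ℝ, ContDiff ℝ 1 θ ∧ (∀ s, T s = tangent θ s) ∧
      ∀ s, deriv θ s = ((starRingEnd ℂ) (T s) * deriv T s).im := by
  have hTc := hT.continuous
  have hT'c : Continuous (deriv T) := hT.continuous_deriv (by norm_num)
  have hcont : Continuous fun s => ((starRingEnd ℂ) (T s) * deriv T s).im := by fun_prop
  let θ : ℝ → ℝ := fun s => Complex.arg (T 0) + ∫ r in (0 : ℝ)..s,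
    ((starRingEnd ℂ) (T r) * deriv T r).im
  have hθ : ∀ s, HasDerivAt θ (((starRingEnd ℂ) (T s) * deriv T s).im) s := fun s =>
    (hasDerivAt_integral hcont 0 s).const_add _
  have hsq : ∀ s, (T s).re ^ 2 + (T s).im ^ 2 = 1 := fun s => by
    have := Complex.sq_norm (T s)
    rw [h1, Complex.normSq_apply] at this
    linarith
  have hdT : ∀ s, HasDerivAt T (deriv T s) s := hasDerivAt_of_contDiff_one hT
  have horth : ∀ s, (T s).re * (deriv T s).re + (T s).im * (deriv T s).im = 0 := fun s => by
    have hre : HasDerivAt (fun s => (T s).re) (deriv T s).re s :=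
      Complex.reCLM.hasFDerivAt.comp_hasDerivAt s (hdT s)
    have him : HasDerivAt (fun s => (T s).im) (deriv T s).im s :=
      Complex.imCLM.hasFDerivAt.comp_hasDerivAt s (hdT s)
    have h2 := ((hre.pow 2).add (him.pow 2)).congr_of_eventuallyEq
      (f₁ := fun _ => (1 : ℝ)) (Eventually.of_forall fun r => by
        simp only [Pi.add_apply, Pi.pow_apply, hsq])
    have := h2.unique (hasDerivAt_const s (1 : ℝ))
    simp at this
    linarith
  have hprod : ∀ s, HasDerivAt (fun s => T s * (starRingEnd ℂ) (tangent θ s)) 0 s := fun s => by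
    have ht := hasDerivAt_tangent (hθ s)
    have htc : HasDerivAt (fun s => (starRingEnd ℂ) (tangent θ s)) _ s :=
      Complex.conjCLE.toContinuousLinearMap.hasFDerivAt.comp_hasDerivAt s ht
    refine ((hdT s).mul htc).congr_deriv ?_
    simp only [ContinuousLinearEquiv.coe_coe, Complex.conjCLE_apply, map_mul, Complex.conj_ofReal,
      Complex.conj_I]
    rw [← mul_assoc, ← add_mul]
    convert zero_mul _
    have a := hsq s
    have b := horth s
    apply Complex.ext
    · simp
      linear_combination (-(deriv T s).re) * a + (T s).re * b
    · simp
      linear_combination (-(deriv T s).im) * a + (T s).im * b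
  have hone : ∀ s, tangent θ s * (starRingEnd ℂ) (tangent θ s) = 1 := fun s => by
    rw [Complex.mul_conj, Complex.normSq_eq_norm_sq, norm_tangent]; simp
  have h0 : tangent θ 0 = T 0 := by
    have := Complex.norm_mul_exp_arg_mul_I (T 0)
    simpa [tangent, θ, h1] using this
  refine ⟨θ, contDiff_one_of_hasDerivAt hθ hcont, fun s => ?_, fun s => (hθ s).deriv⟩
  have h2 := eq_of_hasDerivAt hprod (fun s => hasDerivAt_const s (1 : ℂ)) 0
    (by rw [← h0, hone]) s
  calc T s = T s * (tangent θ s * (starRingEnd ℂ) (tangent θ s)) := by rw [hone, mul_one]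
    _ = (T s * (starRingEnd ℂ) (tangent θ s)) * tangent θ s := by ring
    _ = tangent θ s := by rw [h2, one_mul]

/-- Here `σ` is the arclength, `τ` its inverse, and `T` the unit tangent as a function of arclength.
-/
lemma exists_hasAngle {γ : ℝ → ℂ} (h : γ ∈ Curves) :
    ∃ (z : ℂ) (θ : ℝ → ℝ) (m : ℤ) (σ : ℝ → ℝ), HasAngle γ z θ m σ := by
  obtain ⟨⟨hC, hP, hR⟩, hL⟩ := h
  have hγ' : ContDiff ℝ 1 (deriv γ) := contDiff_one_deriv hC
  have hn : ContDiff ℝ 1 fun t => ‖deriv γ t‖ := hγ'.norm ℝ hR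
  have hnp : Function.Periodic (fun t => ‖deriv γ t‖) (2 * π) := fun t => by
    simp only [periodic_deriv hP t]
  set σ : ℝ → ℝ := fun t => ∫ r in (0 : ℝ)..t, ‖deriv γ r‖ with hσdef
  have hσd : ∀ t, HasDerivAt σ ‖deriv γ t‖ t := hasDerivAt_integral hn.continuous 0
  have hσ : IsReparametrization σ := by
    refine ⟨contDiff_two_of_hasDerivAt hσd hn, fun t => ?_, fun t => ?_⟩
    · rw [(hσd t).deriv]; exact norm_pos_iff.2 (hR t)
    · simp only [hσdef]
      rw [← intervalIntegral.integral_add_adjacent_intervals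
        (hn.continuous.intervalIntegrable 0 t) (hn.continuous.intervalIntegrable _ _),
        hnp.intervalIntegral_add_eq t 0, zero_add]
      exact congrArg _ hL
  obtain ⟨τ, hτ, hτσ, hστ⟩ := hσ.exists_inverse
  have hτd : ∀ s, deriv τ s = ‖deriv γ (τ s)‖⁻¹ := fun s => by
    have h1 : HasDerivAt (fun s => σ (τ s)) (‖deriv γ (τ s)‖ * deriv τ s) s :=
      (hσd (τ s)).comp s (hτ.hasDerivAt s)
    have h2 := h1.unique ((hasDerivAt_id s).congr_of_eventuallyEq (Eventually.of_forall hστ))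
    exact eq_inv_of_mul_eq_one_right h2
  set T : ℝ → ℂ := fun s => ((deriv τ s : ℝ) : ℂ) * deriv γ (τ s) with hTdef
  have hT : ContDiff ℝ 1 T := (Complex.ofRealCLM.contDiff.comp hτ.contDiff_deriv).mul
    (hγ'.comp (hτ.contDiff.of_le (by norm_num)))
  have hβ : ∀ s, HasDerivAt (fun s => γ (τ s)) (T s) s := fun s => by
    have := ((hC.differentiable (by norm_num) (τ s)).hasDerivAt).scomp s (hτ.hasDerivAt s)
    rw [Complex.real_smul] at this
    exact this
  have hT1 : ∀ s, ‖T s‖ = 1 := fun s => by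
    rw [hTdef]
    simp only [norm_mul, Complex.norm_real, hτd, norm_inv, norm_norm]
    exact inv_mul_cancel₀ (norm_ne_zero_iff.2 (hR _))
  have hTp : Function.Periodic T (2 * π) := fun s => by
    simp only [hTdef, hτ.periodic_deriv s, hτ.add_period, periodic_deriv hP (τ s)]
  obtain ⟨θ, hθ, hTθ, hθd⟩ := exists_angle_of_norm_one hT hT1
  have hθ' : Function.Periodic (deriv θ) (2 * π) := fun s => by
    rw [hθd, hθd, hTp s, periodic_deriv hTp s]
  have hT0 : tangent θ (2 * π) = tangent θ 0 := by
    rw [← hTθ, ← hTθ]; simpa using hTp 0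
  obtain ⟨m, hm⟩ : ∃ m : ℤ, θ (2 * π) = θ 0 + m * (2 * π) := by
    obtain ⟨m, hm⟩ := Complex.exp_eq_exp_iff_exists_int.1 hT0
    refine ⟨m, ?_⟩
    have := congrArg Complex.im hm
    simpa using this
  -- The increment of `θ` over a period does not depend on `s`, because `θ'` is periodic; at `0` it
  -- is an integer multiple of `2π`.
  have hm' : ∀ s, θ (s + 2 * π) = θ s + m * (2 * π) := by
    refine eq_of_hasDerivAt (f' := deriv θ) (fun s => ?_) (fun s => ?_) 0 (by simpa using hm)
    · have := (hasDerivAt_of_contDiff_one hθ (s + 2 * π)).comp_add_const s (2 * π)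
      rwa [hθ' s] at this
    · exact (hasDerivAt_of_contDiff_one hθ s).add_const _
  have hTt : T = tangent θ := funext hTθ
  have hint : ∀ a b, ∫ s in a..b, tangent θ s = γ (τ b) - γ (τ a) := fun a b => by
    rw [← hTt]
    exact intervalIntegral.integral_eq_sub_of_hasDerivAt (fun x _ => hβ x)
      (hT.continuous.intervalIntegrable _ _)
  refine ⟨γ (τ 0), θ, m, σ, ⟨hθ, hm', ?_⟩, hσ, funext fun t => ?_⟩
  · have e := hτ.add_period 0
    rw [zero_add] at e
    rw [hint, e, hP, sub_self]
  · rw [primitiveAlong, hint, hτσ]; ring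

/-! ### Restoring closure -/

lemma norm_exp_mul_I_sub_one_le (a : ℝ) : ‖Complex.exp (a * Complex.I) - 1‖ ≤ |a| := by
  have := Real.norm_exp_I_mul_ofReal_sub_one_le (x := a)
  rwa [mul_comm, Real.norm_eq_abs] at this

lemma norm_exp_mul_I_sub_one_sub_le (a : ℝ) :
    ‖Complex.exp (a * Complex.I) - 1 - a * Complex.I‖ ≤ 2 * a ^ 2 := by
  have hn : ‖(a : ℂ) * Complex.I‖ = |a| := by simp
  by_cases ha : |a| ≤ 1
  · have := Complex.norm_exp_sub_one_sub_id_le (x := a * Complex.I) (by rwa [hn])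
    rw [hn, sq_abs] at this
    nlinarith [sq_nonneg a]
  · have h1 := norm_sub_le (Complex.exp (a * Complex.I) - 1) (a * Complex.I)
    have h2 := norm_exp_mul_I_sub_one_le a
    rw [hn] at h1
    have : a ^ 2 = |a| ^ 2 := (sq_abs a).symm
    nlinarith

/-- The factor `|a| + |b|` in front of `|a - b|` is what strict differentiability of the end point
map at `0` requires. -/
lemma norm_exp_mul_I_sub_sub_le (a b : ℝ) :
    ‖Complex.exp (a * Complex.I) - Complex.exp (b * Complex.I) - (a - b : ℝ) * Complex.I‖
      ≤ 3 * (|a| + |b|) * |a - b| := by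
  have e : Complex.exp (a * Complex.I) - Complex.exp (b * Complex.I) - (a - b : ℝ) * Complex.I =
      Complex.exp (b * Complex.I) *
        (Complex.exp ((a - b : ℝ) * Complex.I) - 1 - (a - b : ℝ) * Complex.I) +
      (Complex.exp (b * Complex.I) - 1) * ((a - b : ℝ) * Complex.I) := by
    have : Complex.exp (a * Complex.I) =
        Complex.exp (b * Complex.I) * Complex.exp ((a - b : ℝ) * Complex.I) := by
      rw [← Complex.exp_add]; push_cast; ring_nf
    rw [this]; ring
  rw [e]
  refine (norm_add_le _ _).trans ?_
  rw [norm_mul, norm_mul, Complex.norm_exp_ofReal_mul_I, one_mul]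
  have h1 := norm_exp_mul_I_sub_one_sub_le (a - b)
  have h2 := norm_exp_mul_I_sub_one_le b
  have h3 : ‖((a - b : ℝ) : ℂ) * Complex.I‖ = |a - b| := by
    rw [norm_mul, Complex.norm_I, mul_one, Complex.norm_real, Real.norm_eq_abs]
  rw [h3]
  have h4 : (a - b) ^ 2 = |a - b| * |a - b| := by rw [← sq, sq_abs]
  have h5 := mul_le_mul_of_nonneg_right (abs_sub a b) (abs_nonneg (a - b))
  have h6 := mul_le_mul_of_nonneg_right h2 (abs_nonneg (a - b))
  have h7 := mul_nonneg (abs_nonneg a) (abs_nonneg (a - b))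
  nlinarith

lemma eq_zero_of_integral_eq_zero {f : ℝ → ℝ} (hc : Continuous f)
    (hp : Function.Periodic f (2 * π)) (h0 : ∀ x, 0 ≤ f x)
    (hi : ∫ x in (0 : ℝ)..(2 * π), f x = 0) (x : ℝ) : f x = 0 := by
  by_contra hx
  obtain ⟨y, hy, hxy⟩ := hp.exists_mem_Ico₀ (by positivity) x
  have := intervalIntegral.integral_lt_integral_of_continuousOn_of_le_of_exists_lt
    (f := fun _ => (0 : ℝ)) (g := f) (a := 0) (b := 2 * π) (by positivity) continuousOn_const
    hc.continuousOn (fun x _ => h0 x)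
    ⟨y, ⟨hy.1, hy.2.le⟩, lt_of_le_of_ne (h0 y) (by rw [← hxy]; exact Ne.symm hx)⟩
  simp [hi] at this

/-- A straight segment does not close up. -/
lemma IsClosedAngle.not_deriv_eq_zero {θ : ℝ → ℝ} {m : ℤ} (h : IsClosedAngle θ m) :
    ¬ ∀ s, deriv θ s = 0 := by
  intro h0
  have hc : ∀ s, θ s = θ 0 := fun s => is_const_of_deriv_eq_zero
    (h.contDiff.differentiable (by norm_num)) h0 s 0
  have := h.closed
  simp only [tangent, hc] at this
  simp [Complex.exp_ne_zero, pi_ne_zero] at this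

/-- The component of the unit tangent vector in the direction `w`. -/
noncomputable def tangentComponent (θ : ℝ → ℝ) (w : ℂ) (s : ℝ) : ℝ :=
  w.re * cos (θ s) + w.im * sin (θ s)

lemma abs_tangentComponent_le (θ : ℝ → ℝ) (w : ℂ) (s : ℝ) :
    |tangentComponent θ w s| ≤ 2 * ‖w‖ := by
  unfold tangentComponent
  refine (abs_add_le _ _).trans ?_
  rw [abs_mul, abs_mul]
  have h1 := mul_le_mul (Complex.abs_re_le_norm w) (abs_cos_le_one (θ s)) (abs_nonneg _)
    (norm_nonneg w)
  have h2 := mul_le_mul (Complex.abs_im_le_norm w) (abs_sin_le_one (θ s)) (abs_nonneg _)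
    (norm_nonneg w)
  linarith

lemma hasDerivAt_tangentComponent {θ : ℝ → ℝ} {θ' s : ℝ} (h : HasDerivAt θ θ' s) (w : ℂ) :
    HasDerivAt (tangentComponent θ w) (θ' * (w.im * cos (θ s) - w.re * sin (θ s))) s := by
  refine (((h.cos).const_mul w.re).add ((h.sin).const_mul w.im)).congr_deriv ?_
  ring

lemma continuous_tangentComponent {θ : ℝ → ℝ} (h : Continuous θ) (w : ℂ) :
    Continuous (tangentComponent θ w) := by
  unfold tangentComponent; fun_prop

lemma contDiff_tangentComponent {θ : ℝ → ℝ} (h : ContDiff ℝ 1 θ) (w : ℂ) :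
    ContDiff ℝ 1 (tangentComponent θ w) := by
  unfold tangentComponent; fun_prop

lemma tangentComponent_sub (θ : ℝ → ℝ) (w w' : ℂ) (s : ℝ) :
    tangentComponent θ (w - w') s = tangentComponent θ w s - tangentComponent θ w' s := by
  simp only [tangentComponent, Complex.sub_re, Complex.sub_im]; ring

@[simp] lemma tangentComponent_zero (θ : ℝ → ℝ) (s : ℝ) : tangentComponent θ 0 s = 0 := by
  simp [tangentComponent]

lemma periodic_tangentComponent {θ : ℝ → ℝ} {m : ℤ} (h : IsClosedAngle θ m) (w : ℂ) :
    Function.Periodic (tangentComponent θ w) (2 * π) := fun s => by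
  have := h.periodic_tangent s
  simp only [tangentComponent, ← tangent_re, ← tangent_im, this]

/-- Differentiating, `θ'` times the component normal to the tangent vanishes too. Where `θ' ≠ 0`,
both components of `w` are then zero; and `θ'` cannot vanish identically. -/
lemma IsClosedAngle.eq_zero_of_tangentComponent {θ : ℝ → ℝ} {m : ℤ} (h : IsClosedAngle θ m)
    {w : ℂ} (hw : ∀ s, tangentComponent θ w s = 0) : w = 0 := by
  by_contra hne
  refine h.not_deriv_eq_zero fun s => ?_
  have h1 := (hasDerivAt_tangentComponent (h.hasDerivAt s) w).unique
    ((hasDerivAt_const s (0 : ℝ)).congr_of_eventuallyEq (Eventually.of_forall hw))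
  have h2 := hw s
  unfold tangentComponent at h2
  rcases mul_eq_zero.1 h1 with h3 | h3
  · exact h3
  · refine absurd ?_ hne
    have h4 := sin_sq_add_cos_sq (θ s)
    apply Complex.ext
    · simp only [Complex.zero_re]
      linear_combination cos (θ s) * h2 - sin (θ s) * h3 - w.re * h4
    · simp only [Complex.zero_im]
      linear_combination sin (θ s) * h2 + cos (θ s) * h3 - w.im * h4

/-- The first variation of the end point of the curve with tangent angle `θ`. -/
noncomputable def endpointVariation (θ ψ : ℝ → ℝ) : ℂ :=
  ∫ s in (0 : ℝ)..(2 * π), (ψ s : ℂ) * tangent θ s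

lemma endpointVariation_add_mul {θ ψ χ : ℝ → ℝ} (hθ : Continuous θ) (hψ : Continuous ψ)
    (hχ : Continuous χ) (a b : ℝ) :
    endpointVariation θ (fun s => a * ψ s + b * χ s) =
      a * endpointVariation θ ψ + b * endpointVariation θ χ := by
  have := continuous_tangent hθ
  unfold endpointVariation
  rw [← intervalIntegral.integral_const_mul, ← intervalIntegral.integral_const_mul,
    ← intervalIntegral.integral_add (Continuous.intervalIntegrable (by fun_prop) _ _)
    (Continuous.intervalIntegrable (by fun_prop) _ _)]
  congr 1
  funext s
  push_cast; ring

lemma endpointVariation_re {θ ψ : ℝ → ℝ} (hθ : Continuous θ) (hψ : Continuous ψ) :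
    (endpointVariation θ ψ).re = ∫ s in (0 : ℝ)..(2 * π), ψ s * cos (θ s) := by
  have := continuous_tangent hθ
  have h1 := Complex.reCLM.intervalIntegral_comp_comm
    ((show Continuous fun s => (ψ s : ℂ) * tangent θ s by fun_prop).intervalIntegrable
      (μ := MeasureTheory.volume) 0 (2 * π))
  simpa [tangent_re, endpointVariation] using h1.symm

lemma endpointVariation_im {θ ψ : ℝ → ℝ} (hθ : Continuous θ) (hψ : Continuous ψ) :
    (endpointVariation θ ψ).im = ∫ s in (0 : ℝ)..(2 * π), ψ s * sin (θ s) := by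
  have := continuous_tangent hθ
  have h1 := Complex.imCLM.intervalIntegral_comp_comm
    ((show Continuous fun s => (ψ s : ℂ) * tangent θ s by fun_prop).intervalIntegrable
      (μ := MeasureTheory.volume) 0 (2 * π))
  simpa [tangent_im, endpointVariation] using h1.symm

lemma endpointVariation_tangentComponent {θ : ℝ → ℝ} (hθ : Continuous θ) (w : ℂ) :
    endpointVariation θ (tangentComponent θ w) =
      w.re * endpointVariation θ (fun s => cos (θ s)) +
      w.im * endpointVariation θ (fun s => sin (θ s)) :=
  endpointVariation_add_mul hθ (by fun_prop) (by fun_prop) _ _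

/-- The map is the Gram matrix of `cos θ` and `sin θ`: the inner product of its value at `w` with
`w` is the integral of the squared component. -/
lemma IsClosedAngle.endpointVariation_tangentComponent_injective {θ : ℝ → ℝ} {m : ℤ}
    (h : IsClosedAngle θ m) {w : ℂ} (hw : endpointVariation θ (tangentComponent θ w) = 0) :
    w = 0 := by
  have hθ := h.contDiff.continuous
  have hc := continuous_tangentComponent hθ w
  have h1 := endpointVariation_re hθ hc
  have h2 := endpointVariation_im hθ hc
  rw [hw] at h1 h2
  have h3 : ∫ s in (0 : ℝ)..(2 * π), tangentComponent θ w s ^ 2 = 0 := by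
    calc ∫ s in (0 : ℝ)..(2 * π), tangentComponent θ w s ^ 2
        = ∫ s in (0 : ℝ)..(2 * π), (w.re * (tangentComponent θ w s * cos (θ s)) +
            w.im * (tangentComponent θ w s * sin (θ s))) := by
          congr 1; funext s; simp only [tangentComponent]; ring
      _ = 0 := by
          rw [intervalIntegral.integral_add (Continuous.intervalIntegrable (by fun_prop) _ _)
            (Continuous.intervalIntegrable (by fun_prop) _ _), intervalIntegral.integral_const_mul,
            intervalIntegral.integral_const_mul, ← h1, ← h2]
          simp
  refine h.eq_zero_of_tangentComponent fun s => ?_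
  have := eq_zero_of_integral_eq_zero (hc.pow 2)
    (fun s => congrArg (· ^ 2) (periodic_tangentComponent h w s)) (fun s => sq_nonneg _) h3 s
  exact pow_eq_zero_iff (two_ne_zero) |>.1 this

lemma IsClosedAngle.endpointVariation_tangentComponent_surjective {θ : ℝ → ℝ} {m : ℤ}
    (h : IsClosedAngle θ m) :
    ∃ E : ℂ ≃L[ℝ] ℂ, ∀ w, E w = endpointVariation θ (tangentComponent θ w) := by
  let L : ℂ →ₗ[ℝ] ℂ :=
    { toFun := fun w => endpointVariation θ (tangentComponent θ w)
      map_add' := fun w w' => by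
        simp only [endpointVariation_tangentComponent h.contDiff.continuous, Complex.add_re,
          Complex.add_im]
        push_cast; ring
      map_smul' := fun c w => by
        simp only [endpointVariation_tangentComponent h.contDiff.continuous, RingHom.id_apply,
          Complex.real_smul, Complex.re_ofReal_mul, Complex.im_ofReal_mul]
        push_cast; ring }
  have hL : Function.Injective L := (injective_iff_map_eq_zero L).2 fun w hw =>
    h.endpointVariation_tangentComponent_injective hw
  exact ⟨(LinearEquiv.ofInjectiveEndo L hL).toContinuousLinearEquiv, fun w => rfl⟩

/-- An admissible first variation of the tangent angle can be corrected to second order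
to give closed curves. -/
lemma IsClosedAngle.exists_closing {θ : ℝ → ℝ} {m : ℤ} (h : IsClosedAngle θ m) {ψ : ℝ → ℝ}
    (hψ : Continuous ψ) (hp : Function.Periodic ψ (2 * π)) (h0 : endpointVariation θ ψ = 0) :
    ∃ w : ℝ → ℂ, w 0 = 0 ∧ HasDerivAt w 0 0 ∧ ∀ᶠ x in 𝓝 (0 : ℝ), ∫ s in (0 : ℝ)..(2 * π),
      tangent (fun s => θ s + (x * ψ s + tangentComponent θ (w x) s)) s = 0 := by
  have hθ := h.contDiff.continuous
  have htc := continuous_tangent hθ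
  obtain ⟨E, hE⟩ := h.endpointVariation_tangentComponent_surjective
  obtain ⟨C, hC0, hC⟩ := exists_bound_of_periodic hp hψ
  let u : ℝ × ℂ → ℝ → ℝ := fun x s => x.1 * ψ s + tangentComponent θ x.2 s
  have huc : ∀ x, Continuous (u x) := fun x =>
    (continuous_const.mul hψ).add (continuous_tangentComponent hθ _)
  have hub : ∀ x s, |u x s| ≤ (C + 2) * ‖x‖ := fun x s => by
    refine (abs_add_le _ _).trans ?_
    rw [abs_mul]
    have h1 : |x.1| ≤ ‖x‖ := norm_fst_le x
    have h2 : ‖x.2‖ ≤ ‖x‖ := norm_snd_le x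
    have h3 := abs_tangentComponent_le θ x.2 s
    have h4 := mul_le_mul h1 (hC s) (abs_nonneg _) (norm_nonneg x)
    rw [Real.norm_eq_abs] at h4
    linarith
  have husub : ∀ x y s, u x s - u y s = u (x - y) s := fun x y s => by
    simp only [u, Prod.fst_sub, Prod.snd_sub, tangentComponent_sub]; ring
  -- The end point of the curve with perturbed angle; closed curves are its zeros. The unknowns are
  -- the size `x` of the variation and the correction `w`.
  let F : ℝ × ℂ → ℂ := fun x => ∫ s in (0 : ℝ)..(2 * π), tangent (fun s => θ s + u x s) s
  -- The derivative of `F` at `0`. The variable `x` does not occur in it because `ψ` preserves the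
  -- end point to first order.
  let D : ℝ × ℂ →L[ℝ] ℂ := Complex.I •
    ((E : ℂ →L[ℝ] ℂ) ∘L ContinuousLinearMap.snd ℝ ℝ ℂ)
  have hDu : ∀ x, D x = Complex.I * endpointVariation θ (u x) := fun x => by
    have h1 := endpointVariation_add_mul hθ hψ (continuous_tangentComponent hθ x.2) x.1 1
    simp only [one_mul, h0, mul_zero, zero_add, Complex.ofReal_one] at h1
    simp only [D, u]
    rw [h1, ← hE]
    simp
  have hF : HasStrictFDerivAt F D (0 : ℝ × ℂ) := by
    rw [hasStrictFDerivAt_iff_isLittleO, Asymptotics.isLittleO_iff]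
    intro c hc
    set K := 3 * (C + 2) ^ 2 * (2 * π) with hK
    have hK0 : 0 < K := by positivity
    have hnhds : ∀ᶠ p : (ℝ × ℂ) × (ℝ × ℂ) in 𝓝 (0, 0), K * (‖p.1‖ + ‖p.2‖) < c := by
      have : Continuous fun p : (ℝ × ℂ) × (ℝ × ℂ) => K * (‖p.1‖ + ‖p.2‖) := by fun_prop
      have h1 := this.tendsto (0, 0)
      simp only [norm_zero, add_zero, mul_zero] at h1
      exact h1.eventually (gt_mem_nhds hc)
    filter_upwards [hnhds] with p hp
    have hint : F p.1 - F p.2 - D (p.1 - p.2) = ∫ s in (0 : ℝ)..(2 * π), tangent θ s *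
        (Complex.exp (u p.1 s * Complex.I) - Complex.exp (u p.2 s * Complex.I) -
          (u p.1 s - u p.2 s : ℝ) * Complex.I) := by
      have e1 := huc p.1
      have e2 := huc p.2
      have e3 := huc (p.1 - p.2)
      have c1 := continuous_tangent (θ := fun s => θ s + u p.1 s) (hθ.add e1)
      have c2 := continuous_tangent (θ := fun s => θ s + u p.2 s) (hθ.add e2)
      rw [hDu]
      simp only [F, endpointVariation]
      rw [← intervalIntegral.integral_const_mul, ← intervalIntegral.integral_sub
        (c1.intervalIntegrable _ _) (c2.intervalIntegrable _ _), ← intervalIntegral.integral_sub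
        ((c1.fun_sub c2).intervalIntegrable _ _) (Continuous.intervalIntegrable (by fun_prop) _ _)]
      congr 1
      funext s
      rw [husub]
      simp only [tangent]
      push_cast
      rw [add_mul, add_mul, Complex.exp_add, Complex.exp_add]
      ring
    rw [hint]
    have hbound : ∀ s ∈ Set.uIoc 0 (2 * π), ‖tangent θ s *
        (Complex.exp (u p.1 s * Complex.I) - Complex.exp (u p.2 s * Complex.I) -
          (u p.1 s - u p.2 s : ℝ) * Complex.I)‖ ≤
        3 * (C + 2) ^ 2 * (‖p.1‖ + ‖p.2‖) * ‖p.1 - p.2‖ := fun s _ => by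
      rw [norm_mul, norm_tangent, one_mul]
      refine (norm_exp_mul_I_sub_sub_le _ _).trans ?_
      have b1 := hub p.1 s
      have b2 := hub p.2 s
      have b3 := hub (p.1 - p.2) s
      rw [← husub] at b3
      calc 3 * (|u p.1 s| + |u p.2 s|) * |u p.1 s - u p.2 s|
          ≤ 3 * ((C + 2) * ‖p.1‖ + (C + 2) * ‖p.2‖) * ((C + 2) * ‖p.1 - p.2‖) := by gcongr
        _ = _ := by ring
    refine (intervalIntegral.norm_integral_le_of_norm_le_const hbound).trans ?_
    rw [sub_zero, abs_of_pos (by positivity)]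
    calc 3 * (C + 2) ^ 2 * (‖p.1‖ + ‖p.2‖) * ‖p.1 - p.2‖ * (2 * π)
        = (K * (‖p.1‖ + ‖p.2‖)) * ‖p.1 - p.2‖ := by rw [hK]; ring
      _ ≤ c * ‖p.1 - p.2‖ := by gcongr
  have hinv : (D ∘L ContinuousLinearMap.inr ℝ ℝ ℂ).IsInvertible := by
    refine ⟨E.trans (LinearEquiv.smulOfNeZero ℂ ℂ Complex.I Complex.I_ne_zero
      |>.restrictScalars ℝ).toContinuousLinearEquiv, ?_⟩
    ext w <;> simp [D]
  have hd := hF.hasStrictFDerivAt_implicitFunctionOfProdDomain hinv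
  -- The partial derivative in `x` vanishes, so the implicit function has derivative zero: the
  -- correction is `o(x)`.
  have hinl : D ∘L ContinuousLinearMap.inl ℝ ℝ ℂ = 0 := by
    ext; simp [D]
  rw [hinl, ContinuousLinearMap.comp_zero] at hd
  have hw0 : hF.implicitFunctionOfProdDomain hinv 0 = 0 :=
    (hF.eventually_apply_eq_iff_implicitFunctionOfProdDomain hinv).self_of_nhds.1 rfl
  refine ⟨hF.implicitFunctionOfProdDomain hinv, hw0, ?_, ?_⟩
  · have := hd.hasFDerivAt.hasDerivAt
    simpa using this
  · have h1 := hF.eventually_apply_implicitFunctionOfProdDomain hinv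
    have hF0 : F 0 = 0 := by
      simp only [F, u, Prod.fst_zero, Prod.snd_zero, zero_mul, tangentComponent_zero, add_zero]
      exact h.closed
    rw [hF0] at h1
    exact h1

/-! ### Variations with prescribed variation of the tangent angle -/

/-- The variation of angle `x ψ`, corrected by a component of the unit tangent vector. -/
noncomputable def correctedVariation (θ ψ : ℝ → ℝ) (w : ℝ → ℂ) (x s : ℝ) : ℝ :=
  x * ψ s + tangentComponent θ (w x) s

/-- The derivative of `correctedVariation`. -/
noncomputable def correctedVariationDeriv (θ ψ : ℝ → ℝ) (w : ℝ → ℂ) (x s : ℝ) : ℝ :=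
  x * deriv ψ s + deriv θ s * ((w x).im * cos (θ s) - (w x).re * sin (θ s))

lemma hasDerivAt_correctedVariation {θ ψ : ℝ → ℝ} (hθ : ContDiff ℝ 1 θ) (hψ : ContDiff ℝ 1 ψ)
    (w : ℝ → ℂ) (x s : ℝ) :
    HasDerivAt (correctedVariation θ ψ w x) (correctedVariationDeriv θ ψ w x s) s :=
  ((hasDerivAt_of_contDiff_one hψ s).const_mul x).add
    (hasDerivAt_tangentComponent (hasDerivAt_of_contDiff_one hθ s) (w x))

lemma eventually_norm_le_of_hasDerivAt_zero {w : ℝ → ℂ} (h0 : w 0 = 0) (hw : HasDerivAt w 0 0)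
    {η : ℝ} (hη : 0 < η) : ∀ᶠ x in 𝓝 (0 : ℝ), ‖w x‖ ≤ η * |x| := by
  have := (hasDerivAt_iff_isLittleO.1 hw).def hη
  simpa [h0] using this

/-- First-order expansions, uniform in `s`, of the tangent and of its arclength derivative. Together
they give differentiability of the path of curves in the `C²` norm; the correction `w x` disappears
in the error since it is `o(x)`. -/
lemma tangent_variation_bound {θ ψ : ℝ → ℝ} {m : ℤ} (h : IsClosedAngle θ m)
    (hψ : ContDiff ℝ 1 ψ) (hp : Function.Periodic ψ (2 * π)) {w : ℝ → ℂ} (h0 : w 0 = 0)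
    (hw : HasDerivAt w 0 0) {ε : ℝ} (hε : 0 < ε) :
    ∀ᶠ x in 𝓝 (0 : ℝ), ∀ s,
      ‖tangent (fun s => θ s + correctedVariation θ ψ w x s) s - tangent θ s
        - x * (Complex.I * ψ s * tangent θ s)‖ ≤ ε * |x| ∧
      ‖((deriv θ s + correctedVariationDeriv θ ψ w x s : ℝ) * Complex.I *
          tangent (fun s => θ s + correctedVariation θ ψ w x s) s
        - deriv θ s * Complex.I * tangent θ s
        - x * (Complex.I * deriv ψ s * tangent θ s +
          Complex.I * ψ s * (deriv θ s * Complex.I * tangent θ s)))‖ ≤ ε * |x| := by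
  obtain ⟨A, hA0, hA⟩ := exists_bound_of_periodic hp hψ.continuous
  obtain ⟨B, hB0, hB⟩ := exists_bound_of_periodic (periodic_deriv hp)
    (hψ.continuous_deriv (by norm_num))
  obtain ⟨C, hC0, hC⟩ := exists_bound_of_periodic h.periodic_deriv h.continuous_deriv
  simp only [Real.norm_eq_abs] at hA hB hC
  -- A common bound for the constants of the two error estimates below.
  set K := (1 + C) * (2 * (A + 2) ^ 2) + 2 + 4 * C + (B + 2 * C) * (A + 2) with hK
  have hK0 : 0 < K := by positivity
  set η := min 1 (ε / K) with hηdef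
  have hη0 : 0 < η := lt_min one_pos (by positivity)
  have hη1 : η ≤ 1 := min_le_left _ _
  have hηK : η * K ≤ ε := by
    rw [← le_div_iff₀ hK0]; exact min_le_right _ _
  have hsmall : ∀ᶠ x in 𝓝 (0 : ℝ), |x| ≤ η := by
    filter_upwards [Metric.closedBall_mem_nhds (0 : ℝ) hη0] with x hx
    simpa using hx
  filter_upwards [hsmall, eventually_norm_le_of_hasDerivAt_zero h0 hw hη0] with x hx hwx s
  set u := correctedVariation θ ψ w x s with hu
  set u' := correctedVariationDeriv θ ψ w x s with hu'
  set f := tangent θ s with hf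
  have hfx : tangent (fun s => θ s + correctedVariation θ ψ w x s) s =
      f * Complex.exp (u * Complex.I) := by
    simp only [tangent, hf, hu]
    rw [← Complex.exp_add]; push_cast; ring_nf
  have hfn : ‖f‖ = 1 := norm_tangent _ _
  have hx0 := abs_nonneg x
  have hw' : ‖w x‖ ≤ |x| := hwx.trans (mul_le_of_le_one_left hx0 hη1)
  have hd : |u - x * ψ s| ≤ 2 * (η * |x|) := by
    have := abs_tangentComponent_le θ (w x) s
    rw [hu, correctedVariation, add_sub_cancel_left]; linarith
  have hub : |u| ≤ (A + 2) * |x| := by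
    have h1 := abs_tangentComponent_le θ (w x) s
    have h2 := mul_le_mul_of_nonneg_left (hA s) hx0
    rw [hu, correctedVariation]
    refine (abs_add_le _ _).trans ?_
    rw [abs_mul]; nlinarith
  have hcomp : |deriv θ s * ((w x).im * cos (θ s) - (w x).re * sin (θ s))| ≤ C * (2 * ‖w x‖) := by
    rw [abs_mul]
    refine mul_le_mul (hC s) ?_ (abs_nonneg _) hC0.le
    have := abs_tangentComponent_le (fun s => θ s + π / 2) (w x) s
    simp only [tangentComponent, cos_add_pi_div_two, sin_add_pi_div_two] at this
    rwa [show (w x).im * cos (θ s) - (w x).re * sin (θ s) =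
      (w x).re * -sin (θ s) + (w x).im * cos (θ s) by ring]
  have hd' : |u' - x * deriv ψ s| ≤ C * (2 * (η * |x|)) := by
    rw [hu', correctedVariationDeriv, add_sub_cancel_left]
    exact hcomp.trans (by gcongr)
  have hub' : |u'| ≤ (B + 2 * C) * |x| := by
    have h2 := mul_le_mul_of_nonneg_left (hB s) hx0
    rw [hu', correctedVariationDeriv]
    refine (abs_add_le _ _).trans ?_
    rw [abs_mul]; nlinarith
  have he2 := norm_exp_mul_I_sub_one_sub_le u
  have he1 := norm_exp_mul_I_sub_one_le u
  have hu2 : u ^ 2 ≤ (A + 2) ^ 2 * (η * |x|) := by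
    rw [← sq_abs u]
    calc |u| ^ 2 ≤ ((A + 2) * |x|) ^ 2 := by gcongr
      _ = (A + 2) ^ 2 * (|x| * |x|) := by ring
      _ ≤ _ := by gcongr
  have he2' : ‖Complex.exp (u * Complex.I) - 1 - u * Complex.I‖ ≤
      2 * (A + 2) ^ 2 * (η * |x|) := he2.trans (by linarith)
  have hηx : 0 ≤ η * |x| := by positivity
  constructor
  · rw [hfx]
    have e : f * Complex.exp (u * Complex.I) - f - x * (Complex.I * ψ s * f) =
        f * (Complex.exp (u * Complex.I) - 1 - u * Complex.I) +
        f * ((u - x * ψ s : ℝ) * Complex.I) := by push_cast; ring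
    rw [e]
    refine (norm_add_le _ _).trans ?_
    rw [norm_mul, norm_mul, hfn, norm_mul _ Complex.I, Complex.norm_I, Complex.norm_real,
      Real.norm_eq_abs]
    calc _ ≤ 1 * (2 * (A + 2) ^ 2 * (η * |x|)) + 1 * (2 * (η * |x|) * 1) := by gcongr
      _ = (2 * (A + 2) ^ 2 + 2) * (η * |x|) := by ring
      _ ≤ K * (η * |x|) := by
        refine mul_le_mul_of_nonneg_right ?_ hηx
        have h1 : 0 ≤ C * (2 * (A + 2) ^ 2) := by positivity
        have h2 : 0 ≤ (B + 2 * C) * (A + 2) := by positivity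
        rw [hK]; linarith
      _ = (η * K) * |x| := by ring
      _ ≤ ε * |x| := by gcongr
  · rw [hfx]
    have e : ((deriv θ s + u' : ℝ) : ℂ) * Complex.I * (f * Complex.exp (u * Complex.I))
        - deriv θ s * Complex.I * f
        - x * (Complex.I * deriv ψ s * f + Complex.I * ψ s * (deriv θ s * Complex.I * f)) =
        f * ((((deriv θ s : ℝ) : ℂ) * Complex.I *
          (Complex.exp (u * Complex.I) - 1 - u * Complex.I)) +
        ((-(deriv θ s * (u - x * ψ s)) : ℝ) : ℂ) +
        (u' - x * deriv ψ s : ℝ) * Complex.I +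
        (u' : ℝ) * Complex.I * (Complex.exp (u * Complex.I) - 1)) := by
      push_cast
      linear_combination (((deriv θ s : ℝ) : ℂ) * f * (u - x * ψ s)) * Complex.I_sq
    rw [e, norm_mul, hfn, one_mul]
    refine (norm_add_le _ _).trans ((add_le_add_left (norm_add₃_le) _).trans ?_)
    simp only [norm_mul, Complex.norm_I, Complex.norm_real, Real.norm_eq_abs, mul_one, abs_neg,
      abs_mul]
    calc _ ≤ C * (2 * (A + 2) ^ 2 * (η * |x|)) + C * (2 * (η * |x|)) + C * (2 * (η * |x|))
          + ((B + 2 * C) * |x|) * ((A + 2) * η) := by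
          have h1 := hC s
          have h2 : ‖Complex.exp (u * Complex.I) - 1‖ ≤ (A + 2) * η :=
            he1.trans (hub.trans (by gcongr))
          gcongr
      _ = (C * (2 * (A + 2) ^ 2) + 4 * C + (B + 2 * C) * (A + 2)) * (η * |x|) := by ring
      _ ≤ K * (η * |x|) := by
        refine mul_le_mul_of_nonneg_right ?_ hηx
        have h1 : 0 ≤ 2 * (A + 2) ^ 2 := by positivity
        rw [hK]; linarith
      _ = (η * K) * |x| := by ring
      _ ≤ ε * |x| := by gcongr

/-- All curves of the variation share the parameter `σ`, hence the speed and the length. The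
velocity has derivative `σ' * iψ exp (iθ)` in `t`, and it is periodic exactly because `ψ` is
admissible. -/
lemma HasAngle.exists_variation {γ : ℝ → ℂ} {z : ℂ} {θ : ℝ → ℝ} {m : ℤ} {σ : ℝ → ℝ}
    (h : HasAngle γ z θ m σ) {ψ : ℝ → ℝ} (hψ : ContDiff ℝ 1 ψ)
    (hp : Function.Periodic ψ (2 * π)) (h0 : endpointVariation θ ψ = 0) :
    ∃ (Γ : ℝ → ℝ → ℂ) (V : ℝ → ℂ) (w : ℝ → ℂ), IsVariation γ Γ V ∧ w 0 = 0 ∧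
      HasDerivAt w 0 0 ∧ ∀ᶠ x in 𝓝 (0 : ℝ),
        HasAngle (Γ x) z (fun s => θ s + correctedVariation θ ψ w x s) m σ := by
  have hθ := h.angle.contDiff
  have hσ := h.reparam
  have htc := contDiff_tangent hθ
  obtain ⟨w, hw0, hw, hcl⟩ := h.angle.exists_closing hψ.continuous hp h0
  have hucd : ∀ x, ContDiff ℝ 1 (correctedVariation θ ψ w x) := fun x =>
    (contDiff_const.mul hψ).add (contDiff_tangentComponent hθ _)
  have hθx : ∀ x, ContDiff ℝ 1 (fun s => θ s + correctedVariation θ ψ w x s) := fun x =>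
    hθ.add (hucd x)
  set Γ : ℝ → ℝ → ℂ := fun x =>
    primitiveAlong z (tangent fun s => θ s + correctedVariation θ ψ w x s) σ with hΓ
  set g : ℝ → ℂ := fun s => Complex.I * ψ s * tangent θ s with hg
  set g' : ℝ → ℂ := fun s => Complex.I * ((deriv ψ s : ℝ) : ℂ) * tangent θ s +
          Complex.I * ψ s * (((deriv θ s : ℝ) : ℂ) * Complex.I * tangent θ s) with hg'
  have hgc : ContDiff ℝ 1 g :=
    (contDiff_const.mul (Complex.ofRealCLM.contDiff.comp hψ)).mul htc
  have hgd : ∀ s, HasDerivAt g (g' s) s := fun s =>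
    (((hasDerivAt_of_contDiff_one hψ s).ofReal_comp.const_mul Complex.I).mul
      (hasDerivAt_tangent (h.angle.hasDerivAt s)))
  have hgp : Function.Periodic g (2 * π) := fun s => by
    simp only [hg, hp s, h.angle.periodic_tangent s]
  have hgi : ∫ s in (0 : ℝ)..(2 * π), g s = 0 := by
    have : g = fun s => Complex.I * (ψ s * tangent θ s) := by funext s; simp only [hg]; ring
    rw [this, intervalIntegral.integral_const_mul]
    have h0' : ∫ s in (0 : ℝ)..(2 * π), (ψ s : ℂ) * tangent θ s = 0 := h0
    rw [h0', mul_zero]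
  have hang : ∀ᶠ x in 𝓝 (0 : ℝ),
      HasAngle (Γ x) z (fun s => θ s + correctedVariation θ ψ w x s) m σ := by
    filter_upwards [hcl] with x hx
    refine ⟨⟨hθx x, fun s => ?_, hx⟩, hσ, rfl⟩
    simp only [correctedVariation]
    rw [h.angle.add_period, hp, periodic_tangentComponent h.angle]; ring
  have hΓ0 : Γ 0 = γ := by
    rw [h.eq]
    simp only [hΓ, correctedVariation, hw0, tangentComponent_zero, zero_mul, add_zero]
  refine ⟨Γ, primitiveAlong 0 g σ, w, ⟨hΓ0, hang.mono fun x hx => hx.mem_curves,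
    contDiff_primitiveAlong hgc hσ, periodic_primitiveAlong hgc.continuous hgp hgi hσ, ?_⟩,
    hw0, hw, hang⟩
  intro i hi ε hε
  obtain ⟨M₀, hM₀⟩ := (isCompact_Icc (a := (0 : ℝ)) (b := 2 * π)).exists_bound_of_continuousOn
    hσ.continuous.continuousOn
  obtain ⟨M₁, hM₁0, hM₁⟩ := exists_bound_of_periodic hσ.periodic_deriv hσ.contDiff_deriv.continuous
  obtain ⟨M₂, hM₂0, hM₂⟩ := exists_bound_of_periodic (periodic_deriv hσ.periodic_deriv)
    (hσ.contDiff_deriv.continuous_deriv (by norm_num))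
  set N := |M₀| + M₁ + M₂ + M₁ ^ 2 with hN
  have hN0 : 0 < N := by positivity
  have hkey := tangent_variation_bound h.angle hψ hp hw0 hw (ε := ε / N) (by positivity)
  filter_upwards [hkey, hang] with x hx hxa t
  have hΓp := hxa.mem_curves.1.periodic
  have hγp := h.mem_curves.1.periodic
  have hVp := periodic_primitiveAlong (z := 0) hgc.continuous hgp hgi hσ
  have hεN : ε / N * |x| * N = ε * |x| := by field_simp
  have hnn : 0 ≤ ε / N * |x| := by positivity
  have c1 := (contDiff_tangent (hθx x)).continuous
  have d1 : deriv (Γ x) = _ := deriv_primitiveAlong (z := z) c1 hσ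
  have d2 := h.deriv_eq
  have d3 := deriv_primitiveAlong (z := 0) hgc.continuous hσ
  rcases (by omega : i = 0 ∨ i = 1 ∨ i = 2) with rfl | rfl | rfl
  · simp only [iteratedDeriv_zero]
    have hper : Function.Periodic (fun t => Γ x t - γ t - x • primitiveAlong 0 g σ t) (2 * π) :=
      fun t => by simp only [hΓp t, hγp t, hVp t]
    -- Reduction to one period bounds `σ y`, the length of the interval over which the velocity
    -- error is integrated.
    obtain ⟨y, hy, hty⟩ := hper.exists_mem_Ico₀ (by positivity) t
    refine le_of_eq_of_le (congrArg _ hty) ?_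
    have e : Γ x y - γ y - x • primitiveAlong 0 g σ y = ∫ s in (0 : ℝ)..σ y,
        (tangent (fun s => θ s + correctedVariation θ ψ w x s) s - tangent θ s - x * g s) := by
      have c3 : Continuous fun s => (x : ℂ) * g s := continuous_const.mul hgc.continuous
      rw [intervalIntegral.integral_sub ((c1.fun_sub htc.continuous).intervalIntegrable _ _)
        (c3.intervalIntegrable _ _), intervalIntegral.integral_sub (c1.intervalIntegrable _ _)
        (htc.continuous.intervalIntegrable _ _), intervalIntegral.integral_const_mul, h.eq,
        Complex.real_smul]
      simp only [hΓ, primitiveAlong]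
      ring
    rw [e]
    refine (intervalIntegral.norm_integral_le_of_norm_le_const fun s _ => (hx s).1).trans ?_
    rw [sub_zero, ← hεN]
    refine mul_le_mul_of_nonneg_left ?_ hnn
    have := (hM₀ y ⟨hy.1, hy.2.le⟩).trans (le_abs_self _)
    rw [Real.norm_eq_abs] at this
    have h2 := sq_nonneg M₁
    linarith
  · simp only [iteratedDeriv_one]
    rw [d1, d2, d3, Complex.real_smul]
    have e : ((deriv σ t : ℝ) : ℂ) * tangent (fun s => θ s + correctedVariation θ ψ w x s) (σ t) -
        ((deriv σ t : ℝ) : ℂ) * tangent θ (σ t) - x * (((deriv σ t : ℝ) : ℂ) * g (σ t)) =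
        ((deriv σ t : ℝ) : ℂ) * (tangent (fun s => θ s + correctedVariation θ ψ w x s) (σ t) -
          tangent θ (σ t) - x * g (σ t)) := by ring
    rw [e, norm_mul, Complex.norm_real]
    calc _ ≤ M₁ * (ε / N * |x|) := mul_le_mul (hM₁ t) (hx (σ t)).1 (norm_nonneg _) hM₁0.le
      _ = (ε / N * |x|) * M₁ := by ring
      _ ≤ (ε / N * |x|) * N := by
        refine mul_le_mul_of_nonneg_left ?_ hnn
        have h2 := sq_nonneg M₁
        have h3 := abs_nonneg M₀
        linarith
      _ = _ := hεN
  · have e1 := (hasDerivAt_deriv_primitiveAlong (fun s => hasDerivAt_tangent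
      ((h.angle.hasDerivAt s).fun_add (hasDerivAt_correctedVariation hθ hψ w x s))) hσ t).deriv
    have e2 := (hasDerivAt_deriv_primitiveAlong (fun s => hasDerivAt_tangent
      (h.angle.hasDerivAt s)) hσ t).deriv
    have e3 := (hasDerivAt_deriv_primitiveAlong hgd hσ t).deriv
    rw [iteratedDeriv_succ, iteratedDeriv_one, iteratedDeriv_succ, iteratedDeriv_one,
      iteratedDeriv_succ, iteratedDeriv_one, d1, d2, d3, e1, e2, e3, Complex.real_smul]
    have hs := hx (σ t)
    set a := ((deriv (deriv σ) t : ℝ) : ℂ)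
    set b := ((deriv σ t : ℝ) : ℂ)
    refine le_trans (le_of_eq (congrArg _ (?_ : _ = a * (tangent (fun s => θ s +
      correctedVariation θ ψ w x s) (σ t) - tangent θ (σ t) -
      x * (Complex.I * ψ (σ t) * tangent θ (σ t))) + b ^ 2 *
      (((deriv θ (σ t) + correctedVariationDeriv θ ψ w x (σ t) : ℝ) : ℂ) * Complex.I *
          tangent (fun s => θ s + correctedVariation θ ψ w x s) (σ t)
        - deriv θ (σ t) * Complex.I * tangent θ (σ t)
        - x * (Complex.I * deriv ψ (σ t) * tangent θ (σ t) +
          Complex.I * ψ (σ t) * (deriv θ (σ t) * Complex.I * tangent θ (σ t))))))) ?_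
    · simp only [hg, hg']; ring
    refine (norm_add_le _ _).trans ?_
    rw [norm_mul, norm_mul, norm_pow, Complex.norm_real, Complex.norm_real]
    calc _ ≤ M₂ * (ε / N * |x|) + M₁ ^ 2 * (ε / N * |x|) := by
          have h1 := hM₁ t
          have h2 := hM₂ t
          have h3 := hs.1
          have h4 := hs.2
          gcongr
      _ = (ε / N * |x|) * (M₂ + M₁ ^ 2) := by ring
      _ ≤ (ε / N * |x|) * N := by
        refine mul_le_mul_of_nonneg_left ?_ hnn
        have h3 := abs_nonneg M₀
        linarith
      _ = _ := hεN

/-! ### The equation of critical curves -/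

lemma continuous_correctedVariationDeriv {θ ψ : ℝ → ℝ} (hθ : ContDiff ℝ 1 θ)
    (hψ : ContDiff ℝ 1 ψ) (w : ℝ → ℂ) (x : ℝ) : Continuous (correctedVariationDeriv θ ψ w x) := by
  have h1 := hθ.continuous_deriv (by norm_num)
  have h2 := hψ.continuous_deriv (by norm_num)
  have h3 := hθ.continuous
  unfold correctedVariationDeriv
  fun_prop

lemma HasAngle.U_correctedVariation {γ : ℝ → ℂ} {z : ℂ} {θ ψ : ℝ → ℝ} {m : ℤ} {σ : ℝ → ℝ}
    {w : ℝ → ℂ} {x : ℝ} (hθ : ContDiff ℝ 1 θ) (hψ : ContDiff ℝ 1 ψ)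
    (h : HasAngle γ z (fun s => θ s + correctedVariation θ ψ w x s) m σ) :
    U γ = (∫ s in (0 : ℝ)..(2 * π), deriv θ s ^ 2) +
      (2 * ∫ s in (0 : ℝ)..(2 * π), deriv θ s * correctedVariationDeriv θ ψ w x s) +
      ∫ s in (0 : ℝ)..(2 * π), correctedVariationDeriv θ ψ w x s ^ 2 := by
  have h1 := hθ.continuous_deriv (by norm_num)
  have h2 := continuous_correctedVariationDeriv hθ hψ w x
  rw [h.U_eq, ← intervalIntegral.integral_const_mul, ← intervalIntegral.integral_add
    (Continuous.intervalIntegrable (by fun_prop) _ _)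
    (Continuous.intervalIntegrable (by fun_prop) _ _), ← intervalIntegral.integral_add
    (Continuous.intervalIntegrable (by fun_prop) _ _)
    (Continuous.intervalIntegrable (by fun_prop) _ _)]
  congr 1
  funext s
  have hd : deriv (fun s => θ s + correctedVariation θ ψ w x s) s = _ :=
    ((hasDerivAt_of_contDiff_one hθ s).add (hasDerivAt_correctedVariation hθ hψ w x s)).deriv
  rw [hd]
  ring

lemma abs_rotated_tangentComponent_le (θ : ℝ) (w : ℂ) :
    |w.im * cos θ - w.re * sin θ| ≤ 2 * ‖w‖ := by
  have := abs_tangentComponent_le (fun _ => θ + π / 2) w 0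
  simp only [tangentComponent, cos_add_pi_div_two, sin_add_pi_div_two] at this
  rwa [show w.im * cos θ - w.re * sin θ = w.re * -sin θ + w.im * cos θ by ring]

lemma integral_sq_le {f : ℝ → ℝ} {K : ℝ} (hf : ∀ s, |f s| ≤ K) :
    |∫ s in (0 : ℝ)..(2 * π), f s ^ 2| ≤ K ^ 2 * (2 * π) := by
  have h := intervalIntegral.norm_integral_le_of_norm_le_const (a := 0) (b := 2 * π)
    (f := fun s => f s ^ 2) (C := K ^ 2) fun s _ => by
      rw [norm_pow, Real.norm_eq_abs]
      exact pow_le_pow_left₀ (abs_nonneg _) (hf s) 2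
  rwa [sub_zero, abs_of_pos (by positivity : (0 : ℝ) < 2 * π)] at h

/-- The correction enters the linear term through `w x`, whose derivative at `0` is zero, and the
quadratic term is `O(x²)`. Only `xψ` contributes. -/
lemma hasDerivAt_integral_correctedVariation {θ ψ : ℝ → ℝ} {m : ℤ} (h : IsClosedAngle θ m)
    (hψ : ContDiff ℝ 1 ψ) (hp : Function.Periodic ψ (2 * π)) {w : ℝ → ℂ} (h0 : w 0 = 0)
    (hw : HasDerivAt w 0 0) :
    HasDerivAt (fun x => (∫ s in (0 : ℝ)..(2 * π), deriv θ s ^ 2) +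
      (2 * ∫ s in (0 : ℝ)..(2 * π), deriv θ s * correctedVariationDeriv θ ψ w x s) +
      ∫ s in (0 : ℝ)..(2 * π), correctedVariationDeriv θ ψ w x s ^ 2)
      (2 * ∫ s in (0 : ℝ)..(2 * π), deriv θ s * deriv ψ s) 0 := by
  have c1 := h.continuous_deriv
  have c2 := hψ.continuous_deriv (by norm_num)
  have c3 := h.contDiff.continuous
  have hre : HasDerivAt (fun x => (w x).re) 0 0 :=
    (Complex.reCLM.hasFDerivAt.comp_hasDerivAt 0 hw).congr_deriv (by simp)
  have him : HasDerivAt (fun x => (w x).im) 0 0 :=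
    (Complex.imCLM.hasFDerivAt.comp_hasDerivAt 0 hw).congr_deriv (by simp)
  have hlin : ∀ x, ∫ s in (0 : ℝ)..(2 * π), deriv θ s * correctedVariationDeriv θ ψ w x s =
      x * (∫ s in (0 : ℝ)..(2 * π), deriv θ s * deriv ψ s) +
      ((w x).im * (∫ s in (0 : ℝ)..(2 * π), deriv θ s ^ 2 * cos (θ s)) -
      (w x).re * (∫ s in (0 : ℝ)..(2 * π), deriv θ s ^ 2 * sin (θ s))) := fun x => by
    rw [← intervalIntegral.integral_const_mul, ← intervalIntegral.integral_const_mul,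
      ← intervalIntegral.integral_const_mul, ← intervalIntegral.integral_sub
      (Continuous.intervalIntegrable (by fun_prop) _ _)
      (Continuous.intervalIntegrable (by fun_prop) _ _), ← intervalIntegral.integral_add
      (Continuous.intervalIntegrable (by fun_prop) _ _)
      (Continuous.intervalIntegrable (by fun_prop) _ _)]
    congr 1
    funext s
    simp only [correctedVariationDeriv]; ring
  obtain ⟨B, hB0, hB⟩ := exists_bound_of_periodic (periodic_deriv hp) c2
  obtain ⟨C, hC0, hC⟩ := exists_bound_of_periodic h.periodic_deriv c1
  simp only [Real.norm_eq_abs] at hB hC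
  have hquad : HasDerivAt
      (fun x => ∫ s in (0 : ℝ)..(2 * π), correctedVariationDeriv θ ψ w x s ^ 2) 0 0 := by
    have hz : ∫ s in (0 : ℝ)..(2 * π), correctedVariationDeriv θ ψ w 0 s ^ 2 = 0 := by
      simp [correctedVariationDeriv, h0]
    rw [hasDerivAt_iff_isLittleO]
    have hO : (fun x => ∫ s in (0 : ℝ)..(2 * π), correctedVariationDeriv θ ψ w x s ^ 2)
        =O[𝓝 0] fun x : ℝ => x ^ 2 := by
      refine Asymptotics.IsBigO.of_bound ((B + 2 * C) ^ 2 * (2 * π)) ?_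
      filter_upwards [eventually_norm_le_of_hasDerivAt_zero h0 hw one_pos] with x hx
      have hb : ∀ s, |correctedVariationDeriv θ ψ w x s| ≤ (B + 2 * C) * |x| := fun s => by
        rw [correctedVariationDeriv]
        refine (abs_add_le _ _).trans ?_
        rw [abs_mul, abs_mul]
        have h1 := abs_rotated_tangentComponent_le (θ s) (w x)
        calc _ ≤ |x| * B + C * (2 * (1 * |x|)) := by
              have := hB s
              have := hC s
              have : |(w x).im * cos (θ s) - (w x).re * sin (θ s)| ≤ 2 * (1 * |x|) := by linarith
              gcongr
          _ = _ := by ring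
      refine (integral_sq_le hb).trans (le_of_eq ?_)
      rw [norm_pow, Real.norm_eq_abs]; ring
    refine (hO.trans_isLittleO (Asymptotics.isLittleO_pow_id (by norm_num : 1 < 2))).congr_left
      (f₂ := _) (fun x => ?_) |>.congr_right (fun x => ?_)
    · simp [hz]
    · simp
  have hmain : HasDerivAt (fun x => x * (∫ s in (0 : ℝ)..(2 * π), deriv θ s * deriv ψ s) +
      ((w x).im * (∫ s in (0 : ℝ)..(2 * π), deriv θ s ^ 2 * cos (θ s)) -
      (w x).re * (∫ s in (0 : ℝ)..(2 * π), deriv θ s ^ 2 * sin (θ s))))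
      (∫ s in (0 : ℝ)..(2 * π), deriv θ s * deriv ψ s) 0 :=
    (((hasDerivAt_id (0 : ℝ)).mul_const _).add ((him.mul_const _).sub (hre.mul_const _))).congr_deriv
      (by ring)
  simp only [hlin]
  exact (((hmain.const_mul 2).const_add _).add hquad).congr_deriv (by ring)

lemma IsCritical.integral_eq_zero {γ : ℝ → ℂ} (hγ : IsCritical γ) {z : ℂ} {θ : ℝ → ℝ} {m : ℤ}
    {σ : ℝ → ℝ} (h : HasAngle γ z θ m σ) {ψ : ℝ → ℝ} (hψ : ContDiff ℝ 1 ψ)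
    (hp : Function.Periodic ψ (2 * π)) (h0 : endpointVariation θ ψ = 0) :
    ∫ s in (0 : ℝ)..(2 * π), deriv θ s * deriv ψ s = 0 := by
  obtain ⟨Γ, V, w, hΓ, hw0, hw, hang⟩ := h.exists_variation hψ hp h0
  have h1 := hγ.2 Γ V hΓ
  have h2 := (hasDerivAt_integral_correctedVariation h.angle hψ hp hw0 hw).congr_of_eventuallyEq
    (hang.mono fun x hx => hx.U_correctedVariation h.angle.contDiff hψ)
  have := h1.unique h2
  linarith

/-- Lagrange multipliers for the two closure constraints, followed by the du Bois-Reymond argument.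
The latter is needed since `θ` is only known to be `C¹`. -/
lemma exists_pendulum_of_stationary {θ : ℝ → ℝ} {m : ℤ} (h : IsClosedAngle θ m)
    (hst : ∀ ψ : ℝ → ℝ, ContDiff ℝ 1 ψ → Function.Periodic ψ (2 * π) →
      endpointVariation θ ψ = 0 → ∫ s in (0 : ℝ)..(2 * π), deriv θ s * deriv ψ s = 0) :
    ∃ μ c : ℝ, 0 ≤ μ ∧ ∀ s, HasDerivAt (deriv θ) (-(μ * sin (θ s - c))) s := by
  have c1 := h.continuous_deriv
  have c3 := h.contDiff.continuous
  obtain ⟨E, hE⟩ := h.endpointVariation_tangentComponent_surjective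
  -- Subtracting from `ψ` the tangent component with the same end point variation leaves an
  -- admissible function. So the first variation depends on `ψ` only through its end point
  -- variation, and linearly.
  obtain ⟨Λ, hΛ⟩ : ∃ Λ : ℂ →ₗ[ℝ] ℝ, ∀ ψ : ℝ → ℝ, ContDiff ℝ 1 ψ → Function.Periodic ψ (2 * π) →
      ∫ s in (0 : ℝ)..(2 * π), deriv θ s * deriv ψ s = Λ (endpointVariation θ ψ) := by
    refine ⟨((∫ s in (0 : ℝ)..(2 * π), deriv θ s ^ 2 * cos (θ s)) • Complex.imLm -
      (∫ s in (0 : ℝ)..(2 * π), deriv θ s ^ 2 * sin (θ s)) • Complex.reLm) ∘ₗ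
      (E.symm : ℂ →L[ℝ] ℂ).toLinearMap, fun ψ hψ hp => ?_⟩
    set w := E.symm (endpointVariation θ ψ) with hw
    have hEw : endpointVariation θ (tangentComponent θ w) = endpointVariation θ ψ := by
      rw [← hE, hw, E.apply_symm_apply]
    have hχc := contDiff_tangentComponent h.contDiff w
    have hadm := endpointVariation_add_mul c3 hψ.continuous hχc.continuous 1 (-1)
    rw [hEw] at hadm
    have hz := hst _ ((contDiff_const.mul hψ).add (contDiff_const.mul hχc))
      (fun s => by simp only [hp s, periodic_tangentComponent h w s]) (hadm.trans (by push_cast; ring))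
    have hd : ∀ s, deriv (fun s => 1 * ψ s + -1 * tangentComponent θ w s) s = deriv ψ s -
        deriv θ s * (w.im * cos (θ s) - w.re * sin (θ s)) := fun s => by
      have : HasDerivAt (fun s => 1 * ψ s + -1 * tangentComponent θ w s) _ s :=
        ((hasDerivAt_of_contDiff_one hψ s).const_mul 1).add
        ((hasDerivAt_tangentComponent (h.hasDerivAt s) w).const_mul (-1))
      rw [this.deriv]; ring
    have c2 := hψ.continuous_deriv (by norm_num)
    have hsplit : ∫ s in (0 : ℝ)..(2 * π), deriv θ s * (deriv ψ s -
        deriv θ s * (w.im * cos (θ s) - w.re * sin (θ s))) =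
        (∫ s in (0 : ℝ)..(2 * π), deriv θ s * deriv ψ s) -
        (w.im * (∫ s in (0 : ℝ)..(2 * π), deriv θ s ^ 2 * cos (θ s)) -
        w.re * (∫ s in (0 : ℝ)..(2 * π), deriv θ s ^ 2 * sin (θ s))) := by
      rw [← intervalIntegral.integral_const_mul, ← intervalIntegral.integral_const_mul,
        ← intervalIntegral.integral_sub (Continuous.intervalIntegrable (by fun_prop) _ _)
        (Continuous.intervalIntegrable (by fun_prop) _ _), ← intervalIntegral.integral_sub
        (Continuous.intervalIntegrable (by fun_prop) _ _)
        (Continuous.intervalIntegrable (by fun_prop) _ _)]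
      congr 1
      funext s
      ring
    simp only [hd] at hz
    rw [hsplit] at hz
    simp only [LinearMap.comp_apply, LinearMap.sub_apply, LinearMap.smul_apply, Complex.imLm_coe,
      Complex.reLm_coe, ContinuousLinearMap.coe_coe, ContinuousLinearEquiv.coe_coe, smul_eq_mul,
      ← hw]
    linarith
  set l : ℂ := ⟨Λ 1, Λ Complex.I⟩ with hl
  have hΛl : ∀ v : ℂ, Λ v = v.re * l.re + v.im * l.im := fun v => by
    have : v = v.re • (1 : ℂ) + v.im • Complex.I := by
      apply Complex.ext <;> simp
    conv_lhs => rw [this, map_add, map_smul, map_smul]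
    rfl
  have hlc := continuous_tangentComponent c3 l
  have hψint : ∀ ψ : ℝ → ℝ, ContDiff ℝ 1 ψ → Function.Periodic ψ (2 * π) →
      ∫ s in (0 : ℝ)..(2 * π), deriv θ s * deriv ψ s =
        ∫ s in (0 : ℝ)..(2 * π), ψ s * tangentComponent θ l s := fun ψ hψ hp => by
    have hψc := hψ.continuous
    rw [hΛ ψ hψ hp, hΛl, endpointVariation_re c3 hψc, endpointVariation_im c3 hψc,
      ← intervalIntegral.integral_mul_const, ← intervalIntegral.integral_mul_const,
      ← intervalIntegral.integral_add (Continuous.intervalIntegrable (by fun_prop) _ _)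
        (Continuous.intervalIntegrable (by fun_prop) _ _)]
    congr 1
    funext s
    simp only [tangentComponent]; ring
  have hl0 : ∫ s in (0 : ℝ)..(2 * π), tangentComponent θ l s = 0 := by
    simp only [tangentComponent]
    rw [intervalIntegral.integral_add (Continuous.intervalIntegrable (by fun_prop) _ _)
        (Continuous.intervalIntegrable (by fun_prop) _ _), intervalIntegral.integral_const_mul,
        intervalIntegral.integral_const_mul, h.integral_cos, h.integral_sin]
    simp
  set R : ℝ → ℝ := fun s => ∫ r in (0 : ℝ)..s, tangentComponent θ l r with hR
  have hRd : ∀ s, HasDerivAt R (tangentComponent θ l s) s := hasDerivAt_integral hlc 0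
  have hRc : Continuous R := continuous_iff_continuousAt.2 fun s => (hRd s).continuousAt
  have hRp : Function.Periodic R (2 * π) := fun s => by
    simp only [hR]
    rw [← intervalIntegral.integral_add_adjacent_intervals (hlc.intervalIntegrable 0 s)
      (hlc.intervalIntegrable _ _), (periodic_tangentComponent h l).intervalIntegral_add_eq s 0,
      zero_add, hl0, add_zero]
  set G : ℝ → ℝ := fun s => deriv θ s + R s with hG
  have hGc : Continuous G := c1.add hRc
  have hGp : Function.Periodic G (2 * π) := fun s => by
    simp only [hG, h.periodic_deriv s, hRp s]
  set M : ℝ := (∫ s in (0 : ℝ)..(2 * π), G s) / (2 * π) with hM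
  have hGMc : Continuous fun s => G s - M := hGc.sub continuous_const
  have hGM0 : ∫ s in (0 : ℝ)..(2 * π), (G s - M) = 0 := by
    rw [intervalIntegral.integral_sub (hGc.intervalIntegrable _ _)
      (continuous_const.intervalIntegrable _ _), intervalIntegral.integral_const, hM]
    simp only [sub_zero, smul_eq_mul]
    field_simp
    ring
  -- The du Bois-Reymond test function: a primitive of `G - M`, periodic because `M` is the mean of
  -- `G`.
  set ψ : ℝ → ℝ := fun s => ∫ r in (0 : ℝ)..s, (G r - M) with hψdef
  have hψd : ∀ s, HasDerivAt ψ (G s - M) s := hasDerivAt_integral hGMc 0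
  have hψ : ContDiff ℝ 1 ψ := contDiff_one_of_hasDerivAt hψd hGMc
  have hψp : Function.Periodic ψ (2 * π) := fun s => by
    simp only [hψdef]
    rw [← intervalIntegral.integral_add_adjacent_intervals (hGMc.intervalIntegrable 0 s)
      (hGMc.intervalIntegrable _ _), Function.Periodic.intervalIntegral_add_eq
      (f := fun s => G s - M) (fun s => by simp only [hGp s]) s 0, zero_add, hGM0, add_zero]
  have hψdd : deriv ψ = fun s => G s - M := funext fun s => (hψd s).deriv
  have hψc := hψ.continuous
  have e1 := hψint ψ hψ hψp
  rw [hψdd] at e1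
  have e2 : ∫ s in (0 : ℝ)..(2 * π), (tangentComponent θ l s * ψ s + R s * (G s - M)) = 0 :=
    integral_eq_zero_of_periodic (fun s => (hRd s).mul (hψd s)) (by fun_prop)
      (fun s => by simp only [Pi.mul_apply, hRp s, hψp s])
  -- Stationarity, integration by parts against `R`, and the vanishing mean of `G - M` combine to
  -- give `∫ (G - M)² = 0`.
  have e3 : ∫ s in (0 : ℝ)..(2 * π), (G s - M) ^ 2 = 0 := by
    have : (fun s => (G s - M) ^ 2) = fun s => (deriv θ s * (G s - M) - ψ s * tangentComponent θ l s)
        + ((tangentComponent θ l s * ψ s + R s * (G s - M)) - M * (G s - M)) := by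
      funext s; simp only [hG]; ring
    rw [this, intervalIntegral.integral_add (Continuous.intervalIntegrable (by fun_prop) _ _)
      (Continuous.intervalIntegrable (by fun_prop) _ _), intervalIntegral.integral_sub
      (Continuous.intervalIntegrable (by fun_prop) _ _)
      (Continuous.intervalIntegrable (by fun_prop) _ _), intervalIntegral.integral_sub
      (Continuous.intervalIntegrable (by fun_prop) _ _)
      (Continuous.intervalIntegrable (by fun_prop) _ _), e1, e2,
      intervalIntegral.integral_const_mul, hGM0]
    ring
  have hconst : ∀ s, G s - M = 0 := fun s => pow_eq_zero_iff two_ne_zero |>.1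
    (eq_zero_of_integral_eq_zero (hGMc.pow 2)
      (fun s => show (G (s + 2 * π) - M) ^ 2 = (G s - M) ^ 2 by rw [hGp s])
      (fun s => sq_nonneg _) e3 s)
  have hθ' : deriv θ = fun s => M - R s := funext fun s => by
    have := hconst s
    simp only [hG] at this
    linarith
  -- The equation reads `θ'' = -‖l‖ cos (θ - arg l)`; the shift by `π / 2` turns the cosine into a
  -- sine.
  refine ⟨‖l‖, Complex.arg l - π / 2, norm_nonneg _, fun s => ?_⟩
  rw [hθ']
  refine ((hRd s).const_sub M).congr_deriv ?_
  rw [show θ s - (Complex.arg l - π / 2) = θ s - Complex.arg l + π / 2 by ring,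
    sin_add_pi_div_two, cos_sub, tangentComponent]
  have h1 := Complex.norm_mul_cos_arg l
  have h2 := Complex.norm_mul_sin_arg l
  linear_combination cos (θ s) * h1 + sin (θ s) * h2

/-! ### The pendulum equation -/

lemma pendulum_unique {μ s₀ : ℝ} {x x' y y' : ℝ → ℝ} (hx : ∀ s, HasDerivAt x (x' s) s)
    (hx' : ∀ s, HasDerivAt x' (-(μ * sin (x s))) s) (hy : ∀ s, HasDerivAt y (y' s) s)
    (hy' : ∀ s, HasDerivAt y' (-(μ * sin (y s))) s) (h₀ : x s₀ = y s₀) (h₀' : x' s₀ = y' s₀) :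
    x = y := by
  let v : ℝ × ℝ → ℝ × ℝ := fun p => (p.2, -(μ * sin p.1))
  have hv : LipschitzWith (1 + ‖μ‖₊) v := by
    refine LipschitzWith.of_dist_le_mul fun p q => ?_
    have h1 : dist p.2 q.2 ≤ dist p q := le_max_right _ _
    have h2 : dist p.1 q.1 ≤ dist p q := le_max_left _ _
    have h3 := lipschitzWith_sin.dist_le_mul p.1 q.1
    have h4 : dist (-(μ * sin p.1)) (-(μ * sin q.1)) = |μ| * dist (sin p.1) (sin q.1) := by
      rw [dist_neg_neg, Real.dist_eq, Real.dist_eq, ← mul_sub, abs_mul]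
    have h5 : (0 : ℝ) ≤ dist p q := dist_nonneg
    have h6 := abs_nonneg μ
    simp only [NNReal.coe_one, one_mul] at h3
    rw [Prod.dist_eq]
    simp only [v, NNReal.coe_add, NNReal.coe_one, coe_nnnorm, Real.norm_eq_abs]
    refine max_le ?_ ?_
    · nlinarith
    · rw [h4]; nlinarith [mul_le_mul_of_nonneg_left (h3.trans h2) h6]
  have := ODE_solution_unique_univ (v := fun _ => v) (s := fun _ => Set.univ) (t₀ := s₀)
    (f := fun s => (x s, x' s)) (g := fun s => (y s, y' s)) (fun _ => hv.lipschitzOnWith)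
    (fun s => ⟨(hx s).prodMk (hx' s), trivial⟩) (fun s => ⟨(hy s).prodMk (hy' s), trivial⟩)
    (by simp only [h₀, h₀'])
  exact funext fun s => congrArg Prod.fst (congrFun this s)

/-! ### The elastica of modulus `k` -/

/-- The speed `√(1 - k² sin² u)` of the amplitude of the pendulum. -/
noncomputable def elasticaDelta (k u : ℝ) : ℝ := √(1 - k ^ 2 * sin u ^ 2)

/-- The scale that gives the elastica of modulus `k` the period `2π`. -/
noncomputable def elasticaScale (k : ℝ) : ℝ :=
  2 * π / ∫ u in (0 : ℝ)..(2 * π), (elasticaDelta k u)⁻¹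

/-- The arclength of the elastica of modulus `k` and period `2π`. -/
noncomputable def elasticaArclength (k t : ℝ) : ℝ :=
  elasticaScale k * ∫ u in (0 : ℝ)..t, (elasticaDelta k u)⁻¹

/-- The amplitude of the pendulum as a function of time. -/
noncomputable def elasticaAmplitude (k : ℝ) : ℝ → ℝ := Function.invFun (elasticaArclength k)

/-- The tangent angle of the elastica of modulus `k` and period `2π`. -/
noncomputable def elasticaAngle (k s : ℝ) : ℝ := -(2 * arcsin (k * sin (elasticaAmplitude k s)))

section
variable {k : ℝ}

lemma elasticaDelta_pos (hk : k ∈ Set.Ioo (0 : ℝ) 1) (u : ℝ) : 0 < elasticaDelta k u :=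
  Real.sqrt_pos.2 (elastica_pos hk.1.le hk.2 u)

lemma elasticaDelta_sq (hk : k ∈ Set.Ioo (0 : ℝ) 1) (u : ℝ) :
    elasticaDelta k u ^ 2 = 1 - k ^ 2 * sin u ^ 2 :=
  Real.sq_sqrt (elastica_pos hk.1.le hk.2 u).le

lemma contDiff_inv_elasticaDelta (hk : k ∈ Set.Ioo (0 : ℝ) 1) :
    ContDiff ℝ 1 fun u => (elasticaDelta k u)⁻¹ := by
  unfold elasticaDelta
  refine ContDiff.inv (ContDiff.sqrt (by fun_prop) fun u => (elastica_pos hk.1.le hk.2 u).ne')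
    fun u => (elasticaDelta_pos hk u).ne'

lemma periodic_elasticaDelta (k : ℝ) : Function.Periodic (elasticaDelta k) (2 * π) := fun u => by
  simp only [elasticaDelta, sin_add_two_pi]

lemma elasticaScale_pos (hk : k ∈ Set.Ioo (0 : ℝ) 1) : 0 < elasticaScale k := by
  refine div_pos (by positivity) ?_
  exact intervalIntegral.intervalIntegral_pos_of_pos
    ((contDiff_inv_elasticaDelta hk).continuous.intervalIntegrable _ _)
    (fun u => inv_pos.2 (elasticaDelta_pos hk u)) (by positivity)

lemma hasDerivAt_elasticaArclength (hk : k ∈ Set.Ioo (0 : ℝ) 1) (t : ℝ) :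
    HasDerivAt (elasticaArclength k) (elasticaScale k * (elasticaDelta k t)⁻¹) t :=
  (hasDerivAt_integral (contDiff_inv_elasticaDelta hk).continuous 0 t).const_mul _

lemma isReparametrization_elasticaArclength (hk : k ∈ Set.Ioo (0 : ℝ) 1) :
    IsReparametrization (elasticaArclength k) := by
  have hc := (contDiff_inv_elasticaDelta hk).continuous
  refine ⟨contDiff_two_of_hasDerivAt (hasDerivAt_elasticaArclength hk)
    (contDiff_const.mul (contDiff_inv_elasticaDelta hk)), fun t => ?_, fun t => ?_⟩
  · rw [(hasDerivAt_elasticaArclength hk t).deriv]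
    exact mul_pos (elasticaScale_pos hk) (inv_pos.2 (elasticaDelta_pos hk t))
  · have h1 : elasticaScale k * (∫ u in (0 : ℝ)..(2 * π), (elasticaDelta k u)⁻¹) = 2 * π := by
      refine div_mul_cancel₀ _ (ne_of_gt ?_)
      exact intervalIntegral.intervalIntegral_pos_of_pos (hc.intervalIntegrable _ _)
        (fun u => inv_pos.2 (elasticaDelta_pos hk u)) (by positivity)
    unfold elasticaArclength
    rw [← intervalIntegral.integral_add_adjacent_intervals (hc.intervalIntegrable 0 t)
      (hc.intervalIntegrable _ _), Function.Periodic.intervalIntegral_add_eq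
      (f := fun u => (elasticaDelta k u)⁻¹) (fun u => by simp only [periodic_elasticaDelta k u]) t 0,
      zero_add, mul_add, h1]

lemma elasticaAmplitude_spec (hk : k ∈ Set.Ioo (0 : ℝ) 1) :
    IsReparametrization (elasticaAmplitude k) ∧
    (∀ t, elasticaAmplitude k (elasticaArclength k t) = t) ∧
    ∀ s, elasticaArclength k (elasticaAmplitude k s) = s := by
  have hσ := isReparametrization_elasticaArclength hk
  obtain ⟨τ, hτ, h1, h2⟩ := hσ.exists_inverse
  have : elasticaAmplitude k = τ := funext fun s => by
    apply hσ.strictMono.injective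
    rw [h2]
    exact Function.rightInverse_invFun hσ.surjective s
  rw [this]
  exact ⟨hτ, h1, h2⟩

lemma elasticaArclength_zero (k : ℝ) : elasticaArclength k 0 = 0 := by
  simp [elasticaArclength]

lemma elasticaAmplitude_zero (hk : k ∈ Set.Ioo (0 : ℝ) 1) : elasticaAmplitude k 0 = 0 := by
  have := (elasticaAmplitude_spec hk).2.1 0
  rwa [elasticaArclength_zero] at this

lemma hasDerivAt_elasticaAmplitude (hk : k ∈ Set.Ioo (0 : ℝ) 1) (s : ℝ) :
    HasDerivAt (elasticaAmplitude k)
      (elasticaDelta k (elasticaAmplitude k s) / elasticaScale k) s := by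
  obtain ⟨hτ, -, h2⟩ := elasticaAmplitude_spec hk
  have hpos := elasticaDelta_pos hk (elasticaAmplitude k s)
  have hsc := elasticaScale_pos hk
  refine (HasDerivAt.of_local_left_inverse hτ.continuous.continuousAt
    (hasDerivAt_elasticaArclength hk _) (by positivity) (Eventually.of_forall h2)).congr_deriv ?_
  field_simp

lemma cos_arcsin_elastica (u : ℝ) : cos (arcsin (k * sin u)) = elasticaDelta k u := by
  rw [cos_arcsin, elasticaDelta, mul_pow]

lemma abs_mul_sin_lt_one (hk : k ∈ Set.Ioo (0 : ℝ) 1) (u : ℝ) : |k * sin u| < 1 := by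
  rw [abs_mul, abs_of_pos hk.1]
  nlinarith [hk.1, hk.2, abs_sin_le_one u]

lemma sin_arcsin_elastica (hk : k ∈ Set.Ioo (0 : ℝ) 1) (u : ℝ) :
    sin (arcsin (k * sin u)) = k * sin u := by
  have := abs_lt.1 (abs_mul_sin_lt_one hk u)
  exact sin_arcsin this.1.le this.2.le

lemma cos_elasticaAngle (hk : k ∈ Set.Ioo (0 : ℝ) 1) (s : ℝ) :
    cos (elasticaAngle k s) = 1 - 2 * k ^ 2 * sin (elasticaAmplitude k s) ^ 2 := by
  rw [elasticaAngle, cos_neg, cos_two_mul', cos_arcsin_elastica, sin_arcsin_elastica hk,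
    elasticaDelta_sq hk]
  ring

lemma sin_elasticaAngle (hk : k ∈ Set.Ioo (0 : ℝ) 1) (s : ℝ) :
    sin (elasticaAngle k s) =
      -(2 * k * sin (elasticaAmplitude k s) * elasticaDelta k (elasticaAmplitude k s)) := by
  rw [elasticaAngle, sin_neg, sin_two_mul, cos_arcsin_elastica, sin_arcsin_elastica hk]
  ring

/-- The angular velocity of the elastica of modulus `k`. -/
noncomputable def elasticaCurvature (k s : ℝ) : ℝ :=
  -(2 * k * cos (elasticaAmplitude k s) / elasticaScale k)

/-- The amplitude moves with speed `Δ / λ`, where `λ` is the scale, and the derivative of `arcsin`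
at `k sin τ` is `1 / Δ`; the two factors `Δ` cancel. -/
lemma hasDerivAt_elasticaAngle (hk : k ∈ Set.Ioo (0 : ℝ) 1) (s : ℝ) :
    HasDerivAt (elasticaAngle k) (elasticaCurvature k s) s := by
  set τ := elasticaAmplitude k s with hτ
  have h := abs_lt.1 (abs_mul_sin_lt_one hk τ)
  have hpos := elasticaDelta_pos hk τ
  have hsc := elasticaScale_pos hk
  have h1 := (hasDerivAt_arcsin h.1.ne' h.2.ne).comp s
    (((hasDerivAt_elasticaAmplitude hk s).sin).const_mul k)
  refine (h1.const_mul 2).neg.congr_deriv ?_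
  rw [elasticaCurvature, ← hτ, mul_pow]
  change -(2 * (1 / elasticaDelta k τ * _)) = _
  field_simp

lemma hasDerivAt_elasticaCurvature (hk : k ∈ Set.Ioo (0 : ℝ) 1) (s : ℝ) :
    HasDerivAt (elasticaCurvature k)
      (-((elasticaScale k ^ 2)⁻¹ * sin (elasticaAngle k s))) s := by
  have hsc := elasticaScale_pos hk
  refine ((((hasDerivAt_elasticaAmplitude hk s).cos).const_mul (2 * k)).div_const
    (elasticaScale k)).neg.congr_deriv ?_
  rw [sin_elasticaAngle hk]
  field_simp

lemma contDiff_elasticaAngle (hk : k ∈ Set.Ioo (0 : ℝ) 1) : ContDiff ℝ 1 (elasticaAngle k) :=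
  contDiff_one_of_hasDerivAt (hasDerivAt_elasticaAngle hk) (continuous_iff_continuousAt.2
    fun s => (hasDerivAt_elasticaCurvature hk s).continuousAt)

lemma periodic_elasticaAngle (hk : k ∈ Set.Ioo (0 : ℝ) 1) :
    Function.Periodic (elasticaAngle k) (2 * π) := fun s => by
  simp only [elasticaAngle, (elasticaAmplitude_spec hk).1.add_period, sin_add_two_pi]

/-- Links the angle to the explicit curve: speed times unit tangent, in the amplitude parameter, is
the velocity of the closed formula. -/
lemma tangent_elasticaAngle (hk : k ∈ Set.Ioo (0 : ℝ) 1) (t : ℝ) :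
    (elasticaScale k * (elasticaDelta k t)⁻¹ : ℝ) *
      tangent (elasticaAngle k) (elasticaArclength k t) =
      elasticaScale k * ((elasticaVelocity k t : ℝ) + (2 * k * -sin t : ℝ) * Complex.I) := by
  have hpos := elasticaDelta_pos hk t
  have hv : elasticaVelocity k t = (1 - 2 * k ^ 2 * sin t ^ 2) * (elasticaDelta k t)⁻¹ := by
    rw [elasticaVelocity, div_eq_mul_inv, elasticaDelta]
  have h1 := cos_elasticaAngle hk (elasticaArclength k t)
  have h2 := sin_elasticaAngle hk (elasticaArclength k t)
  rw [(elasticaAmplitude_spec hk).2.1] at h1 h2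
  have h3 : elasticaDelta k t * (elasticaDelta k t)⁻¹ = 1 := mul_inv_cancel₀ hpos.ne'
  rw [hv]
  apply Complex.ext
  · simp only [Complex.mul_re, Complex.mul_im, Complex.add_re, Complex.add_im, Complex.ofReal_re,
      Complex.ofReal_im, tangent_re, tangent_im, Complex.I_re, Complex.I_im, h1, h2]
    ring
  · simp only [Complex.mul_re, Complex.mul_im, Complex.add_re, Complex.add_im, Complex.ofReal_re,
      Complex.ofReal_im, tangent_re, tangent_im, Complex.I_re, Complex.I_im, h1, h2]
    linear_combination (-(elasticaScale k * 2 * k * sin t)) * h3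

/-- In the amplitude parameter the vertical velocity is a multiple of `sin`, whose integral is zero,
so only the horizontal gap obstructs closure. -/
lemma integral_tangent_elasticaAngle (hk : k ∈ Set.Ioo (0 : ℝ) 1) :
    ∫ s in (0 : ℝ)..(2 * π), tangent (elasticaAngle k) s =
      ((elasticaScale k * elasticaGap k : ℝ) : ℂ) := by
  have hσ := isReparametrization_elasticaArclength hk
  have hp : Function.Periodic (tangent (elasticaAngle k)) (2 * π) := fun s => by
    simp only [tangent, periodic_elasticaAngle hk s]
  rw [← hσ.integral_comp_period (continuous_tangent (contDiff_elasticaAngle hk).continuous) hp]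
  have hvc := continuous_elasticaVelocity hk.1.le hk.2
  simp only [Complex.real_smul, (hasDerivAt_elasticaArclength hk _).deriv,
    tangent_elasticaAngle hk]
  rw [intervalIntegral.integral_const_mul, intervalIntegral.integral_add
    (Continuous.intervalIntegrable (by fun_prop) _ _)
    (Continuous.intervalIntegrable (by fun_prop) _ _), intervalIntegral.integral_mul_const,
    intervalIntegral.integral_ofReal, intervalIntegral.integral_ofReal,
    intervalIntegral.integral_const_mul, intervalIntegral.integral_neg, integral_sin]
  simp [elasticaGap]

end

/-! ### Multiple covers -/

lemma integral_comp_nat_mul {E : Type*} [NormedAddCommGroup E] [NormedSpace ℝ E]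
    {f : ℝ → E} (hf : Continuous f) (hp : Function.Periodic f (2 * π)) {n : ℕ} (hn : 1 ≤ n) :
    ∫ s in (0 : ℝ)..(2 * π), f (n * s) = ∫ s in (0 : ℝ)..(2 * π), f s := by
  have hn0 : (n : ℝ) ≠ 0 := by positivity
  rw [intervalIntegral.integral_comp_mul_left _ hn0, mul_zero]
  have := hp.intervalIntegral_add_zsmul_eq n 0 (fun a b => hf.intervalIntegrable a b)
  simp only [zero_add, zsmul_eq_mul, Int.cast_natCast] at this
  rw [this, natCast_zsmul, ← Nat.cast_smul_eq_nsmul ℝ n, smul_smul, inv_mul_cancel₀ hn0, one_smul]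

lemma nat_mul_add_period {f : ℝ → ℝ} (hp : Function.Periodic f (2 * π)) (n : ℕ) (s : ℝ) :
    f (n * (s + 2 * π)) = f (n * s) := by
  rw [mul_add]; exact hp.nat_mul n _

lemma IsReparametrization.nat_mul {σ : ℝ → ℝ} (h : IsReparametrization σ) {n : ℕ} (hn : 1 ≤ n) :
    IsReparametrization (fun t => σ (n * t) / n) where
  contDiff := (h.contDiff.comp (contDiff_const.mul contDiff_id)).div_const _
  deriv_pos t := by
    have hn0 : (0 : ℝ) < n := by positivity
    have h1 : HasDerivAt (fun t : ℝ => (n : ℝ) * t) n t := by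
      simpa using (hasDerivAt_id t).const_mul (n : ℝ)
    have h2 : HasDerivAt (fun t => σ (n * t) / n) _ t := ((h.hasDerivAt (n * t)).comp t h1).div_const _
    rw [h2.deriv]
    have := h.deriv_pos (n * t)
    positivity
  add_period t := by
    have hn0 : (n : ℝ) ≠ 0 := by positivity
    have := h.add_int_period (n * t) n
    rw [Int.cast_natCast] at this
    rw [mul_add, this]
    field_simp

lemma bernoulliModulus_spec : bernoulliModulus ∈ Set.Ioo (0 : ℝ) 1 ∧
    elasticaGap bernoulliModulus = 0 := existsUnique_modulus.choose_spec.1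

lemma eq_bernoulliModulus {k : ℝ} (hk : k ∈ Set.Ioo (0 : ℝ) 1) (h0 : elasticaGap k = 0) :
    k = bernoulliModulus := existsUnique_modulus.choose_spec.2 k ⟨hk, h0⟩

/-- The tangent angle of Bernoulli's elastica traversed `n` times. -/
noncomputable def bernoulliAngle (n : ℕ) (s : ℝ) : ℝ := elasticaAngle bernoulliModulus (n * s)

lemma hasDerivAt_bernoulliAngle (n : ℕ) (s : ℝ) :
    HasDerivAt (bernoulliAngle n) (n * elasticaCurvature bernoulliModulus (n * s)) s := by
  have h1 : HasDerivAt (fun t : ℝ => (n : ℝ) * t) n s := by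
    simpa using (hasDerivAt_id s).const_mul (n : ℝ)
  exact ((hasDerivAt_elasticaAngle bernoulliModulus_spec.1 (n * s)).comp s h1).congr_deriv
    (mul_comm _ _)

lemma isClosedAngle_bernoulliAngle {n : ℕ} (hn : 1 ≤ n) : IsClosedAngle (bernoulliAngle n) 0 where
  contDiff := (contDiff_elasticaAngle bernoulliModulus_spec.1).comp
    (contDiff_const.mul contDiff_id)
  add_period s := by
    rw [bernoulliAngle, nat_mul_add_period (periodic_elasticaAngle bernoulliModulus_spec.1)]
    simp [bernoulliAngle]
  closed := by
    have hk := bernoulliModulus_spec.1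
    have := integral_comp_nat_mul (f := tangent (elasticaAngle bernoulliModulus))
      (continuous_tangent (contDiff_elasticaAngle hk).continuous)
      (fun s => by simp only [tangent, periodic_elasticaAngle hk s]) hn
    rw [integral_tangent_elasticaAngle hk, bernoulliModulus_spec.2] at this
    simpa [tangent, bernoulliAngle] using this

lemma hasAngle_bernoulliTimes {n : ℕ} (hn : 1 ≤ n) :
    ∃ z, HasAngle (bernoulliTimes n) z (bernoulliAngle n) 0
      (fun t => elasticaArclength bernoulliModulus (n * t) / n) := by
  set k := bernoulliModulus with hkdef
  have hk : k ∈ Set.Ioo (0 : ℝ) 1 := bernoulliModulus_spec.1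
  have hn0 : (n : ℂ) ≠ 0 := by exact_mod_cast (by positivity : n ≠ 0)
  have hn1 : (n : ℝ) ≠ 0 := by positivity
  have hσ := (isReparametrization_elasticaArclength hk).nat_mul hn
  have hvc := continuous_elasticaVelocity hk.1.le hk.2
  have hang := isClosedAngle_bernoulliAngle hn
  have hmul : ∀ t : ℝ, HasDerivAt (fun t : ℝ => (n : ℝ) * t) n t := fun t => by
    simpa using (hasDerivAt_id t).const_mul (n : ℝ)
  have hB : ∀ t, HasDerivAt bernoulli ((elasticaScale k : ℂ) *
      ((elasticaVelocity k t : ℝ) + (2 * k * -sin t : ℝ) * Complex.I)) t := fun t => by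
    have h1 := (hasDerivAt_integral hvc 0 t).ofReal_comp
    have h2 := (((hasDerivAt_cos t).const_mul (2 * k)).ofReal_comp).mul_const Complex.I
    exact (h1.add h2).const_mul _
  refine ⟨bernoulliTimes n 0, hang, hσ, funext fun t => ?_⟩
  refine eq_of_hasDerivAt (f' := fun t => (elasticaScale k : ℂ) *
      ((elasticaVelocity k (n * t) : ℝ) + (2 * k * -sin (n * t) : ℝ) * Complex.I))
    (fun t => ?_) (fun t => ?_) 0 ?_ t
  · have h1 := ((hB (n * t)).scomp t (hmul t)).const_mul (n : ℂ)⁻¹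
    refine h1.congr_deriv ?_
    rw [Complex.real_smul, Complex.ofReal_natCast, inv_mul_cancel_left₀ hn0]
  · have h1 := hasDerivAt_primitiveAlong (z := bernoulliTimes n 0)
      (continuous_tangent hang.contDiff.continuous) hσ t
    refine h1.congr_deriv ?_
    have h2 : HasDerivAt (fun t => elasticaArclength k (n * t) / n) _ t :=
      ((hasDerivAt_elasticaArclength hk (n * t)).comp t (hmul t)).div_const _
    rw [h2.deriv, mul_div_cancel_right₀ _ hn1, ← tangent_elasticaAngle hk]
    simp only [tangent, bernoulliAngle, mul_div_cancel₀ _ hn1, ← hkdef]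
  · simp [primitiveAlong, elasticaArclength_zero]

lemma hasAngle_circleTimes {n : ℕ} (hn : 1 ≤ n) :
    HasAngle (circleTimes n) (n : ℂ)⁻¹ (fun s => n * s + π / 2) n id := by
  have hn0 : (n : ℂ) ≠ 0 := by exact_mod_cast (by positivity : n ≠ 0)
  have hid : IsReparametrization id := ⟨contDiff_id, fun t => by simp, fun t => rfl⟩
  have hc : ContDiff ℝ 1 fun s : ℝ => (n : ℝ) * s + π / 2 := by fun_prop
  have htc := continuous_tangent hc.continuous
  have hd : ∀ t, HasDerivAt (circleTimes n) (tangent (fun s => n * s + π / 2) t) t := fun t => by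
    have h1 : HasDerivAt (fun t : ℝ => (n : ℝ) * t) n t := by
      simpa using (hasDerivAt_id t).const_mul (n : ℝ)
    refine ((h1.ofReal_comp.mul_const Complex.I).cexp.const_mul (n : ℂ)⁻¹).congr_deriv ?_
    rw [tangent]
    push_cast
    rw [add_mul, Complex.exp_add, Complex.exp_pi_div_two_mul_I]
    field_simp
  have hper : ∀ s : ℝ, (n : ℝ) * (s + 2 * π) + π / 2 = n * s + π / 2 + (n : ℤ) * (2 * π) :=
    fun s => by push_cast; ring
  refine ⟨⟨hc, hper, integral_eq_zero_of_periodic hd htc fun t => ?_⟩, hid, funext fun t => ?_⟩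
  · simp only [circleTimes]
    congr 1
    have := Complex.exp_periodic.nat_mul n (((n : ℝ) * t : ℝ) * Complex.I)
    rw [← this]
    push_cast
    ring_nf
  · rw [primitiveAlong, intervalIntegral.integral_eq_sub_of_hasDerivAt (fun x _ => hd x)
      (htc.intervalIntegrable _ _)]
    simp [circleTimes]

/-! ### Classification of critical curves -/

lemma IsClosedAngle.eq_linear {θ : ℝ → ℝ} {m : ℤ} (h : IsClosedAngle θ m)
    (hd : ∀ s, HasDerivAt (deriv θ) 0 s) : m ≠ 0 ∧ ∀ s, θ s = m * s + θ 0 := by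
  have h1 : ∀ s, deriv θ s = deriv θ 0 := fun s =>
    eq_of_hasDerivAt hd (fun s => hasDerivAt_const s (deriv θ 0)) 0 rfl s
  have h2 : ∀ s, θ s = deriv θ 0 * s + θ 0 := by
    refine eq_of_hasDerivAt (f' := fun _ => deriv θ 0) (fun s => ?_) (fun s => ?_) 0 (by simp)
    · rw [← h1 s]; exact h.hasDerivAt s
    · exact (((hasDerivAt_id s).const_mul (deriv θ 0)).add_const (θ 0)).congr_deriv (mul_one _)
  have h3 : deriv θ 0 = m := by
    have h4 := h.add_period 0
    rw [h2 (0 + 2 * π), zero_add, add_comm, add_left_cancel_iff] at h4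
    exact mul_right_cancel₀ (by positivity) h4
  refine ⟨fun hm => h.not_deriv_eq_zero fun s => ?_, fun s => by rw [← h3]; exact h2 s⟩
  rw [h1, h3, hm, Int.cast_zero]

/-- Excludes rotating pendulums. If `θ'` had no zero, `sin (θ - c) / θ'` would be periodic with
derivative `cos (θ - c) + μ sin² (θ - c) / θ'²`. The first term integrates to zero by closure, so
the second vanishes identically; then `sin (θ - c)` is constantly zero, which `θ' ≠ 0` forbids. -/
lemma IsClosedAngle.exists_deriv_eq_zero {θ : ℝ → ℝ} {m : ℤ} (h : IsClosedAngle θ m) {μ c : ℝ}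
    (hμ : 0 < μ) (hd : ∀ s, HasDerivAt (deriv θ) (-(μ * sin (θ s - c))) s) :
    ∃ s, deriv θ s = 0 := by
  by_contra! hne
  have hθc := h.contDiff.continuous
  have hc1 := h.continuous_deriv
  have hx : ∀ s, HasDerivAt (fun s => θ s - c) (deriv θ s) s := fun s =>
    (h.hasDerivAt s).sub_const c
  have hcont : Continuous fun s => sin (θ s - c) ^ 2 / deriv θ s ^ 2 :=
    Continuous.div (by fun_prop) (by fun_prop) fun s => pow_ne_zero 2 (hne s)
  have hper : Function.Periodic (fun s => sin (θ s - c)) (2 * π) := fun s => by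
    simp only
    rw [h.add_period, show θ s + m * (2 * π) - c = θ s - c + m * (2 * π) by ring,
      sin_add_int_mul_two_pi]
  have h1 : ∀ s, HasDerivAt (fun s => sin (θ s - c) / deriv θ s)
      (cos (θ s - c) + μ * (sin (θ s - c) ^ 2 / deriv θ s ^ 2)) s := fun s => by
    refine ((hx s).sin.div (hd s) (hne s)).congr_deriv ?_
    have := hne s
    field_simp
    ring
  have h2 := integral_eq_zero_of_periodic h1 (by fun_prop) fun s => by
    have := hper s
    simp only at this
    simp only [this, h.periodic_deriv s]
  rw [intervalIntegral.integral_add (Continuous.intervalIntegrable (by fun_prop) _ _)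
    (Continuous.intervalIntegrable (by fun_prop) _ _), h.integral_cos_sub, zero_add,
    intervalIntegral.integral_const_mul] at h2
  have h3 := eq_zero_of_integral_eq_zero hcont (fun s => by
    have := hper s
    simp only at this
    simp only [this, h.periodic_deriv s]) (fun s => by positivity)
    ((mul_eq_zero.1 h2).resolve_left hμ.ne')
  have h4 : ∀ s, sin (θ s - c) = 0 := fun s => by
    rcases div_eq_zero_iff.1 (h3 s) with h5 | h5
    · exact pow_eq_zero_iff two_ne_zero |>.1 h5
    · exact absurd h5 (pow_ne_zero 2 (hne s))
  have h5 := (hx 0).sin.unique ((hasDerivAt_const (0 : ℝ) (0 : ℝ)).congr_of_eventuallyEq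
    (Eventually.of_forall h4))
  have h6 := (mul_eq_zero.1 h5).resolve_right (hne 0)
  have h7 := sin_sq_add_cos_sq (θ 0 - c)
  rw [h4, h6] at h7
  norm_num at h7

lemma arcsin_sin_half {A : ℝ} (h0 : 0 < A) (hπ : A < π) : arcsin (sin (A / 2)) = A / 2 :=
  arcsin_sin (by linarith) (by linarith)

/-- A closed solution of the pendulum equation that starts at rest is a multiple of the
oscillation of Bernoulli's elastica. -/
lemma oscillation_eq_bernoulliAngle {y y' : ℝ → ℝ} {μ s₁ : ℝ} {m : ℤ} (hμ : 0 < μ)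
    (hy : ∀ s, HasDerivAt y (y' s) s) (hy' : ∀ s, HasDerivAt y' (-(μ * sin (y s))) s)
    (hper : ∀ s, y (s + 2 * π) = y s + m * (2 * π)) (h0 : 0 < y s₁) (hπ : y s₁ < π)
    (h0' : y' s₁ = 0) (hcos : ∫ s in (0 : ℝ)..(2 * π), cos (y s) = 0) :
    ∃ (n : ℕ) (a : ℝ), 1 ≤ n ∧ ∀ s, y s = bernoulliAngle n (s + a) := by
  set A := y s₁ with hA
  set k := sin (A / 2) with hkdef
  have hk : k ∈ Set.Ioo (0 : ℝ) 1 := by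
    refine ⟨sin_pos_of_pos_of_lt_pi (by linarith) (by linarith), ?_⟩
    rw [hkdef, ← sin_pi_div_two]
    exact sin_lt_sin_of_lt_of_le_pi_div_two (by linarith) le_rfl (by linarith)
  have hl := elasticaScale_pos hk
  -- The model oscillation has frequency parameter `λ⁻²` with `λ = elasticaScale k`; running it at
  -- speed `r` changes this to `r² λ⁻² = μ`.
  set r := elasticaScale k * √μ with hr
  have hr0 : 0 < r := mul_pos hl (sqrt_pos.2 hμ)
  -- At amplitude `-π / 2` the model angle is at its maximum `2 arcsin k = A`, with zero velocity:
  -- the same initial data as `y` at `s₁`.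
  set u₀ := elasticaArclength k (-(π / 2)) with hu₀
  obtain ⟨hτ, hτσ, hστ⟩ := elasticaAmplitude_spec hk
  have hlin : ∀ s, HasDerivAt (fun s => r * (s - s₁) + u₀) r s := fun s =>
    ((((hasDerivAt_id s).sub_const s₁).const_mul r).add_const u₀).congr_deriv (mul_one r)
  have hrμ : r * r * (elasticaScale k ^ 2)⁻¹ = μ := by
    have := Real.mul_self_sqrt hμ.le
    rw [hr]; field_simp; rw [pow_two]; exact this
  have hyz : y = fun s => elasticaAngle k (r * (s - s₁) + u₀) := by
    refine pendulum_unique (μ := μ) (s₀ := s₁) hy hy'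
      (y' := fun s => r * elasticaCurvature k (r * (s - s₁) + u₀)) (fun s => ?_) (fun s => ?_) ?_ ?_
    · exact ((hasDerivAt_elasticaAngle hk _).comp s (hlin s)).congr_deriv (mul_comm _ _)
    · refine (((hasDerivAt_elasticaCurvature hk _).comp s (hlin s)).const_mul r).congr_deriv ?_
      linear_combination (-sin (elasticaAngle k (r * (s - s₁) + u₀))) * hrμ
    · rw [sub_self, mul_zero, zero_add, elasticaAngle, hu₀, hτσ, sin_neg, sin_pi_div_two,
        mul_neg_one, arcsin_neg, hkdef, arcsin_sin_half h0 hπ, ← hA]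
      ring
    · rw [h0', sub_self, mul_zero, zero_add, elasticaCurvature, hu₀, hτσ, cos_neg, cos_pi_div_two]
      simp
  -- An oscillation stays in `[-π, π]`, while `y s₁` lies strictly between `0` and `π`; there is no
  -- room for a nonzero multiple of `2π`.
  have hm : m = 0 := by
    have h1 := hper s₁
    have h2 : |y (s₁ + 2 * π)| ≤ π := by
      rw [hyz]
      simp only [elasticaAngle]
      rw [abs_neg, abs_mul, abs_two]
      have := abs_le.2 ⟨neg_pi_div_two_le_arcsin
        (k * sin (elasticaAmplitude k (r * (s₁ + 2 * π - s₁) + u₀))), arcsin_le_pi_div_two _⟩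
      linarith
    rw [h1, ← hA] at h2
    obtain ⟨h3, h4⟩ := abs_le.1 h2
    have h5 : (m : ℝ) < 1 := by
      by_contra! h; nlinarith [pi_pos]
    have h6 : (-1 : ℝ) < m := by
      by_contra! h; nlinarith [pi_pos]
    have h7 : m < 1 := by exact_mod_cast h5
    have h8 : -1 < m := by exact_mod_cast h6
    omega
  -- After time `2π` the angle is again at its maximum, which happens only at amplitudes `-π / 2 +
  -- 2πN`. Hence `r * 2π = N * 2π`.
  obtain ⟨N, hN⟩ : ∃ N : ℤ, r = N := by
    have h1 := hper s₁
    rw [hm, Int.cast_zero, zero_mul, add_zero, ← hA, hyz] at h1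
    simp only [elasticaAngle] at h1
    rw [show s₁ + 2 * π - s₁ = 2 * π by ring] at h1
    set t := elasticaAmplitude k (r * (2 * π) + u₀) with ht
    have h2 : arcsin (k * sin t) = -(A / 2) := by linarith
    have h3 := sin_arcsin_elastica hk t
    rw [h2, sin_neg, ← hkdef] at h3
    have h4 : sin t = -1 := mul_left_cancel₀ hk.1.ne' (by linarith)
    obtain ⟨N, hN⟩ := Real.sin_eq_neg_one_iff.1 h4
    refine ⟨N, ?_⟩
    have h5 := hστ (r * (2 * π) + u₀)
    rw [← ht, ← hN, (isReparametrization_elasticaArclength hk).add_int_period, ← hu₀] at h5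
    have h6 : r * (2 * π) = N * (2 * π) := by linarith
    exact mul_right_cancel₀ (by positivity) h6
  have hNpos : 0 < N := by
    have : (0 : ℝ) < N := hN ▸ hr0
    exact_mod_cast this
  obtain ⟨n, rfl⟩ := Int.eq_ofNat_of_zero_le hNpos.le
  have hn : 1 ≤ n := by omega
  have hn0 : (n : ℝ) ≠ 0 := by positivity
  rw [Int.cast_natCast] at hN
  have hyn : ∀ s, y s = elasticaAngle k (n * (s + (u₀ / n - s₁))) := fun s => by
    rw [hyz]
    simp only [hN]
    congr 1
    field_simp
    ring
  have hcp : Function.Periodic (fun s => cos (elasticaAngle k s)) (2 * π) := fun s => by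
    simp only [periodic_elasticaAngle hk s]
  have hcc : Continuous fun s => cos (elasticaAngle k s) :=
    continuous_cos.comp (contDiff_elasticaAngle hk).continuous
  -- Undoing the shift and the `n`-fold cover turns the closure condition for `y` into the one for a
  -- single period of the model.
  have hgap : elasticaGap k = 0 := by
    simp only [hyn] at hcos
    rw [integral_shift_of_periodic (f := fun s => cos (elasticaAngle k (n * s)))
      (fun s => by simp only [nat_mul_add_period (periodic_elasticaAngle hk)]),
      integral_comp_nat_mul hcc hcp hn] at hcos
    have h1 := Complex.reCLM.intervalIntegral_comp_comm
      ((continuous_tangent (contDiff_elasticaAngle hk).continuous).intervalIntegrable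
        (μ := MeasureTheory.volume) 0 (2 * π))
    rw [integral_tangent_elasticaAngle hk] at h1
    simp only [Complex.reCLM_apply, tangent_re, Complex.ofReal_re, hcos] at h1
    exact (mul_eq_zero.1 h1.symm).resolve_left hl.ne'
  refine ⟨n, u₀ / n - s₁, hn, fun s => ?_⟩
  rw [hyn, bernoulliAngle, ← eq_bernoulliModulus hk hgap]

theorem IsCritical.classification {γ : ℝ → ℂ} (hγ : IsCritical γ) :
    ∃ n : ℕ, 1 ≤ n ∧ (SameShape γ (circleTimes n) ∨ SameShape γ (bernoulliTimes n)) := by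
  obtain ⟨z, θ, m, σ, h⟩ := exists_hasAngle hγ.1
  have ha := h.angle
  obtain ⟨μ, c, hμ, hd⟩ := exists_pendulum_of_stationary ha
    (fun ψ hψ hp h0 => hγ.integral_eq_zero h hψ hp h0)
  rcases hμ.eq_or_lt with rfl | hμ
  · simp only [zero_mul, neg_zero] at hd
    obtain ⟨hm, hlin⟩ := ha.eq_linear hd
    have hn : 1 ≤ m.natAbs := Int.natAbs_pos.2 hm
    refine ⟨m.natAbs, hn, Or.inl ?_⟩
    rcases Int.natAbs_eq m with hm' | hm'
    · refine sameShape_of_angle h (hasAngle_circleTimes hn) 0 (θ 0 - π / 2) (Or.inl fun s => ?_)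
      have : (m : ℝ) = m.natAbs := by rw [← Int.cast_natCast m.natAbs, ← hm']
      rw [hlin, this]; ring
    · refine sameShape_of_angle h (hasAngle_circleTimes hn) 0 (θ 0 + π / 2) (Or.inr fun s => ?_)
      have : (m : ℝ) = -(m.natAbs : ℝ) := by exact_mod_cast hm'
      rw [hlin, this]; ring
  · obtain ⟨s₁, hs₁⟩ := ha.exists_deriv_eq_zero hμ hd
    -- The phase is chosen modulo `2π` so that the rest position is measured from the nearest stable
    -- equilibrium.
    obtain ⟨c', j, hc', hlo, hhi⟩ : ∃ (c' : ℝ) (j : ℤ), c' = c + j * (2 * π) ∧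
        -π < θ s₁ - c' ∧ θ s₁ - c' ≤ π := by
      have h1 := toIocMod_mem_Ioc (by positivity : (0 : ℝ) < 2 * π) (-π) (θ s₁ - c)
      have h2 := self_sub_toIocDiv_zsmul (by positivity : (0 : ℝ) < 2 * π) (-π) (θ s₁ - c)
      refine ⟨_, toIocDiv (by positivity : (0 : ℝ) < 2 * π) (-π) (θ s₁ - c), rfl, ?_⟩
      rw [zsmul_eq_mul] at h2
      rw [← sub_sub, h2]
      exact ⟨h1.1, by linarith [h1.2]⟩
    have hd' : ∀ s, HasDerivAt (deriv θ) (-(μ * sin (θ s - c'))) s := fun s => by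
      rw [hc', show θ s - (c + j * (2 * π)) = θ s - c - j * (2 * π) by ring,
        sin_sub_int_mul_two_pi]
      exact hd s
    -- A pendulum at rest at an equilibrium stays there, and a constant angle does not close up.
    have hsin : sin (θ s₁ - c') ≠ 0 := fun h0 => by
      refine ha.not_deriv_eq_zero fun s => ?_
      have h1 := pendulum_unique (μ := μ) (s₀ := s₁) (x := fun s => θ s - c')
        (fun s => (ha.hasDerivAt s).sub_const c') hd' (y := fun _ => θ s₁ - c') (y' := fun _ => 0)
        (fun s => hasDerivAt_const s _) (fun s => by
          simp only [h0, mul_zero, neg_zero]; exact hasDerivAt_const s _) rfl hs₁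
      have h2 : θ = fun _ => θ s₁ := funext fun s => by
        have : θ s - c' = θ s₁ - c' := congrFun h1 s
        linarith
      rw [h2, deriv_const]
    have hne0 : θ s₁ - c' ≠ 0 := fun h0 => hsin (by rw [h0, sin_zero])
    have hneπ : θ s₁ - c' ≠ π := fun h0 => hsin (by rw [h0, sin_pi])
    -- The comparison starts from a positive maximum; a negative rest position is brought to that
    -- case by a reflection.
    rcases hne0.lt_or_gt with hneg | hpos
    · obtain ⟨n, a, hn, hna⟩ := oscillation_eq_bernoulliAngle (y := fun s => -(θ s - c'))
        (y' := fun s => -deriv θ s) (m := -m) (s₁ := s₁) hμ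
        (fun s => ((ha.hasDerivAt s).sub_const c').neg)
        (fun s => by rw [sin_neg, mul_neg]; exact (hd' s).neg)
        (fun s => by rw [ha.add_period]; push_cast; ring) (by linarith) (by linarith)
        (by rw [hs₁, neg_zero]) (by simp only [cos_neg]; exact ha.integral_cos_sub c')
      obtain ⟨z', hb⟩ := hasAngle_bernoulliTimes hn
      exact ⟨n, hn, Or.inr (sameShape_of_angle h hb a c' (Or.inr fun s => by
        have := hna s; linarith))⟩
    · obtain ⟨n, a, hn, hna⟩ := oscillation_eq_bernoulliAngle (y := fun s => θ s - c')
        (y' := fun s => deriv θ s) (m := m) (s₁ := s₁) hμ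
        (fun s => (ha.hasDerivAt s).sub_const c') hd'
        (fun s => by rw [ha.add_period]; ring) (by linarith) (lt_of_le_of_ne hhi hneπ) hs₁
        (ha.integral_cos_sub c')
      obtain ⟨z', hb⟩ := hasAngle_bernoulliTimes hn
      exact ⟨n, hn, Or.inr (sameShape_of_angle h hb a c' (Or.inl fun s => by
        have := hna s; linarith))⟩

/-! ### Rotation number and circles -/

/-- If `‖η' - γ'‖ < ‖γ'‖` everywhere, the two tangents have positive inner product, so the
difference `d` of the angles never meets a zero of the cosine. Over a period `d` changes by `2π (m'
- m)`, which must therefore be zero. -/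
lemma HasAngle.exists_rotation_number_eq {γ : ℝ → ℂ} {z : ℂ} {θ : ℝ → ℝ} {m : ℤ} {σ : ℝ → ℝ}
    (h : HasAngle γ z θ m σ) : ∃ ε : ℝ, 0 < ε ∧ ∀ (η : ℝ → ℂ) (z' : ℂ) (θ' : ℝ → ℝ) (m' : ℤ)
      (σ' : ℝ → ℝ), HasAngle η z' θ' m' σ' → (∀ t, ‖deriv η t - deriv γ t‖ < ε) → m' = m := by
  obtain ⟨C, hC0, hC⟩ := exists_bound_of_periodic (f := fun t => (deriv σ t)⁻¹)
    (fun t => by simp only [h.reparam.periodic_deriv t])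
    (h.reparam.contDiff_deriv.continuous.inv₀ fun t => (h.reparam.deriv_pos t).ne')
  refine ⟨C⁻¹, inv_pos.2 hC0, fun η z' θ' m' σ' hη hclose => ?_⟩
  have hlow : ∀ t, C⁻¹ ≤ deriv σ t := fun t => by
    have h1 := (le_abs_self _).trans (hC t)
    exact inv_le_of_inv_le₀ (h.reparam.deriv_pos t) h1
  set d : ℝ → ℝ := fun t => θ' (σ' t) - θ (σ t) with hd
  have hdc : Continuous d := (hη.angle.contDiff.continuous.comp hη.reparam.continuous).sub
    (h.angle.contDiff.continuous.comp h.reparam.continuous)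
  have hcos : ∀ t, 0 < cos (d t) := fun t => by
    have h1 := (hclose t).trans_le (hlow t)
    have hp := hη.reparam.deriv_pos t
    have hq := h.reparam.deriv_pos t
    rw [hη.deriv_eq, h.deriv_eq] at h1
    have h2 := pow_lt_pow_left₀ h1 (norm_nonneg _) two_ne_zero
    rw [Complex.sq_norm, Complex.normSq_apply] at h2
    simp only [Complex.sub_re, Complex.sub_im, Complex.re_ofReal_mul, Complex.im_ofReal_mul,
      tangent_re, tangent_im] at h2
    have h3 := sin_sq_add_cos_sq (θ' (σ' t))
    have h4 := sin_sq_add_cos_sq (θ (σ t))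
    rw [hd]
    simp only
    rw [cos_sub]
    have h5 : deriv σ' t ^ 2 - 2 * deriv σ' t * deriv σ t *
        (cos (θ' (σ' t)) * cos (θ (σ t)) + sin (θ' (σ' t)) * sin (θ (σ t))) < 0 := by
      linear_combination h2 - deriv σ' t ^ 2 * h3 - deriv σ t ^ 2 * h4
    by_contra! h6
    nlinarith [mul_pos hp hq]
  have hend : d (2 * π) = d 0 + (m' - m : ℤ) * (2 * π) := by
    have e1 := hη.reparam.add_period 0
    have e2 := h.reparam.add_period 0
    rw [zero_add] at e1 e2
    simp only [hd]
    rw [e1, e2, hη.angle.add_period, h.angle.add_period]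
    push_cast; ring
  -- Where the cosine equals `-cos (d 0)` it is negative. If `m' ≠ m`, one of `d 0 ± π` lies between
  -- the end values of `d`, contradicting this.
  have hno : ∀ a : ℝ, cos a = -cos (d 0) → a ∉ Set.uIcc (d 0) (d (2 * π)) := fun a ha hmem => by
    obtain ⟨t, -, ht⟩ := intermediate_value_uIcc hdc.continuousOn hmem
    have h1 := hcos t
    rw [ht, ha] at h1
    linarith [hcos 0]
  by_contra hne
  have hπ := pi_pos
  rcases lt_or_gt_of_ne (sub_ne_zero.2 hne) with hlt | hgt
  · have h1 : ((m' - m : ℤ) : ℝ) ≤ -1 := by exact_mod_cast (by omega : m' - m ≤ -1)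
    have h2 : d (2 * π) ≤ d 0 - π := by rw [hend]; nlinarith
    exact hno (d 0 - π) (cos_sub_pi _) (Set.mem_uIcc.2 (Or.inr ⟨h2, by linarith⟩))
  · have h1 : (1 : ℝ) ≤ ((m' - m : ℤ) : ℝ) := by exact_mod_cast (by omega : 1 ≤ m' - m)
    have h2 : d 0 + π ≤ d (2 * π) := by rw [hend]; nlinarith
    exact hno (d 0 + π) (cos_add_pi _) (Set.mem_uIcc.2 (Or.inl ⟨by linarith, h2⟩))

/-- Since nearby curves have the same rotation number, minimality of the energy within that class is
enough. -/
lemma HasAngle.isLocalMinimum {γ : ℝ → ℂ} {z : ℂ} {θ : ℝ → ℝ} {m : ℤ} {σ : ℝ → ℝ}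
    (h : HasAngle γ z θ m σ) (hmin : ∀ θ' : ℝ → ℝ, IsClosedAngle θ' m →
      ∫ s in (0 : ℝ)..(2 * π), deriv θ s ^ 2 ≤ ∫ s in (0 : ℝ)..(2 * π), deriv θ' s ^ 2) :
    IsLocalMinimum γ := by
  obtain ⟨ε, hε, hrot⟩ := h.exists_rotation_number_eq
  refine ⟨ε, hε, fun η hη hclose => ?_⟩
  obtain ⟨z', θ', m', σ', h'⟩ := exists_hasAngle hη
  have := hrot η z' θ' m' σ' h' fun t => by
    simpa [iteratedDeriv_one] using hclose 1 (by norm_num) t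
  subst this
  rw [h.U_eq, h'.U_eq]
  exact hmin θ' h'.angle

/-- This is `∫ (θ' - m)² ≥ 0`, because `θ'` has mean `m`. -/
lemma IsClosedAngle.sq_le_integral {θ : ℝ → ℝ} {m : ℤ} (h : IsClosedAngle θ m) :
    2 * π * m ^ 2 ≤ ∫ s in (0 : ℝ)..(2 * π), deriv θ s ^ 2 := by
  have hc := h.continuous_deriv
  have h1 : ∫ s in (0 : ℝ)..(2 * π), deriv θ s = m * (2 * π) := by
    rw [intervalIntegral.integral_eq_sub_of_hasDerivAt (fun s _ => h.hasDerivAt s)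
      (hc.intervalIntegrable _ _)]
    have := h.add_period 0
    rw [zero_add] at this
    rw [this]; ring
  have h2 : 0 ≤ ∫ s in (0 : ℝ)..(2 * π), (deriv θ s ^ 2 - (2 * m * deriv θ s - m ^ 2)) :=
    intervalIntegral.integral_nonneg (by positivity) fun s _ => by
      nlinarith [sq_nonneg (deriv θ s - m)]
  rw [intervalIntegral.integral_sub (Continuous.intervalIntegrable (by fun_prop) _ _)
    (Continuous.intervalIntegrable (by fun_prop) _ _), intervalIntegral.integral_sub
    (Continuous.intervalIntegrable (by fun_prop) _ _)
    (Continuous.intervalIntegrable (by fun_prop) _ _), intervalIntegral.integral_const_mul, h1,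
    intervalIntegral.integral_const] at h2
  simp only [sub_zero, smul_eq_mul] at h2
  linarith

lemma HasAngle.isLocalMinimum_of_deriv_eq {γ : ℝ → ℂ} {z : ℂ} {θ : ℝ → ℝ} {m : ℤ} {σ : ℝ → ℝ}
    (h : HasAngle γ z θ m σ) (hd : ∀ s, deriv θ s = m) : IsLocalMinimum γ := by
  refine h.isLocalMinimum fun θ' hθ' => le_trans (le_of_eq ?_) hθ'.sq_le_integral
  simp only [hd]
  simp

theorem circleTimes_stable {n : ℕ} (hn : 1 ≤ n) {γ : ℝ → ℂ} (h : SameShape γ (circleTimes n)) :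
    γ ∈ Curves ∧ IsLocalMinimum γ := by
  have hd : ∀ s : ℝ, HasDerivAt (fun s : ℝ => (n : ℝ) * s + π / 2) n s := fun s => by
    simpa using ((hasDerivAt_id s).const_mul (n : ℝ)).add_const (π / 2)
  obtain ⟨z, c, σ, h1 | h1⟩ := h.hasAngle (hasAngle_circleTimes hn)
  · refine ⟨h1.mem_curves, h1.isLocalMinimum_of_deriv_eq fun s => ?_⟩
    rw [((hd s).add_const c).deriv, Int.cast_natCast]
  · refine ⟨h1.mem_curves, h1.isLocalMinimum_of_deriv_eq fun s => ?_⟩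
    rw [((hd s).const_sub c).deriv, Int.cast_neg, Int.cast_natCast]

/-! ### The Dirichlet problem for the pendulum -/

/-- Concavity: `sin x / x` is the slope of a chord from the origin, so it decreases on `(0, π]`. -/
lemma mul_sin_le_mul_sin {a b : ℝ} (ha : 0 < a) (hab : a ≤ b) (hb : b ≤ π) :
    a * sin b ≤ b * sin a := by
  have hb0 : 0 < b := ha.trans_le hab
  have h := strictConcaveOn_sin_Icc.concaveOn.2 (show (0 : ℝ) ∈ Set.Icc 0 π from
    ⟨le_rfl, pi_pos.le⟩) (show b ∈ Set.Icc 0 π from ⟨hb0.le, hb⟩)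
    (show 0 ≤ 1 - a / b by rw [sub_nonneg, div_le_one hb0]; exact hab)
    (show 0 ≤ a / b by positivity) (by ring)
  simp only [smul_eq_mul, sin_zero, mul_zero, zero_add, div_mul_cancel₀ _ hb0.ne'] at h
  rwa [div_mul_eq_mul_div, div_le_iff₀ hb0, mul_comm (sin a)] at h

/-- As a function of `x²`, the function `cos x` lies above its tangents at points of `(0, π)`. -/
lemma cos_add_half_sinc_le {a : ℝ} (ha : 0 < a) (haπ : a < π) (x : ℝ) :
    cos a + 1 / 2 * sinc a * a ^ 2 ≤ cos x + 1 / 2 * sinc a * x ^ 2 := by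
  have hs : sinc a = sin a / a := sinc_of_ne_zero ha.ne'
  have hs0 : 0 ≤ sinc a := by
    rw [hs]; exact div_nonneg (sin_pos_of_pos_of_lt_pi ha haπ).le ha.le
  set G : ℝ → ℝ := fun x => cos x + 1 / 2 * sinc a * x ^ 2 with hG
  have hGd : ∀ x, HasDerivAt G (sinc a * x - sin x) x := fun x => by
    refine ((hasDerivAt_cos x).add ((hasDerivAt_pow 2 x).const_mul (1 / 2 * sinc a))).congr_deriv ?_
    push_cast; ring
  have hGc : Continuous G := by simp only [hG]; fun_prop
  have hle : ∀ x, 0 < x → x ≤ a → sinc a * x ≤ sin x := fun x h0 h1 => by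
    rw [hs, div_mul_eq_mul_div, div_le_iff₀ ha]
    linarith [mul_sin_le_mul_sin h0 h1 haπ.le]
  have hge : ∀ x, a ≤ x → x ≤ π → sin x ≤ sinc a * x := fun x h0 h1 => by
    rw [hs, div_mul_eq_mul_div, le_div_iff₀ ha]
    linarith [mul_sin_le_mul_sin ha h0 h1]
  have hanti : AntitoneOn G (Set.Icc 0 a) := by
    refine antitoneOn_of_deriv_nonpos (convex_Icc _ _) hGc.continuousOn
      (fun x _ => (hGd x).differentiableAt.differentiableWithinAt) fun x hx => ?_
    rw [interior_Icc] at hx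
    rw [(hGd x).deriv]
    linarith [hle x hx.1 hx.2.le]
  have hmono : MonotoneOn G (Set.Icc a π) := by
    refine monotoneOn_of_deriv_nonneg (convex_Icc _ _) hGc.continuousOn
      (fun x _ => (hGd x).differentiableAt.differentiableWithinAt) fun x hx => ?_
    rw [interior_Icc] at hx
    rw [(hGd x).deriv]
    linarith [hge x hx.1.le hx.2.le]
  -- On `[0, π]` the point `a` is the minimum of `G`. Beyond `π` the quadratic term has grown and
  -- the cosine is at least `cos π`, so `G x ≥ G π`.
  have key : ∀ x, 0 ≤ x → G a ≤ G x := fun x hx => by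
    rcases le_total x a with h1 | h1
    · exact hanti ⟨hx, h1⟩ ⟨ha.le, le_rfl⟩ h1
    rcases le_total x π with h2 | h2
    · exact hmono ⟨le_rfl, haπ.le⟩ ⟨h1, h2⟩ h1
    · refine (hmono ⟨le_rfl, haπ.le⟩ ⟨haπ.le, le_rfl⟩ haπ.le).trans ?_
      simp only [hG, cos_pi]
      have h3 : π ^ 2 ≤ x ^ 2 := pow_le_pow_left₀ pi_pos.le h2 2
      have := mul_le_mul_of_nonneg_left h3 (by positivity : 0 ≤ 1 / 2 * sinc a)
      linarith [neg_one_le_cos x]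
  have := key |x| (abs_nonneg x)
  simpa only [hG, cos_abs, sq_abs] using this

lemma tendsto_div_of_hasDerivAt {f g : ℝ → ℝ} {f' g' a : ℝ} (hf : HasDerivAt f f' a)
    (hg : HasDerivAt g g' a) (hf0 : f a = 0) (hg0 : g a = 0) (hg' : g' ≠ 0) :
    Tendsto (fun s => f s / g s) (𝓝[≠] a) (𝓝 (f' / g')) := by
  refine ((hasDerivAt_iff_tendsto_slope.1 hf).div (hasDerivAt_iff_tendsto_slope.1 hg) hg').congr' ?_
  filter_upwards [self_mem_nhdsWithin] with s hs
  have hs' : s - a ≠ 0 := sub_ne_zero.2 hs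
  rw [Pi.div_apply, slope_def_field, slope_def_field, hf0, hg0, sub_zero, sub_zero,
    div_div_div_cancel_right₀ hs']

/-- A positive arch of the pendulum minimizes the action among the functions with the same boundary
values. -/
lemma pendulum_arch_le {μ : ℝ} (hμ : 0 < μ) {p p' : ℝ → ℝ} (hp : ∀ s, HasDerivAt p (p' s) s)
    (hp' : ∀ s, HasDerivAt p' (-(μ * sin (p s))) s) (hp0 : p 0 = 0) (hpπ : p π = 0)
    (hp0' : p' 0 ≠ 0) (hpπ' : p' π ≠ 0) (hpos : ∀ s ∈ Set.Ioo 0 π, 0 < p s ∧ p s < π)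
    {f f' : ℝ → ℝ} (hf : ∀ s, HasDerivAt f (f' s) s) (hfc : Continuous f') (hf0 : f 0 = 0)
    (hfπ : f π = 0) :
    ∫ s in (0 : ℝ)..π, (1 / 2 * p' s ^ 2 + μ * cos (p s)) ≤
      ∫ s in (0 : ℝ)..π, (1 / 2 * f' s ^ 2 + μ * cos (f s)) := by
  have hpc : Continuous p := continuous_iff_continuousAt.2 fun s => (hp s).continuousAt
  have hpc' : Continuous p' := continuous_iff_continuousAt.2 fun s => (hp' s).continuousAt
  have hfc0 : Continuous f := continuous_iff_continuousAt.2 fun s => (hf s).continuousAt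
  have hsc : Continuous fun s => sinc (p s) := continuous_sinc.comp hpc
  have hπ := pi_pos
  have hsinc : ∀ x, sinc x * x = sin x := fun x => by
    rcases eq_or_ne x 0 with rfl | hx
    · simp
    · rw [sinc_of_ne_zero hx, div_mul_cancel₀ _ hx]
  -- The boundary term of the Picone identity. At the ends `p` vanishes, but so does `f`, and `f /
  -- p` has a finite limit; the expression tends to `0`, which is also its value there.
  have hPc : ContinuousOn (fun s => 1 / 2 * (p' s / p s) * f s ^ 2) (Set.Icc 0 π) := by
    have hend : ∀ a, p a = 0 → p' a ≠ 0 → f a = 0 →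
        ContinuousAt (fun s => 1 / 2 * (p' s / p s) * f s ^ 2) a := fun a h1 h2 h3 => by
      rw [continuousAt_iff_punctured_nhds]
      have h4 := tendsto_div_of_hasDerivAt (hf a) (hp a) h3 h1 h2
      have h5 := ((hpc'.tendsto a).mono_left (nhdsWithin_le_nhds (s := {a}ᶜ))).const_mul (1 / 2)
      have h6 := (hfc0.tendsto a).mono_left (nhdsWithin_le_nhds (s := {a}ᶜ))
      have h7 := (h5.mul h6).mul h4
      simp only [h3, mul_zero, zero_mul] at h7
      simp only [h3]
      refine Tendsto.congr (fun s => ?_) (by simpa using h7)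
      ring
    intro s hs
    rcases eq_or_ne s 0 with rfl | h0
    · exact (hend 0 hp0 hp0' hf0).continuousWithinAt
    rcases eq_or_ne s π with rfl | h1
    · exact (hend _ hpπ hpπ' hfπ).continuousWithinAt
    have hps := (hpos s ⟨lt_of_le_of_ne hs.1 h0.symm, lt_of_le_of_ne hs.2 h1⟩).1
    exact ((continuousAt_const.mul (hpc'.continuousAt.div hpc.continuousAt hps.ne')).mul
      (hfc0.continuousAt.pow 2)).continuousWithinAt
  -- Since `p'' + μ sinc(p) p = 0`, Picone's identity gives `f'² - μ sinc(p) f² = (f' - (p' / p) f)²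
  -- + ((p' / p) f²)'`. The exact derivative contributes nothing, as `f` vanishes at both ends.
  have step1 : ∫ s in (0 : ℝ)..π, 1 / 2 * μ * sinc (p s) * f s ^ 2 ≤
      ∫ s in (0 : ℝ)..π, 1 / 2 * f' s ^ 2 := by
    have h := intervalIntegral.sub_le_integral_of_hasDeriv_right_of_le (a := 0) (b := π)
      (g := fun s => 1 / 2 * (p' s / p s) * f s ^ 2)
      (g' := fun s => 1 / 2 * ((-(μ * sin (p s)) * p s - p' s * p' s) / p s ^ 2) * f s ^ 2 +
        1 / 2 * (p' s / p s) * (2 * f s * f' s))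
      (φ := fun s => 1 / 2 * f' s ^ 2 - 1 / 2 * μ * sinc (p s) * f s ^ 2) hπ.le hPc
      (fun s hs => by
        have hps := (hpos s hs).1.ne'
        refine HasDerivAt.hasDerivWithinAt ?_
        refine (((((hp' s).div (hp s) hps).const_mul (1 / 2)).mul ((hf s).pow 2))).congr_deriv ?_
        simp only [Pi.pow_apply, Pi.div_apply, Nat.cast_ofNat, Nat.reduceSub, pow_one])
      ((Continuous.continuousOn (by fun_prop)).integrableOn_Icc)
      (fun s hs => by
        have hps := (hpos s hs).1.ne'
        rw [sinc_of_ne_zero hps, ← sub_nonneg]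
        have e : 1 / 2 * f' s ^ 2 - 1 / 2 * μ * (sin (p s) / p s) * f s ^ 2 -
          (1 / 2 * ((-(μ * sin (p s)) * p s - p' s * p' s) / p s ^ 2) * f s ^ 2 +
          1 / 2 * (p' s / p s) * (2 * f s * f' s)) =
          1 / 2 * (f' s - p' s / p s * f s) ^ 2 := by
          field_simp
          ring
        rw [e]; positivity)
    simp only [hf0, hfπ] at h
    rw [intervalIntegral.integral_sub (Continuous.intervalIntegrable (by fun_prop) _ _)
      (Continuous.intervalIntegrable (by fun_prop) _ _)] at h
    simp only [ne_eq, OfNat.ofNat_ne_zero, not_false_eq_true, zero_pow, mul_zero, sub_zero] at h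
    linarith
  have step2 : ∫ s in (0 : ℝ)..π, (μ * cos (p s) + 1 / 2 * μ * sinc (p s) * p s ^ 2) ≤
      ∫ s in (0 : ℝ)..π, (μ * cos (f s) + 1 / 2 * μ * sinc (p s) * f s ^ 2) := by
    refine intervalIntegral.integral_mono_on_of_le_Ioo hπ.le
      (Continuous.intervalIntegrable (by fun_prop) _ _)
      (Continuous.intervalIntegrable (by fun_prop) _ _) fun s hs => ?_
    have := mul_le_mul_of_nonneg_left
      (cos_add_half_sinc_le (hpos s hs).1 (hpos s hs).2 (f s)) hμ.le
    linarith
  -- The quadratic form of `step1` vanishes at `p` itself, so the comparison is sharp there.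
  have step3 : ∫ s in (0 : ℝ)..π, (p' s * p' s + p s * -(μ * sin (p s))) = 0 := by
    rw [intervalIntegral.integral_eq_sub_of_hasDerivAt (fun s _ => (hp s).mul (hp' s))
      (Continuous.intervalIntegrable (by fun_prop) _ _)]
    simp [hp0, hpπ]
  have e1 : ∫ s in (0 : ℝ)..π, (1 / 2 * p' s ^ 2 + μ * cos (p s)) =
      (∫ s in (0 : ℝ)..π, (μ * cos (p s) + 1 / 2 * μ * sinc (p s) * p s ^ 2)) +
      1 / 2 * ∫ s in (0 : ℝ)..π, (p' s * p' s + p s * -(μ * sin (p s))) := by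
    rw [← intervalIntegral.integral_const_mul, ← intervalIntegral.integral_add
      (Continuous.intervalIntegrable (by fun_prop) _ _)
      (Continuous.intervalIntegrable (by fun_prop) _ _)]
    congr 1
    funext s
    rw [← hsinc]; ring
  have e2 : ∫ s in (0 : ℝ)..π, (1 / 2 * f' s ^ 2 + μ * cos (f s)) =
      (∫ s in (0 : ℝ)..π, (μ * cos (f s) + 1 / 2 * μ * sinc (p s) * f s ^ 2)) +
      ((∫ s in (0 : ℝ)..π, 1 / 2 * f' s ^ 2) -
        ∫ s in (0 : ℝ)..π, 1 / 2 * μ * sinc (p s) * f s ^ 2) := by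
    rw [← intervalIntegral.integral_sub (Continuous.intervalIntegrable (by fun_prop) _ _)
      (Continuous.intervalIntegrable (by fun_prop) _ _), ← intervalIntegral.integral_add
      (Continuous.intervalIntegrable (by fun_prop) _ _)
      (Continuous.intervalIntegrable (by fun_prop) _ _)]
    congr 1
    funext s
    ring
  rw [e1, e2, step3]
  linarith

/-! ### Half periods of Bernoulli's elastica -/

section
variable {k : ℝ}

lemma periodic_elasticaDelta_pi (k : ℝ) : Function.Periodic (elasticaDelta k) π := fun u => by
  simp only [elasticaDelta, sin_add_pi, neg_sq]

lemma elasticaArclength_add_pi (hk : k ∈ Set.Ioo (0 : ℝ) 1) (t : ℝ) :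
    elasticaArclength k (t + π) = elasticaArclength k t + π := by
  have hc := (contDiff_inv_elasticaDelta hk).continuous
  have hp : Function.Periodic (fun u => (elasticaDelta k u)⁻¹) π := fun u => by
    simp only [periodic_elasticaDelta_pi k u]
  have h : ∀ t, elasticaArclength k (t + π) = elasticaArclength k t + elasticaArclength k π :=
    fun t => by
      unfold elasticaArclength
      rw [← intervalIntegral.integral_add_adjacent_intervals (hc.intervalIntegrable 0 t)
        (hc.intervalIntegrable _ _), hp.intervalIntegral_add_eq t 0, zero_add, mul_add]
  have h1 := (isReparametrization_elasticaArclength hk).add_period 0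
  rw [elasticaArclength_zero, zero_add, two_mul, h π] at h1
  rw [h]
  linarith

lemma elasticaAmplitude_add_pi (hk : k ∈ Set.Ioo (0 : ℝ) 1) (s : ℝ) :
    elasticaAmplitude k (s + π) = elasticaAmplitude k s + π := by
  obtain ⟨-, h1, h2⟩ := elasticaAmplitude_spec hk
  apply (isReparametrization_elasticaArclength hk).strictMono.injective
  rw [elasticaArclength_add_pi hk, h2, h2]

lemma elasticaAngle_add_pi (hk : k ∈ Set.Ioo (0 : ℝ) 1) (s : ℝ) :
    elasticaAngle k (s + π) = -elasticaAngle k s := by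
  rw [elasticaAngle, elasticaAngle, elasticaAmplitude_add_pi hk, sin_add_pi, mul_neg, arcsin_neg]
  ring

lemma elasticaCurvature_add_pi (hk : k ∈ Set.Ioo (0 : ℝ) 1) (s : ℝ) :
    elasticaCurvature k (s + π) = -elasticaCurvature k s := by
  rw [elasticaCurvature, elasticaCurvature, elasticaAmplitude_add_pi hk, cos_add_pi]
  ring

lemma neg_elasticaAngle_mem (hk : k ∈ Set.Ioo (0 : ℝ) 1) {s : ℝ} (hs : s ∈ Set.Ioo 0 π) :
    0 < -elasticaAngle k s ∧ -elasticaAngle k s < π := by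
  have hmono := (elasticaAmplitude_spec hk).1.strictMono
  have h0 := elasticaAmplitude_zero hk
  have hπ : elasticaAmplitude k π = π := by
    have := elasticaAmplitude_add_pi hk 0
    rwa [zero_add, h0, zero_add] at this
  have h1 := hmono hs.1
  have h2 := hmono hs.2
  rw [h0] at h1
  rw [hπ] at h2
  have h3 := sin_pos_of_pos_of_lt_pi h1 h2
  have h4 := abs_lt.1 (abs_mul_sin_lt_one hk (elasticaAmplitude k s))
  rw [elasticaAngle, neg_neg]
  constructor
  · have := arcsin_pos.2 (mul_pos hk.1 h3)
    linarith
  · have := arcsin_lt_pi_div_two.2 h4.2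
    linarith

end

lemma continuous_elasticaCurvature {k : ℝ} (hk : k ∈ Set.Ioo (0 : ℝ) 1) :
    Continuous (elasticaCurvature k) :=
  continuous_iff_continuousAt.2 fun s => (hasDerivAt_elasticaCurvature hk s).continuousAt

/-- Bernoulli's elastica has the least energy among the closed curves of rotation number zero. -/
lemma IsClosedAngle.bernoulli_le {θ : ℝ → ℝ} (h : IsClosedAngle θ 0) :
    ∫ s in (0 : ℝ)..(2 * π), elasticaCurvature bernoulliModulus s ^ 2 ≤
      ∫ s in (0 : ℝ)..(2 * π), deriv θ s ^ 2 := by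
  obtain ⟨hk, hgap⟩ := bernoulliModulus_spec
  set k := bernoulliModulus
  set μ := (elasticaScale k ^ 2)⁻¹ with hμdef
  have hsc := elasticaScale_pos hk
  have hμ : 0 < μ := by positivity
  have hθ := h.contDiff.continuous
  have hθ' := h.continuous_deriv
  have hKc := continuous_elasticaCurvature hk
  have hAc := (contDiff_elasticaAngle hk).continuous
  have hper : ∀ s, θ (s + 2 * π) = θ s := fun s => by
    have := h.add_period s
    simpa using this
  -- For rotation number zero, `θ (s + π) - θ s` changes sign when `s` increases by `π`, hence it
  -- has a zero.
  obtain ⟨s₀, hs₀⟩ : ∃ s₀, θ (s₀ + π) - θ s₀ = 0 := by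
    have hc : Continuous fun s => θ (s + π) - θ s := by fun_prop
    have hπ : θ (π + π) - θ π = -(θ (0 + π) - θ 0) := by
      have := hper 0
      rw [zero_add, two_mul] at this
      rw [this, zero_add]; ring
    have hmem : (0 : ℝ) ∈ Set.uIcc (θ (0 + π) - θ 0) (θ (π + π) - θ π) := by
      rw [hπ, Set.mem_uIcc]
      rcases le_total (θ (0 + π) - θ 0) 0 with h1 | h1
      · left; constructor <;> linarith
      · right; constructor <;> linarith
    obtain ⟨s, -, hs⟩ := intermediate_value_uIcc
      (hc.continuousOn (s := Set.uIcc 0 π)) hmem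
    exact ⟨s, hs⟩
  have hα0 : elasticaAngle k 0 = 0 := by
    rw [elasticaAngle, elasticaAmplitude_zero hk]; simp
  have hαπ : elasticaAngle k π = 0 := by
    have := elasticaAngle_add_pi hk 0
    rwa [zero_add, hα0, neg_zero] at this
  have hκ0 : elasticaCurvature k 0 ≠ 0 := by
    rw [elasticaCurvature, elasticaAmplitude_zero hk, cos_zero]
    have := hk.1
    exact neg_ne_zero.2 (by positivity)
  have hκπ : elasticaCurvature k π ≠ 0 := by
    have := elasticaCurvature_add_pi hk 0
    rw [zero_add] at this
    rw [this]; exact neg_ne_zero.2 hκ0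
  -- Each half of `θ - θ s₀` vanishes at both ends and competes with the positive arch `-α`, where
  -- `α` is the elastica angle. The other half of the elastica has the same action, because `α`
  -- changes sign after time `π`.
  have harch : ∀ a, θ a = θ s₀ → θ (a + π) = θ s₀ →
      ∫ s in (0 : ℝ)..π, (1 / 2 * elasticaCurvature k s ^ 2 + μ * cos (elasticaAngle k s)) ≤
      ∫ s in (0 : ℝ)..π, (1 / 2 * deriv θ (s + a) ^ 2 + μ * cos (θ (s + a) - θ s₀)) :=
    fun a h1 h2 => by
      have := pendulum_arch_le hμ (p := fun s => -elasticaAngle k s)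
        (p' := fun s => -elasticaCurvature k s) (fun s => (hasDerivAt_elasticaAngle hk s).neg)
        (fun s => by
          rw [sin_neg, mul_neg]
          exact (hasDerivAt_elasticaCurvature hk s).neg)
        (by simp [hα0]) (by simp [hαπ]) (neg_ne_zero.2 hκ0) (neg_ne_zero.2 hκπ)
        (fun s hs => neg_elasticaAngle_mem hk hs) (f := fun s => θ (s + a) - θ s₀)
        (f' := fun s => deriv θ (s + a))
        (fun s => ((h.hasDerivAt (s + a)).comp_add_const s a).sub_const _) (by fun_prop)
        (by simp [h1]) (by rw [add_comm π, h2, sub_self])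
      simpa only [neg_sq, cos_neg] using this
  have i1 := harch s₀ rfl (by linarith)
  have i2 := harch (s₀ + π) (by linarith) (by rw [add_assoc, ← two_mul, hper])
  have split : ∀ f : ℝ → ℝ, Continuous f → ∀ a, (∫ s in (0 : ℝ)..π, f (s + a)) +
      (∫ s in (0 : ℝ)..π, f (s + (a + π))) = ∫ s in (0 : ℝ)..(2 * π), f (s + a) := fun f hf a => by
    have e : ∀ s, s + (a + π) = s + π + a := fun s => by ring
    simp only [e]
    have hfa : Continuous fun s => f (s + a) := by fun_prop
    rw [intervalIntegral.integral_comp_add_right (fun s => f (s + a)) π, zero_add, ← two_mul,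
      intervalIntegral.integral_add_adjacent_intervals (hfa.intervalIntegrable _ _)
      (hfa.intervalIntegrable _ _)]
  have j1 := split (fun s => 1 / 2 * deriv θ s ^ 2 + μ * cos (θ s - θ s₀)) (by fun_prop) s₀
  rw [integral_shift_of_periodic (f := fun s => 1 / 2 * deriv θ s ^ 2 + μ * cos (θ s - θ s₀))
    (fun s => by simp only [hper s, h.periodic_deriv s])] at j1
  -- Closure removes the potential term, whatever the constant `θ s₀` is.
  have j4 : ∫ s in (0 : ℝ)..(2 * π), (1 / 2 * deriv θ s ^ 2 + μ * cos (θ s - θ s₀)) =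
      1 / 2 * ∫ s in (0 : ℝ)..(2 * π), deriv θ s ^ 2 := by
    rw [intervalIntegral.integral_add (Continuous.intervalIntegrable (by fun_prop) _ _)
      (Continuous.intervalIntegrable (by fun_prop) _ _), intervalIntegral.integral_const_mul,
      intervalIntegral.integral_const_mul, h.integral_cos_sub, mul_zero, add_zero]
  rw [j4] at j1
  have j2 := split (fun s => 1 / 2 * elasticaCurvature k s ^ 2 + μ * cos (elasticaAngle k s))
    (by fun_prop) 0
  simp only [zero_add, add_zero, elasticaCurvature_add_pi hk, elasticaAngle_add_pi hk, neg_sq,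
    cos_neg] at j2
  have hcos0 : ∫ s in (0 : ℝ)..(2 * π), cos (elasticaAngle k s) = 0 := by
    have := (isClosedAngle_bernoulliAngle le_rfl).integral_cos
    simpa [bernoulliAngle] using this
  have j3 : ∫ s in (0 : ℝ)..(2 * π), (1 / 2 * elasticaCurvature k s ^ 2 +
      μ * cos (elasticaAngle k s)) =
      1 / 2 * ∫ s in (0 : ℝ)..(2 * π), elasticaCurvature k s ^ 2 := by
    rw [intervalIntegral.integral_add (Continuous.intervalIntegrable (by fun_prop) _ _)
    (Continuous.intervalIntegrable (by fun_prop) _ _), intervalIntegral.integral_const_mul,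
    intervalIntegral.integral_const_mul, hcos0, mul_zero, add_zero]
  rw [j3] at j2
  linarith

theorem bernoulli_stable {γ : ℝ → ℂ} (h : SameShape γ (bernoulliTimes 1)) :
    γ ∈ Curves ∧ IsLocalMinimum γ := by
  obtain ⟨z₀, hb⟩ := hasAngle_bernoulliTimes le_rfl
  have hd : ∀ s, HasDerivAt (bernoulliAngle 1) (elasticaCurvature bernoulliModulus s) s := fun s => by
    simpa using hasDerivAt_bernoulliAngle 1 s
  obtain ⟨z, c, σ, h1 | h1⟩ := h.hasAngle hb
  · refine ⟨h1.mem_curves, h1.isLocalMinimum fun θ' hθ' => ?_⟩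
    simp only [((hd _).add_const c).deriv]
    exact hθ'.bernoulli_le
  · rw [neg_zero] at h1
    refine ⟨h1.mem_curves, h1.isLocalMinimum fun θ' hθ' => ?_⟩
    simp only [((hd _).const_sub c).deriv, neg_sq]
    exact hθ'.bernoulli_le

/-! ### The second variation -/

/-- Second-order Taylor expansion with a generous cubic remainder: the bounds for `cos u` and `sin
u` contribute at most `5/96 + 1/6 + 1/100 < 1`. -/
lemma cos_add_taylor_le {a u : ℝ} (hu : |u| ≤ 1) :
    cos (a + u) - cos a + sin a * u ≤ -(1 / 2 * cos a * u ^ 2) + |u| ^ 3 := by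
  have h1 := cos_bound hu
  have h2 := sin_bound hu
  have h0 := abs_nonneg u
  have h4 : |u| ^ 4 ≤ |u| ^ 3 := pow_le_pow_of_le_one h0 hu (by norm_num)
  have h5' : |u| ^ 5 ≤ |u| ^ 3 := pow_le_pow_of_le_one h0 hu (by norm_num)
  have h3 : |u ^ 3| = |u| ^ 3 := abs_pow u 3
  have h5 : |sin u - u| ≤ |u| ^ 3 / 6 + |u| ^ 3 / 100 := by
    have : sin u - u = (sin u - (u - u ^ 3 / 6)) + -(u ^ 3 / 6) := by ring
    rw [this]
    refine (abs_add_le _ _).trans ?_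
    rw [abs_neg, abs_div, h3, abs_of_pos (by norm_num : (0 : ℝ) < 6)]
    linarith
  have e : cos (a + u) - cos a + sin a * u + 1 / 2 * cos a * u ^ 2 =
      cos a * (cos u - (1 - u ^ 2 / 2)) + -(sin a * (sin u - u)) := by
    rw [cos_add]; ring
  have h6 : cos a * (cos u - (1 - u ^ 2 / 2)) ≤ |u| ^ 4 * (5 / 96) := by
    refine (le_abs_self _).trans ?_
    rw [abs_mul]
    nlinarith [abs_cos_le_one a, abs_nonneg (cos a), abs_nonneg (cos u - (1 - u ^ 2 / 2))]
  have h7 : -(sin a * (sin u - u)) ≤ |u| ^ 3 / 6 + |u| ^ 3 / 100 := by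
    refine (neg_le_abs _).trans ?_
    rw [abs_mul]
    nlinarith [abs_sin_le_one a, abs_nonneg (sin a), abs_nonneg (sin u - u)]
  have h8 : 0 ≤ |u| ^ 3 := by positivity
  linarith

lemma IsVariation.eventually_close {γ : ℝ → ℂ} {Γ : ℝ → ℝ → ℂ} {V : ℝ → ℂ}
    (h : IsVariation γ Γ V) {ε : ℝ} (hε : 0 < ε) : ∀ᶠ x in 𝓝 (0 : ℝ), ∀ i : ℕ, i ≤ 2 → ∀ t,
      ‖iteratedDeriv i (Γ x) t - iteratedDeriv i γ t‖ < ε := by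
  have key : ∀ i : ℕ, i ≤ 2 → ∀ᶠ x in 𝓝 (0 : ℝ), ∀ t,
      ‖iteratedDeriv i (Γ x) t - iteratedDeriv i γ t‖ < ε := fun i hi => by
    have hper : Function.Periodic (iteratedDeriv i V) (2 * π) := by
      rw [iteratedDeriv_eq_iterate]
      exact Nat.rec h.periodic (fun n ih => by
        rw [Function.iterate_succ_apply']; exact periodic_deriv ih) i
    have hcont : Continuous (iteratedDeriv i V) :=
      h.contDiff.continuous_iteratedDeriv i (by exact_mod_cast hi)
    obtain ⟨C, hC0, hC⟩ := exists_bound_of_periodic hper hcont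
    have hsmall : ∀ᶠ x in 𝓝 (0 : ℝ), |x| < ε / (C + 1) := by
      filter_upwards [Metric.ball_mem_nhds (0 : ℝ) (show 0 < ε / (C + 1) by positivity)] with x hx
      simpa using hx
    filter_upwards [h.differentiable i hi 1 one_pos, hsmall] with x hx hxs t
    have h1 := hx t
    have h2 : ‖x • iteratedDeriv i V t‖ ≤ |x| * C := by
      rw [norm_smul, Real.norm_eq_abs]; exact mul_le_mul_of_nonneg_left (hC t) (abs_nonneg x)
    have h3 := norm_add_le (iteratedDeriv i (Γ x) t - iteratedDeriv i γ t - x • iteratedDeriv i V t)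
      (x • iteratedDeriv i V t)
    rw [sub_add_cancel] at h3
    rw [lt_div_iff₀ (by positivity)] at hxs
    linarith
  filter_upwards [key 0 (by norm_num), key 1 (by norm_num), key 2 le_rfl] with x h0 h1 h2 i hi
  rcases (by omega : i = 0 ∨ i = 1 ∨ i = 2) with rfl | rfl | rfl
  exacts [h0, h1, h2]

/-- The energy of a corrected variation is controlled by the second variation. -/
lemma energy_correctedVariation_le {θ ψ : ℝ → ℝ} {m : ℤ} (h : IsClosedAngle θ m) {μ c : ℝ}
    (hμ : 0 ≤ μ) (hd : ∀ s, HasDerivAt (deriv θ) (-(μ * sin (θ s - c))) s)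
    (hψ : ContDiff ℝ 1 ψ) (hp : Function.Periodic ψ (2 * π)) {w : ℝ → ℂ} {x δ : ℝ}
    (hcl : IsClosedAngle (fun s => θ s + correctedVariation θ ψ w x s) m) (hδ1 : δ ≤ 1)
    (hδ : ∀ s, |correctedVariation θ ψ w x s| ≤ δ) :
    (2 * ∫ s in (0 : ℝ)..(2 * π), deriv θ s * correctedVariationDeriv θ ψ w x s) +
      (∫ s in (0 : ℝ)..(2 * π), correctedVariationDeriv θ ψ w x s ^ 2) ≤
      (∫ s in (0 : ℝ)..(2 * π), (correctedVariationDeriv θ ψ w x s ^ 2 -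
        μ * cos (θ s - c) * correctedVariation θ ψ w x s ^ 2)) + 4 * π * μ * δ ^ 3 := by
  have hθ := h.contDiff.continuous
  have hθ' := h.continuous_deriv
  set u := correctedVariation θ ψ w x with hu
  set u' := correctedVariationDeriv θ ψ w x with hu'
  have hud : ∀ s, HasDerivAt u (u' s) s := hasDerivAt_correctedVariation h.contDiff hψ w x
  have huc : Continuous u := continuous_iff_continuousAt.2 fun s => (hud s).continuousAt
  have huc' : Continuous u' := continuous_correctedVariationDeriv h.contDiff hψ w x
  have hup : Function.Periodic u (2 * π) := fun s => by
    simp only [hu, correctedVariation, hp s, periodic_tangentComponent h (w x) s]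
  -- Integration by parts using the pendulum equation: `∫ θ' u' = μ ∫ sin (θ - c) u`.
  have e1 : ∫ s in (0 : ℝ)..(2 * π), (-(μ * sin (θ s - c)) * u s + deriv θ s * u' s) = 0 :=
    integral_eq_zero_of_periodic (fun s => (hd s).mul (hud s)) (by fun_prop) fun s => by
      simp only [Pi.mul_apply, h.periodic_deriv s, hup s]
  have e2 := h.integral_cos_sub c
  have e3 := hcl.integral_cos_sub c
  -- Both angles are closed, so `∫ (cos (θ + u - c) - cos (θ - c)) = 0` can be added with weight
  -- `2μ`. The integrand then has no first-order term in `u`.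
  have e4 : (2 * ∫ s in (0 : ℝ)..(2 * π), deriv θ s * u' s) +
      (∫ s in (0 : ℝ)..(2 * π), u' s ^ 2) =
      ∫ s in (0 : ℝ)..(2 * π), (u' s ^ 2 + 2 * μ * (cos (θ s - c + u s) - cos (θ s - c) +
        sin (θ s - c) * u s)) := by
    have hsplit : ∀ s, u' s ^ 2 + 2 * μ * (cos (θ s - c + u s) - cos (θ s - c) +
        sin (θ s - c) * u s) = (2 * (deriv θ s * u' s) + u' s ^ 2) +
        (2 * μ * (cos (θ s + u s - c) - cos (θ s - c)) -
        2 * (-(μ * sin (θ s - c)) * u s + deriv θ s * u' s)) := fun s => by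
      rw [show θ s - c + u s = θ s + u s - c by ring]; ring
    simp only [hsplit]
    rw [intervalIntegral.integral_add (Continuous.intervalIntegrable (by fun_prop) _ _)
      (Continuous.intervalIntegrable (by fun_prop) _ _), intervalIntegral.integral_add
      (Continuous.intervalIntegrable (by fun_prop) _ _)
      (Continuous.intervalIntegrable (by fun_prop) _ _), intervalIntegral.integral_sub
      (Continuous.intervalIntegrable (by fun_prop) _ _)
      (Continuous.intervalIntegrable (by fun_prop) _ _), intervalIntegral.integral_const_mul,
      intervalIntegral.integral_const_mul, intervalIntegral.integral_const_mul, e1,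
      intervalIntegral.integral_sub (Continuous.intervalIntegrable (by fun_prop) _ _)
      (Continuous.intervalIntegrable (by fun_prop) _ _), e2, e3]
    ring
  have e5 : ∫ s in (0 : ℝ)..(2 * π), (2 * μ * δ ^ 3) = 4 * π * μ * δ ^ 3 := by
    rw [intervalIntegral.integral_const, sub_zero, smul_eq_mul]; ring
  rw [e4, ← e5, ← intervalIntegral.integral_add
    (Continuous.intervalIntegrable (by fun_prop) _ _)
    (Continuous.intervalIntegrable (by fun_prop) _ _)]
  refine intervalIntegral.integral_mono_on (by positivity)
    (Continuous.intervalIntegrable (by fun_prop) _ _)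
    (Continuous.intervalIntegrable (by fun_prop) _ _) fun s _ => ?_
  have h1 := cos_add_taylor_le (a := θ s - c) ((hδ s).trans hδ1)
  have h2 : |u s| ^ 3 ≤ δ ^ 3 := pow_le_pow_left₀ (abs_nonneg _) (hδ s) 3
  have h3 := mul_le_mul_of_nonneg_left (h1.trans (add_le_add_right h2 _))
    (by positivity : 0 ≤ 2 * μ)
  linarith

/-- The energy increment along the corrected variation is at most `x² Q(w x / x) + O(x³)`, where `Q
v` is the second variation at `ψ` plus the tangent component of `v`. Since `w x / x → 0` and `Q` is
continuous, the sign is that of `Q 0`; no second derivative of `w` is needed. -/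
lemma HasAngle.not_isLocalMinimum {γ : ℝ → ℂ} {z : ℂ} {θ : ℝ → ℝ} {m : ℤ} {σ : ℝ → ℝ}
    (h : HasAngle γ z θ m σ) {μ c : ℝ} (hμ : 0 ≤ μ)
    (hd : ∀ s, HasDerivAt (deriv θ) (-(μ * sin (θ s - c))) s) {ψ : ℝ → ℝ} (hψ : ContDiff ℝ 1 ψ)
    (hp : Function.Periodic ψ (2 * π)) (h0 : endpointVariation θ ψ = 0)
    (hQ : ∫ s in (0 : ℝ)..(2 * π), (deriv ψ s ^ 2 - μ * cos (θ s - c) * ψ s ^ 2) < 0) :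
    ¬ IsLocalMinimum γ := by
  rintro ⟨ε, hε, hmin⟩
  obtain ⟨Γ, V, w, hΓ, hw0, hw, hang⟩ := h.exists_variation hψ hp h0
  have hθ := h.angle.contDiff.continuous
  have hθ' := h.angle.continuous_deriv
  have hψ' := hψ.continuous_deriv (by norm_num)
  have hψc := hψ.continuous
  obtain ⟨A, hA0, hA⟩ := exists_bound_of_periodic hp hψc
  simp only [Real.norm_eq_abs] at hA
  let Q : ℂ → ℝ := fun v => ∫ s in (0 : ℝ)..(2 * π),
    ((deriv ψ s + deriv θ s * (v.im * cos (θ s) - v.re * sin (θ s))) ^ 2 -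
      μ * cos (θ s - c) * (ψ s + tangentComponent θ v s) ^ 2)
  have hQc : Continuous Q := by
    apply intervalIntegral.continuous_parametric_intervalIntegral_of_continuous'
      (μ := MeasureTheory.volume)
    simp only [Function.uncurry_def, tangentComponent]
    fun_prop
  have hQ0 : Q 0 < 0 := by simpa [Q] using hQ
  set v : ℝ → ℂ := fun x => x⁻¹ • w x with hv
  have hvt : Tendsto v (𝓝[>] 0) (𝓝 0) := by
    have h1 := hasDerivAt_iff_tendsto_slope.1 hw
    have h2 := h1.mono_left (nhdsWithin_mono 0 (fun x (hx : x ∈ Set.Ioi (0 : ℝ)) => hx.ne'))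
    refine h2.congr fun x => ?_
    simp [slope, hw0, hv]
  have hlim : Tendsto (fun x => Q (v x) + 4 * π * μ * (A + 2) ^ 3 * x) (𝓝[>] 0) (𝓝 (Q 0)) := by
    have h1 := (hQc.tendsto 0).comp hvt
    have h2 : Tendsto (fun x : ℝ => 4 * π * μ * (A + 2) ^ 3 * x) (𝓝[>] 0) (𝓝 0) := by
      have : Continuous fun x : ℝ => 4 * π * μ * (A + 2) ^ 3 * x := by fun_prop
      have h3 := (this.tendsto 0).mono_left (nhdsWithin_le_nhds (s := Set.Ioi 0))
      rwa [mul_zero] at h3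
    simpa using h1.add h2
  have hneg := hlim.eventually (gt_mem_nhds hQ0)
  have hsmall : ∀ᶠ x in 𝓝 (0 : ℝ), (A + 2) * |x| ≤ 1 := by
    have : Continuous fun x : ℝ => (A + 2) * |x| := by fun_prop
    have h3 := this.tendsto 0
    rw [abs_zero, mul_zero] at h3
    exact (h3.eventually (gt_mem_nhds one_pos)).mono fun x hx => hx.le
  have hall := (((hang.and (hΓ.eventually_close hε)).and (hsmall.and
    (eventually_norm_le_of_hasDerivAt_zero hw0 hw one_pos))).filter_mono
    (nhdsWithin_le_nhds (s := Set.Ioi 0))).and (hneg.and self_mem_nhdsWithin)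
  obtain ⟨x, ⟨⟨hxa, hxc⟩, hxs, hxw⟩, hxneg, hx0⟩ := hall.exists
  have hx0' : (0 : ℝ) < x := hx0
  have hU := hmin (Γ x) hxa.mem_curves hxc
  rw [hxa.U_correctedVariation h.angle.contDiff hψ, h.U_eq] at hU
  rw [abs_of_pos hx0'] at hxs hxw
  have hb : ∀ s, |correctedVariation θ ψ w x s| ≤ (A + 2) * x := fun s => by
    rw [correctedVariation]
    refine (abs_add_le _ _).trans ?_
    rw [abs_mul, abs_of_pos hx0']
    have h1 := abs_tangentComponent_le θ (w x) s
    have h2 := mul_le_mul_of_nonneg_left (hA s) hx0'.le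
    linarith
  have hE := energy_correctedVariation_le h.angle hμ hd hψ hp hxa.angle hxs hb
  have hwv : w x = x • v x := by rw [hv]; simp only; rw [smul_inv_smul₀ hx0'.ne']
  have hscale : ∫ s in (0 : ℝ)..(2 * π), (correctedVariationDeriv θ ψ w x s ^ 2 -
        μ * cos (θ s - c) * correctedVariation θ ψ w x s ^ 2) = x ^ 2 * Q (v x) := by
    simp only [Q]
    rw [← intervalIntegral.integral_const_mul]
    congr 1
    funext s
    simp only [correctedVariation, correctedVariationDeriv, tangentComponent, hwv,
      Complex.smul_re, Complex.smul_im, smul_eq_mul]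
    ring
  rw [hscale] at hE
  have : 0 ≤ x ^ 2 * (Q (v x) + 4 * π * μ * (A + 2) ^ 3 * x) := by
    have e : x ^ 2 * (Q (v x) + 4 * π * μ * (A + 2) ^ 3 * x) =
      x ^ 2 * Q (v x) + 4 * π * μ * ((A + 2) * x) ^ 3 := by ring
    rw [e]; linarith
  have := mul_neg_of_pos_of_neg (pow_pos hx0' 2) hxneg
  linarith

/-! ### Instability of the multiple covers of Bernoulli's elastica -/

lemma integral_eq_symm_of_periodic {f : ℝ → ℝ} (hp : Function.Periodic f (2 * π)) (a : ℝ) :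
    ∫ s in (0 : ℝ)..(2 * π), f s = ∫ y in (-π)..π, f (a + y) := by
  rw [intervalIntegral.integral_comp_add_left]
  have := hp.intervalIntegral_add_eq 0 (a + -π)
  rw [zero_add] at this
  rw [this]
  congr 1
  ring

/-- A quadratic form whose leading part vanishes at a point where its linear part does not
takes negative values on concentrated functions. -/
lemma exists_concentrated {ω M : ℝ → ℝ} {s₁ C K : ℝ} (hω : Continuous ω) (hM : Continuous M)
    (hωp : Function.Periodic ω (2 * π)) (hMp : Function.Periodic M (2 * π))
    (hωC : ∀ y, |ω (s₁ + y)| ≤ C * |y|) (hM₁ : M s₁ ≠ 0) (hK : 0 ≤ K) :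
    ∃ b : ℝ → ℝ, Continuous b ∧ Function.Periodic b (2 * π) ∧ ∃ δ : ℝ,
      4 * (∫ s in (0 : ℝ)..(2 * π), ω s ^ 2 * b s ^ 2) +
        2 * δ * (∫ s in (0 : ℝ)..(2 * π), b s * M s) + δ ^ 2 * K < 0 := by
  have hπ := pi_pos
  have hM2 : 0 < M s₁ ^ 2 := by positivity
  obtain ⟨ρ, hρ0, hρ⟩ : ∃ ρ > 0, ∀ y, |y| < ρ → M s₁ ^ 2 / 2 ≤ M (s₁ + y) * M s₁ := by
    have hc : Continuous fun y => M (s₁ + y) * M s₁ := by fun_prop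
    have h1 := (hc.tendsto 0).eventually (lt_mem_nhds (a := M s₁ ^ 2 / 2) (by
      rw [add_zero, ← pow_two]; linarith))
    obtain ⟨ρ, hρ0, hρ⟩ := Metric.eventually_nhds_iff.1 h1
    exact ⟨ρ, hρ0, fun y hy => (hρ (by simpa using hy)).le⟩
  -- Chosen so that `r K ≤ 1/2`: the term `δ² K` then uses at most half of the gain from the linear
  -- term.
  set r := 1 / (2 * (K + 1)) with hr
  have hr0 : 0 < r := by positivity
  have hrK : r ^ 2 * K ≤ r / 2 := by
    rw [hr]
    field_simp
    nlinarith
  -- The width of the bump. The third condition keeps the support where `M` stays close to `M s₁`;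
  -- the last makes the leading term `O(t⁴ β)` smaller than the gain, which is at least of order `t³
  -- β`.
  obtain ⟨t, ht0, ht1, htρ, htC⟩ : ∃ t : ℝ, 0 < t ∧ t < 1 ∧ 5 * t ^ 2 < ρ ^ 2 ∧
      80 * C ^ 2 * t < r * M s₁ ^ 2 := by
    have h1 : ∀ᶠ t : ℝ in 𝓝 0, t < 1 ∧ 5 * t ^ 2 < ρ ^ 2 ∧ 80 * C ^ 2 * t < r * M s₁ ^ 2 := by
      refine (gt_mem_nhds one_pos).and (Eventually.and ?_ ?_)
      · have : Continuous fun t : ℝ => 5 * t ^ 2 := by fun_prop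
        exact (this.tendsto 0).eventually (gt_mem_nhds (by simpa using pow_pos hρ0 2))
      · have : Continuous fun t : ℝ => 80 * C ^ 2 * t := by fun_prop
        exact (this.tendsto 0).eventually (gt_mem_nhds (by rw [mul_zero]; positivity))
    have h2 := (h1.filter_mono (nhdsWithin_le_nhds (s := Set.Ioi 0))).and self_mem_nhdsWithin
    obtain ⟨t, ⟨h3, h4, h5⟩, h6⟩ := h2.exists
    exact ⟨t, h6, h3, h4, h5⟩
  -- A continuous bump of height at most `t²` and width of order `t`; built from the cosine, it is
  -- automatically `2π`-periodic.
  set B : ℝ → ℝ := fun y => max 0 (cos y - (1 - t ^ 2)) with hB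
  have hBc : Continuous B := by simp only [hB]; fun_prop
  have hB0 : ∀ y, 0 ≤ B y := fun y => le_max_left _ _
  have hBle : ∀ y, B y ≤ t ^ 2 := fun y => max_le (by positivity) (by linarith [cos_le_one y])
  -- From `cos y ≤ 1 - 2 y² / π²` on `[-π, π]`, together with `π² ≤ 10`.
  have hBsupp : ∀ y, |y| ≤ π → B y ≠ 0 → y ^ 2 ≤ 5 * t ^ 2 := fun y hy hne => by
    have h1 : 1 - t ^ 2 < cos y := by
      by_contra! h; exact hne (max_eq_left (by linarith))
    have h2 := cos_le_one_sub_mul_cos_sq hy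
    have h3 : 2 / π ^ 2 * y ^ 2 < t ^ 2 := by linarith
    rw [div_mul_eq_mul_div, div_lt_iff₀ (by positivity)] at h3
    have h4 : π ^ 2 ≤ 10 := by nlinarith [pi_lt_d2]
    nlinarith [sq_nonneg t]
  set β := ∫ y in (-π)..π, B y with hβ
  have hβlow : t ^ 3 / 2 ≤ β := by
    have h1 : ∫ y in (0 : ℝ)..t, B y ≤ β :=
      intervalIntegral.integral_mono_interval (by linarith) ht0.le (by linarith [pi_gt_three])
        (Eventually.of_forall hB0) (hBc.intervalIntegrable _ _)
    have h2 : ∫ y in (0 : ℝ)..t, t ^ 2 / 2 ≤ ∫ y in (0 : ℝ)..t, B y := by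
      refine intervalIntegral.integral_mono_on ht0.le (by simp) (hBc.intervalIntegrable _ _)
        fun y hy => le_max_of_le_right ?_
      have h3 := one_sub_sq_div_two_le_cos (x := y)
      have h4 : y ^ 2 ≤ t ^ 2 := pow_le_pow_left₀ hy.1 hy.2 2
      linarith
    rw [intervalIntegral.integral_const, smul_eq_mul, sub_zero] at h2
    nlinarith
  have hβ0 : 0 < β := lt_of_lt_of_le (by positivity) hβlow
  have hBp : Function.Periodic (fun s => B (s - s₁)) (2 * π) := fun s => by
    simp only [hB]
    rw [show s + 2 * π - s₁ = s - s₁ + 2 * π by ring, cos_add_two_pi]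
  have i1 : ∫ s in (0 : ℝ)..(2 * π), ω s ^ 2 * B (s - s₁) ^ 2 ≤ 5 * C ^ 2 * t ^ 4 * β := by
    rw [integral_eq_symm_of_periodic (f := fun s => ω s ^ 2 * B (s - s₁) ^ 2)
      (fun s => by have := hBp s; simp only at this; simp only [hωp s, this]) s₁, hβ,
      ← intervalIntegral.integral_const_mul]
    refine intervalIntegral.integral_mono_on (by linarith)
      (Continuous.intervalIntegrable (by fun_prop) _ _)
      (Continuous.intervalIntegrable (by fun_prop) _ _) fun y hy => ?_
    rw [add_sub_cancel_left]
    rcases eq_or_ne (B y) 0 with h0 | h0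
    · simp [h0]
    have h1 := hBsupp y (abs_le.2 hy) h0
    have h2 : ω (s₁ + y) ^ 2 ≤ C ^ 2 * (5 * t ^ 2) := by
      calc ω (s₁ + y) ^ 2 = |ω (s₁ + y)| ^ 2 := (sq_abs _).symm
        _ ≤ (C * |y|) ^ 2 := pow_le_pow_left₀ (abs_nonneg _) (hωC y) 2
        _ = C ^ 2 * y ^ 2 := by rw [mul_pow, sq_abs]
        _ ≤ _ := by gcongr
    calc ω (s₁ + y) ^ 2 * B y ^ 2 ≤ C ^ 2 * (5 * t ^ 2) * (t ^ 2 * B y) := by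
          have h3 : B y ^ 2 ≤ t ^ 2 * B y := by
            rw [pow_two]; exact mul_le_mul_of_nonneg_right (hBle y) (hB0 y)
          exact mul_le_mul h2 h3 (by positivity) (by positivity)
      _ = _ := by ring
  have i2 : M s₁ ^ 2 / 2 * β ≤ M s₁ * ∫ s in (0 : ℝ)..(2 * π), B (s - s₁) * M s := by
    rw [integral_eq_symm_of_periodic (f := fun s => B (s - s₁) * M s)
      (fun s => by have := hBp s; simp only at this; simp only [hMp s, this]) s₁, hβ,
      ← intervalIntegral.integral_const_mul, ← intervalIntegral.integral_const_mul]
    refine intervalIntegral.integral_mono_on (by linarith)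
      (Continuous.intervalIntegrable (by fun_prop) _ _)
      (Continuous.intervalIntegrable (by fun_prop) _ _) fun y hy => ?_
    rw [add_sub_cancel_left]
    rcases eq_or_ne (B y) 0 with h0 | h0
    · simp [h0]
    have h1 := hBsupp y (abs_le.2 hy) h0
    have h2 := hρ y (abs_lt_of_sq_lt_sq (h1.trans_lt htρ) hρ0.le)
    have := mul_le_mul_of_nonneg_right h2 (hB0 y)
    linarith
  -- The sign of `δ` makes the linear term negative, at most `-r β² (M s₁)²`; its size is
  -- proportional to the mass `β` of the bump.
  refine ⟨fun s => B (s - s₁), by fun_prop, hBp, -(r * β * M s₁), ?_⟩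
  have h1 : r * β * (M s₁ ^ 2 / 2 * β) ≤
      r * β * (M s₁ * ∫ s in (0 : ℝ)..(2 * π), B (s - s₁) * M s) :=
    mul_le_mul_of_nonneg_left i2 (by positivity)
  have h2 : β ^ 2 * M s₁ ^ 2 * (r ^ 2 * K) ≤ β ^ 2 * M s₁ ^ 2 * (r / 2) :=
    mul_le_mul_of_nonneg_left hrK (by positivity)
  have h3 : β * (80 * C ^ 2 * t) * t ^ 3 < β * (r * M s₁ ^ 2) * t ^ 3 := by gcongr
  have h4 : β * (r * M s₁ ^ 2) * (t ^ 3 / 2) ≤ β * (r * M s₁ ^ 2) * β :=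
    mul_le_mul_of_nonneg_left hβlow (by positivity)
  nlinarith

/-- Summation by parts for a shift. When `F` has period `T` the right side is zero, so `g - g (· -
T)` is orthogonal to `F`; this is the source of admissible variations on a multiple cover. -/
lemma integral_sub_shift_mul {E : Type*} [NormedAddCommGroup E] [NormedSpace ℝ E]
    {g : ℝ → ℝ} {F : ℝ → E} {T : ℝ} (hg : Continuous g) (hF : Continuous F)
    (hgp : Function.Periodic g (2 * π)) (hFp : Function.Periodic F (2 * π)) :
    ∫ s in (0 : ℝ)..(2 * π), (g s - g (s - T)) • F s =
      ∫ s in (0 : ℝ)..(2 * π), g s • (F s - F (s + T)) := by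
  have h1 := integral_shift_of_periodic (f := fun s => g (s - T) • F s) (fun s => by
    have := hgp (s - T)
    rw [show s - T + 2 * π = s + 2 * π - T by ring] at this
    simp only [this, hFp s]) T
  simp only [add_sub_cancel_right] at h1
  simp only [sub_smul, smul_sub]
  rw [intervalIntegral.integral_sub (Continuous.intervalIntegrable (by fun_prop) _ _)
    (Continuous.intervalIntegrable (by fun_prop) _ _), intervalIntegral.integral_sub
    (Continuous.intervalIntegrable (by fun_prop) _ _)
    (Continuous.intervalIntegrable (by fun_prop) _ _), h1]

/-- The second variation of a periodic oscillation of the pendulum takes negative values on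
admissible variations when the period divides the length properly. -/
lemma IsClosedAngle.exists_second_variation_neg {θ : ℝ → ℝ} {m : ℤ} (h : IsClosedAngle θ m)
    {μ c T s₁ : ℝ} (hd : ∀ s, HasDerivAt (deriv θ) (-(μ * sin (θ s - c))) s)
    (hT : Function.Periodic θ T) (hcosT : cos T ≠ 1) (hs₁ : deriv θ s₁ = 0)
    (hs₁' : μ * sin (θ s₁ - c) ≠ 0) :
    ∃ ψ : ℝ → ℝ, ContDiff ℝ 1 ψ ∧ Function.Periodic ψ (2 * π) ∧ endpointVariation θ ψ = 0 ∧
      ∫ s in (0 : ℝ)..(2 * π), (deriv ψ s ^ 2 - μ * cos (θ s - c) * ψ s ^ 2) < 0 := by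
  have hθ := h.contDiff.continuous
  have htc := continuous_tangent hθ
  set ω := deriv θ with hωdef
  have hω : Continuous ω := h.continuous_deriv
  have hωp : Function.Periodic ω (2 * π) := h.periodic_deriv
  have hωT : Function.Periodic ω T := EulerElastica.periodic_deriv hT
  set ω₁ : ℝ → ℝ := fun s => -(μ * sin (θ s - c)) with hω₁def
  have hω₁ : Continuous ω₁ := by simp only [hω₁def]; fun_prop
  -- The velocity `ω = θ'` is a Jacobi field: it solves the linearized pendulum equation.
  have hω₁d : ∀ s, HasDerivAt ω₁ (-(μ * cos (θ s - c) * ω s)) s := fun s => by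
    refine ((((h.hasDerivAt s).sub_const c).sin).const_mul μ).neg.congr_deriv ?_
    ring
  have hω₁p : Function.Periodic ω₁ (2 * π) := fun s => by
    simp only [hω₁def]
    rw [h.add_period, show θ s + m * (2 * π) - c = θ s - c + m * (2 * π) by ring,
      sin_add_int_mul_two_pi]
  have hω₁T : Function.Periodic ω₁ T := fun s => by simp only [hω₁def, hT s]
  -- Of the form `g - g (· - T)`, hence admissible. It is centred so that `χ s₁ = 1 - cos T ≠ 0`.
  set χ : ℝ → ℝ := fun s => cos (s - s₁) - cos (s - T - s₁) with hχdef
  set χ' : ℝ → ℝ := fun s => -sin (s - s₁) + sin (s - T - s₁) with hχ'def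
  have hχd : ∀ s, HasDerivAt χ (χ' s) s := fun s => by
    refine ((((hasDerivAt_id s).sub_const s₁).cos).sub
      ((((hasDerivAt_id s).sub_const T).sub_const s₁).cos)).congr_deriv ?_
    simp only [hχ'def, id]; ring
  have hχc : Continuous χ := by simp only [hχdef]; fun_prop
  have hχc' : Continuous χ' := by simp only [hχ'def]; fun_prop
  have hχp : Function.Periodic χ (2 * π) := fun s => by
    simp only [hχdef]
    rw [show s + 2 * π - s₁ = s - s₁ + 2 * π by ring,
      show s + 2 * π - T - s₁ = s - T - s₁ + 2 * π by ring, cos_add_two_pi, cos_add_two_pi]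
  have hχp' : Function.Periodic χ' (2 * π) := fun s => by
    simp only [hχ'def]
    rw [show s + 2 * π - s₁ = s - s₁ + 2 * π by ring,
      show s + 2 * π - T - s₁ = s - T - s₁ + 2 * π by ring, sin_add_two_pi, sin_add_two_pi]
  -- The Wronskian of `ω` and `χ`, which is the density of the cross term between `ω f` and `δ χ`
  -- once exact derivatives are dropped.
  set W : ℝ → ℝ := fun s => ω s * χ' s - ω₁ s * χ s with hWdef
  have hW : Continuous W := by simp only [hWdef]; fun_prop
  have hWp : Function.Periodic W (2 * π) := fun s => by
    simp only [hWdef, hωp s, hω₁p s, hχp s, hχp' s]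
  have hWsT : Function.Periodic (fun s => W (s + T)) (2 * π) := fun s => by
    simp only
    rw [show s + 2 * π + T = s + T + 2 * π by ring, hWp]
  set M : ℝ → ℝ := fun s => W s - W (s + T) with hMdef
  have hM : Continuous M := by simp only [hMdef]; fun_prop
  have hMp : Function.Periodic M (2 * π) := fun s => by
    have := hWsT s
    simp only at this
    simp only [hMdef, hWp s, this]
  -- At `s₁` only the terms `ω₁ χ` survive, and `χ` takes opposite values at `s₁` and `s₁ + T`, so
  -- they add up instead of cancelling.
  have hM₁ : M s₁ ≠ 0 := by
    have e : M s₁ = μ * sin (θ s₁ - c) * (2 * (1 - cos T)) := by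
      simp only [hMdef, hWdef, hωT s₁, hω₁T s₁, hs₁]
      simp only [hω₁def, hχdef]
      rw [show s₁ - T - s₁ = -T by ring, show s₁ + T - s₁ = T by ring,
        show s₁ + T - T - s₁ = 0 by ring, sub_self, cos_neg, cos_zero]
      ring
    rw [e]
    exact mul_ne_zero hs₁' (mul_ne_zero two_ne_zero (sub_ne_zero.2 hcosT.symm))
  have hωC : ∀ y, |ω (s₁ + y)| ≤ |μ| * |y| := fun y => by
    have := Convex.norm_image_sub_le_of_norm_hasDerivWithin_le (C := |μ|) (f := ω)
      (f' := ω₁) (s := Set.univ) (x := s₁) (y := s₁ + y)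
      (fun s _ => (hd s).hasDerivWithinAt) (fun s _ => by
        simp only [hω₁def, norm_neg, norm_mul, Real.norm_eq_abs]
        exact mul_le_of_le_one_right (abs_nonneg _) (abs_sin_le_one _))
      convex_univ trivial trivial
    rwa [hs₁, sub_zero, add_sub_cancel_left, Real.norm_eq_abs, Real.norm_eq_abs] at this
  set q := ∫ s in (0 : ℝ)..(2 * π), (χ' s ^ 2 - μ * cos (θ s - c) * χ s ^ 2) with hq
  obtain ⟨b, hb, hbp, δ, hneg⟩ := exists_concentrated hω hM hωp hMp hωC hM₁ (abs_nonneg q)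
  -- The difference gives `β` mean zero, so that its primitive `f` is periodic, and makes `β`
  -- orthogonal to the tangent.
  set β : ℝ → ℝ := fun s => b s - b (s - T) with hβdef
  have hβ : Continuous β := by simp only [hβdef]; fun_prop
  have hbTp : Function.Periodic (fun s => b (s - T)) (2 * π) := fun s => by
    simp only
    rw [show s + 2 * π - T = s - T + 2 * π by ring, hbp]
  have hβp : Function.Periodic β (2 * π) := fun s => by
    have := hbTp s
    simp only at this
    simp only [hβdef, hbp s, this]
  have hβ0 : ∫ s in (0 : ℝ)..(2 * π), β s = 0 := by
    have := integral_sub_shift_mul (T := T) (F := fun _ => (1 : ℝ)) hb continuous_const hbp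
      (fun _ => rfl)
    simpa using this
  set f : ℝ → ℝ := fun s => ∫ r in (0 : ℝ)..s, β r with hfdef
  have hfd : ∀ s, HasDerivAt f (β s) s := hasDerivAt_integral hβ 0
  have hfc : Continuous f := continuous_iff_continuousAt.2 fun s => (hfd s).continuousAt
  have hfp : Function.Periodic f (2 * π) := fun s => by
    simp only [hfdef]
    rw [← intervalIntegral.integral_add_adjacent_intervals (hβ.intervalIntegrable 0 s)
      (hβ.intervalIntegrable _ _), hβp.intervalIntegral_add_eq s 0, zero_add, hβ0, add_zero]
  have hψd : ∀ s, HasDerivAt (fun s => ω s * f s + δ * χ s)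
      ((ω₁ s * f s + ω s * β s) + δ * χ' s) s := fun s =>
    ((hd s).mul (hfd s)).add ((hχd s).const_mul δ)
  have hTp : Function.Periodic (tangent θ) T := fun s => by simp only [tangent, hT s]
  refine ⟨fun s => ω s * f s + δ * χ s, contDiff_one_of_hasDerivAt hψd (by fun_prop),
    fun s => by simp only [hωp s, hfp s, hχp s], ?_, ?_⟩
  · have e1 : endpointVariation θ χ = 0 := by
      have := integral_sub_shift_mul (T := T) (g := fun s => cos (s - s₁)) (F := tangent θ)
        (by fun_prop) htc (fun s => by
          simp only; rw [show s + 2 * π - s₁ = s - s₁ + 2 * π by ring, cos_add_two_pi])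
        h.periodic_tangent
      simp only [hTp _, sub_self, smul_zero, intervalIntegral.integral_zero,
        Complex.real_smul] at this
      exact this
    have e2 : ∫ s in (0 : ℝ)..(2 * π), (β s : ℂ) * tangent θ s = 0 := by
      have := integral_sub_shift_mul (T := T) (F := tangent θ) hb htc hbp h.periodic_tangent
      simp only [hTp _, sub_self, smul_zero, intervalIntegral.integral_zero,
        Complex.real_smul] at this
      exact this
    -- Since `ω exp (iθ)` is `-i` times the derivative of `exp (iθ)`, integration by parts moves the
    -- derivative to `f` and leaves `∫ β exp (iθ) = 0`.
    have e3 : endpointVariation θ (fun s => ω s * f s) = 0 := by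
      have ht : ∀ s, HasDerivAt (tangent θ) ((ω s : ℂ) * Complex.I * tangent θ s) s :=
        fun s => hasDerivAt_tangent (h.hasDerivAt s)
      have h1 := integral_eq_zero_of_periodic
        (fun s => (hfd s).ofReal_comp.mul (ht s)) (by fun_prop)
        (fun s => by simp only [Pi.mul_apply, hfp s, h.periodic_tangent s])
      rw [intervalIntegral.integral_add (Continuous.intervalIntegrable (by fun_prop) _ _)
        (Continuous.intervalIntegrable (by fun_prop) _ _), e2, zero_add] at h1
      have h2 : ∫ s in (0 : ℝ)..(2 * π), (f s : ℂ) * ((ω s : ℂ) * Complex.I * tangent θ s) =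
          Complex.I * endpointVariation θ (fun s => ω s * f s) := by
        rw [endpointVariation, ← intervalIntegral.integral_const_mul]
        congr 1
        funext s
        push_cast; ring
      rw [h2] at h1
      exact (mul_eq_zero.1 h1).resolve_left Complex.I_ne_zero
    have := endpointVariation_add_mul hθ (hω.fun_mul hfc) hχc 1 δ
    simp only [one_mul] at this
    rw [this, e1]
    simpa using e3
  · have hdp : ∀ s, deriv (fun s => ω s * f s + δ * χ s) s =
        (ω₁ s * f s + ω s * β s) + δ * χ' s := fun s => (hψd s).deriv
    simp only [hdp]
    -- The exact derivative that completes the square for a Jacobi field: after removing it, `ω f`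
    -- contributes `ω² β²` and the cross term `2 δ β W`.
    have hE : ∀ s, HasDerivAt (fun s => ω s * ω₁ s * f s ^ 2 + 2 * δ * (ω₁ s * f s * χ s))
        (ω₁ s ^ 2 * f s ^ 2 - μ * cos (θ s - c) * ω s ^ 2 * f s ^ 2 + 2 * ω s * ω₁ s * f s * β s +
        2 * δ * (-(μ * cos (θ s - c) * ω s) * f s * χ s + ω₁ s * β s * χ s +
          ω₁ s * f s * χ' s)) s := fun s => by
      refine ((((hd s).mul (hω₁d s)).mul ((hfd s).pow 2)).add
        ((((hω₁d s).mul (hfd s)).mul (hχd s)).const_mul (2 * δ))).congr_deriv ?_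
      simp only [Pi.mul_apply, Pi.pow_apply, hω₁def]
      push_cast
      ring
    have hEi := integral_eq_zero_of_periodic hE (by fun_prop) (fun s => by
      simp only [hωp s, hω₁p s, hfp s, hχp s])
    have hsplit : ∀ s, ((ω₁ s * f s + ω s * β s) + δ * χ' s) ^ 2 -
        μ * cos (θ s - c) * (ω s * f s + δ * χ s) ^ 2 =
        (ω₁ s ^ 2 * f s ^ 2 - μ * cos (θ s - c) * ω s ^ 2 * f s ^ 2 + 2 * ω s * ω₁ s * f s * β s +
        2 * δ * (-(μ * cos (θ s - c) * ω s) * f s * χ s + ω₁ s * β s * χ s +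
          ω₁ s * f s * χ' s)) + ((ω s ^ 2 * β s ^ 2 + 2 * δ * (β s • W s)) +
        δ ^ 2 * (χ' s ^ 2 - μ * cos (θ s - c) * χ s ^ 2)) := fun s => by
      simp only [hWdef, smul_eq_mul]; ring
    simp only [hsplit]
    rw [intervalIntegral.integral_add (Continuous.intervalIntegrable (by fun_prop) _ _)
      (Continuous.intervalIntegrable (by fun_prop) _ _), hEi, zero_add,
      intervalIntegral.integral_add (Continuous.intervalIntegrable (by fun_prop) _ _)
      (Continuous.intervalIntegrable (by fun_prop) _ _), intervalIntegral.integral_add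
      (Continuous.intervalIntegrable (by fun_prop) _ _)
      (Continuous.intervalIntegrable (by fun_prop) _ _), intervalIntegral.integral_const_mul,
      intervalIntegral.integral_const_mul, ← hq, integral_sub_shift_mul hb hW hbp hWp]
    -- Since `ω` has period `T`, the bump and its translate carry the same weight; `(b - b')² ≤ 2 b²
    -- + 2 b'²` produces the factor `4`.
    have hβ2 : ∫ s in (0 : ℝ)..(2 * π), ω s ^ 2 * β s ^ 2 ≤
        4 * ∫ s in (0 : ℝ)..(2 * π), ω s ^ 2 * b s ^ 2 := by
      have hsh := integral_shift_of_periodic (f := fun s => ω s ^ 2 * b (s - T) ^ 2) (fun s => by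
        have := hbTp s
        simp only at this
        simp only [hωp s, this]) T
      simp only [add_sub_cancel_right, hωT _] at hsh
      have hle : ∫ s in (0 : ℝ)..(2 * π), ω s ^ 2 * β s ^ 2 ≤
          ∫ s in (0 : ℝ)..(2 * π), (2 * (ω s ^ 2 * b s ^ 2) + 2 * (ω s ^ 2 * b (s - T) ^ 2)) := by
        refine intervalIntegral.integral_mono_on (by positivity)
          (Continuous.intervalIntegrable (by fun_prop) _ _)
          (Continuous.intervalIntegrable (by fun_prop) _ _) fun s _ => ?_
        have : β s ^ 2 ≤ 2 * b s ^ 2 + 2 * b (s - T) ^ 2 := by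
          simp only [hβdef]; nlinarith [sq_nonneg (b s + b (s - T))]
        nlinarith [mul_le_mul_of_nonneg_left this (sq_nonneg (ω s))]
      rw [intervalIntegral.integral_add (Continuous.intervalIntegrable (by fun_prop) _ _)
        (Continuous.intervalIntegrable (by fun_prop) _ _), intervalIntegral.integral_const_mul,
        intervalIntegral.integral_const_mul, ← hsh] at hle
      linarith
    have hqle : δ ^ 2 * q ≤ δ ^ 2 * |q| := mul_le_mul_of_nonneg_left (le_abs_self q) (sq_nonneg δ)
    simp only [smul_eq_mul]
    simp only [hMdef] at hneg
    linarith

theorem bernoulliTimes_not_stable {n : ℕ} (hn : 2 ≤ n) {γ : ℝ → ℂ}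
    (h : SameShape γ (bernoulliTimes n)) : γ ∈ Curves ∧ ¬ IsLocalMinimum γ := by
  have hn1 : 1 ≤ n := by omega
  have hn0 : (n : ℝ) ≠ 0 := by positivity
  obtain ⟨hk, -⟩ := bernoulliModulus_spec
  set k := bernoulliModulus with hkdef
  have hsc := elasticaScale_pos hk
  set μ : ℝ := n ^ 2 * (elasticaScale k ^ 2)⁻¹ with hμ
  have hμ0 : 0 < μ := by positivity
  have hα := hasDerivAt_bernoulliAngle n
  have hα' : ∀ s, HasDerivAt (fun s => n * elasticaCurvature k (n * s))
      (-(μ * sin (bernoulliAngle n s))) s := fun s => by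
    have h1 : HasDerivAt (fun t : ℝ => (n : ℝ) * t) n s := by
      simpa using (hasDerivAt_id s).const_mul (n : ℝ)
    refine (((hasDerivAt_elasticaCurvature hk (n * s)).comp s h1).const_mul (n : ℝ)).congr_deriv ?_
    rw [bernoulliAngle, ← hkdef, hμ]; ring
  have hαT : Function.Periodic (bernoulliAngle n) (2 * π / n) := fun s => by
    rw [bernoulliAngle, mul_add, mul_div_cancel₀ _ hn0, periodic_elasticaAngle hk]
    rfl
  -- The place where `n ≥ 2` enters: the period `2π / n` is at most `π`.
  have hcosT : cos (2 * π / n) ≠ 1 := by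
    have hn2 : (2 : ℝ) ≤ n := by exact_mod_cast hn
    have h1 : 2 * π / n ≤ π := by
      rw [div_le_iff₀ (by positivity)]; nlinarith [pi_pos]
    have h2 := cos_lt_cos_of_nonneg_of_le_pi le_rfl h1 (by positivity : (0 : ℝ) < 2 * π / n)
    rw [cos_zero] at h2
    exact h2.ne
  -- Amplitude `π / 2` is a turning point of the oscillation: the curvature vanishes there and the
  -- restoring force does not.
  set s₁ := elasticaArclength k (π / 2) / n with hs₁
  have hamp : elasticaAmplitude k (n * s₁) = π / 2 := by
    rw [hs₁, mul_div_cancel₀ _ hn0, (elasticaAmplitude_spec hk).2.1]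
  have hcurv : elasticaCurvature k (n * s₁) = 0 := by
    rw [elasticaCurvature, hamp, cos_pi_div_two]; simp
  have hsin : μ * sin (bernoulliAngle n s₁) ≠ 0 := by
    refine mul_ne_zero hμ0.ne' ?_
    rw [bernoulliAngle, ← hkdef, sin_elasticaAngle hk, hamp, sin_pi_div_two]
    have := elasticaDelta_pos hk (π / 2)
    have := hk.1
    exact neg_ne_zero.2 (by positivity)
  obtain ⟨z₀, hb⟩ := hasAngle_bernoulliTimes hn1
  have main : ∀ (z : ℂ) (θ : ℝ → ℝ) (m : ℤ) (σ : ℝ → ℝ) (c : ℝ), HasAngle γ z θ m σ →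
      (∀ s, HasDerivAt (deriv θ) (-(μ * sin (θ s - c))) s) → Function.Periodic θ (2 * π / n) →
      deriv θ s₁ = 0 → μ * sin (θ s₁ - c) ≠ 0 → γ ∈ Curves ∧ ¬ IsLocalMinimum γ :=
    fun z θ m σ c hγ hd hT h1 h2 => by
      obtain ⟨ψ, hψ, hψp, hψ0, hQ⟩ :=
        hγ.angle.exists_second_variation_neg hd hT hcosT h1 h2
      exact ⟨hγ.mem_curves, hγ.not_isLocalMinimum hμ0.le hd hψ hψp hψ0 hQ⟩
  obtain ⟨z, c, σ, h1 | h1⟩ := h.hasAngle hb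
  · have hderiv : deriv (fun s => bernoulliAngle n s + c) = fun s => n * elasticaCurvature k (n * s) :=
      funext fun s => ((hα s).add_const c).deriv
    refine main _ _ _ _ c h1 (fun s => ?_) (fun s => by simp only [hαT s]) ?_ ?_
    · rw [hderiv, add_sub_cancel_right]; exact hα' s
    · rw [hderiv]; simp [hcurv]
    · rwa [add_sub_cancel_right]
  · have hderiv : deriv (fun s => c - bernoulliAngle n s) =
        fun s => -(n * elasticaCurvature k (n * s)) :=
      funext fun s => ((hα s).const_sub c).deriv
    have hsub : ∀ s, c - bernoulliAngle n s - c = -bernoulliAngle n s := fun s => by ring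
    refine main _ _ _ _ c h1 (fun s => ?_) (fun s => by simp only [hαT s]) ?_ ?_
    · rw [hderiv, hsub, sin_neg, mul_neg]; exact (hα' s).neg
    · rw [hderiv]; simp [hcurv]
    · rw [hsub, sin_neg, mul_neg]; exact neg_ne_zero.2 hsin

end EulerElastica

theorem theorem1p3 :
    -- (i) every critical curve is a multiply traversed circle or Bernoulli elastica
    (∀ γ : ℝ → ℂ, EulerElastica.IsCritical γ →
      ∃ n : ℕ, 1 ≤ n ∧ (EulerElastica.SameShape γ (EulerElastica.circleTimes n) ∨
        EulerElastica.SameShape γ (EulerElastica.bernoulliTimes n))) ∧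
    -- (ii) the Bernoulli elastica traversed more than once is not stable
    (∀ (n : ℕ) (γ : ℝ → ℂ), 2 ≤ n →
      EulerElastica.SameShape γ (EulerElastica.bernoulliTimes n) →
        γ ∈ EulerElastica.Curves ∧ ¬ EulerElastica.IsLocalMinimum γ) ∧
    -- (iii) circles traversed any number of times are local minima
    (∀ (n : ℕ) (γ : ℝ → ℂ), 1 ≤ n →
      EulerElastica.SameShape γ (EulerElastica.circleTimes n) →
        γ ∈ EulerElastica.Curves ∧ EulerElastica.IsLocalMinimum γ) ∧
    -- (iii) the Bernoulli elastica traversed once is a local minimum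
    (∀ γ : ℝ → ℂ, EulerElastica.SameShape γ (EulerElastica.bernoulliTimes 1) →
      γ ∈ EulerElastica.Curves ∧ EulerElastica.IsLocalMinimum γ) :=
  ⟨fun _ hγ => hγ.classification, fun _ _ hn h => EulerElastica.bernoulliTimes_not_stable hn h,
    fun _ _ hn h => EulerElastica.circleTimes_stable hn h,
    fun _ h => EulerElastica.bernoulli_stable h⟩
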